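/- **Model.** Let $n\ge 0$ and $T\ge 1$. Agent $0$ is the major agent and $i\in N=\{1,\dots,n\}$ are the minor agents. Agent $i$ has state $x_i(t)\in\mathbb R^{d^i_x}$ and control $u_i(t)\in\mathbb R^{d^i_u}$; put $x=\mathrm{vec}(x_0,\dots,x_n)$, $u=\mathrm{vec}(u_0,\dots,u_n)$, $w=\mathrm{vec}(w_0,\dots,w_n)$. The dynamics are $x(t+1)=Ax(t)+Bu(t)+w(t)$, where the only possibly nonzero blocks of $A$ and $B$ are $A_{i0},A_{ii},B_{i0},B_{ii}$ ($0\le i\le n$), and minor agent $i$ has the output $y_i(t)=C_{ii}x_i(t)+v_i(t)\in\mathbb R^{d_y^i}$. The initial states $x_i(1)$, the process noises $w_i(t)$ and the observation noises $v_i(t)$, $1\le t\le T$, are independent, with zero mean and finite variance. The information of the agents is $$I_0(t)=I^c(t)=\{x_0(1{:}t),u_0(1{:}t-1)\},\qquad I_i(t)=\{x_0(1{:}t),y_i(1{:}t),u_0(1{:}t-1),u_i(1{:}t-1)\}\ (i\in N).$$ A (general) strategy $g$ consists of measurable control laws, $u_i(t)=g_{i,t}(I_i(t))$, $0\le i\le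 n$. Its cost is $$J(g)=\mathbb E\Big[\sum_{t=1}^{T-1}\big(x(t)^{\top}Qx(t)+u(t)^{\top}Ru(t)\big)+x(T)^{\top}Q_Tx(T)\Big]\in[0,\infty],$$ with $Q,Q_T$ symmetric positive semidefinite and $R$ symmetric positive definite; $g$ is optimal if it minimizes $J$ over all strategies. **Gains.** Let $\mathcal R(P,A,B,Q,R)=Q+A^{\top}PA-A^{\top}PB(R+B^{\top}PB)^{-1}B^{\top}PA$ and $\mathcal G(P,A,B,R)=(R+B^{\top}PB)^{-1}B^{\top}PA$. Put $S^c(T)=Q_T$, $S^\ell_i(T)=[Q_T]_{ii}$ and, for $t=T-1,\dots,1$, $$S^c(t)=\mathcal R(S^c(t+1),A,B,Q,R),\qquad S^\ell_i(t)=\mathcal R(S^\ell_i(t+1),A_{ii},B_{ii},Q_{ii},R_{ii}),$$ $$L^c(t)=\mathcal G(S^c(t+1),A,B,R),\qquad L^\ell_i(t)=\mathcal G(S^\ell_i(t+1),A_{ii},B_{ii},R_{ii}),$$ and let $L^c_i(t)$ be the $i$-th block row of $L^c(t)$. For a given strategy put $\hat x(t|c)=\mathbb E[x(t)\mid I^c(t)]$,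 $\hat x(t|i)=\mathbb E[x(t)\mid I_i(t)]$, $u^c(t)=\mathbb E[u(t)\mid I^c(t)]$, and let the subscript $i$ denote the $i$-th component of these vectors. **Theorem.** 1. *Optimal strategy.* An optimal strategy exists. A strategy is optimal if and only if, almost surely for all $1\le t\le T-1$, $$u_0(t)=-L^c_0(t)\,\hat x(t|c),\qquad u_i(t)=-L^c_i(t)\,\hat x(t|c)-L^\ell_i(t)\big(\hat x_i(t|i)-\hat x_i(t|c)\big)\quad(i\in N).$$ An optimal strategy has finite cost, $\mathbb E\|u(t)\|^2<\infty$ and $u^c(t)=-L^c(t)\hat x(t|c)$ a.s. for $1\le t\le T-1$. The optimal strategy is unique: for two optimal strategies $g,g'$ and $1\le t\le T-1$, the control actions agree almost surely, and $g_{i,t}=g'_{i,t}$ almost everywhere with respect to the law of $I_i(t)$, $0\le i\le n$. 2. *Major agent's estimate.* For every strategy with integrable control actions at the times $1,\dots,T-1$ one has, almost surely, $\hat x(1|c)=\mathrm{vec}(x_0(1),0,\dots,0)$ and, for $1\le t\le T-1$, $$\hat x(t+1|c)=A\begin{bmatrix}x_0(t)\\ \hat x_1(t|c)\\ \vdots\\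 \hat x_n(t|c)\end{bmatrix}+B\begin{bmatrix}u_0(t)\\ u^c_1(t)\\ \vdots\\ u^c_n(t)\end{bmatrix}+\begin{bmatrix}w_0(t)\\0\\ \vdots\\0\end{bmatrix},\qquad w_0(t)=x_0(t+1)-A_{00}x_0(t)-B_{00}u_0(t).$$ 3. *Minor agent's estimate.* For every strategy with integrable control actions at the times $1,\dots,T-1$, every $i\in N$ and $1\le t\le T$: if $f_{i,t}$ is a conditional density of $x_i(t)$ given $I_i(t)$, then almost surely $\hat x_i(t|i)=\int x\,f_{i,t}(x)\,dx$, where the integrand is integrable. 4. *Bayesian filter.* Let the strategy be arbitrary and $i\in N$. If $x_i(1)$ and $v_i(1)$ have densities $\xi_i$ and $\nu_i$, then $f_{i,1}(x)=\nu_i(y_i(1)-C_{ii}x)\,\xi_i(x)\big/\int\nu_i(y_i(1)-C_{ii}x')\,\xi_i(x')\,dx'$ is a conditional density of $x_i(1)$ given $I_i(1)$. If $2\le t\le T$, if $w_0(t-1)$, $w_i(t-1)$ and $v_i(t)$ have densities $\varphi_0$, $\varphi_i$ and $\nu_i$, and if $f_{i,t-1}$ is a conditional density of $x_i(t-1)$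 given $I_i(t-1)$, then $$f_{i,t}(x)=\frac{\beta_i(x)\int\gamma_i(x,x')\,\gamma_0\,f_{i,t-1}(x')\,dx'}{\int\beta_i(z)\int\gamma_i(z,x')\,\gamma_0\,f_{i,t-1}(x')\,dx'\,dz}$$ is a conditional density of $x_i(t)$ given $I_i(t)$, where $$\beta_i(x)=\nu_i\big(y_i(t)-C_{ii}x\big),\qquad \gamma_0=\varphi_0\big(x_0(t)-A_{00}x_0(t-1)-B_{00}u_0(t-1)\big),$$ $$\gamma_i(x,x')=\varphi_i\big(x-A_{ii}x'-A_{i0}x_0(t-1)-B_{ii}u_i(t-1)-B_{i0}u_0(t-1)\big).$$ In particular the update does not depend on the strategy. -/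

import Mathlib

open MeasureTheory ProbabilityTheory

open scoped ENNReal Matrix

noncomputable section

namespace MajorMinor

/-! ### Block vectors and matrices -/

/-- The vector `vec(x_0, …, x_n)` obtained by stacking the vectors `x_i ∈ ℝ^{d_i}`. -/
def stack {n : ℕ} {d : Fin (n + 1) → ℕ} (x : (i : Fin (n + 1)) → Fin (d i) → ℝ) :
    (Σ i, Fin (d i)) → ℝ :=
  fun p => x p.1 p.2

/-- The `i`-th component `x_i` of a stacked vector. -/
def comp {n : ℕ} {d : Fin (n + 1) → ℕ} (x : (Σ i, Fin (d i)) → ℝ) (i : Fin (n + 1)) :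
    Fin (d i) → ℝ :=
  fun k => x ⟨i, k⟩

/-- The vector `vec(a, b_1, …, b_n)`, with a major component `a` and minor components `b_i`. -/
def stackMM {n : ℕ} {d : Fin (n + 1) → ℕ} (a : Fin (d 0) → ℝ)
    (b : (i : Fin n) → Fin (d i.succ) → ℝ) : (Σ i, Fin (d i)) → ℝ :=
  stack (Fin.cons (α := fun i => Fin (d i) → ℝ) a b)

/-- The block `M_{ij}`. -/
def block {n : ℕ} {d e : Fin (n + 1) → ℕ}
    (M : Matrix (Σ i, Fin (d i)) (Σ i, Fin (e i)) ℝ) (i j : Fin (n + 1)) :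
    Matrix (Fin (d i)) (Fin (e j)) ℝ :=
  M.submatrix (fun k => ⟨i, k⟩) (fun k => ⟨j, k⟩)

/-- The block row `M_i`. -/
def blockRow {n : ℕ} {d e : Fin (n + 1) → ℕ}
    (M : Matrix (Σ i, Fin (d i)) (Σ i, Fin (e i)) ℝ) (i : Fin (n + 1)) :
    Matrix (Fin (d i)) (Σ i, Fin (e i)) ℝ :=
  M.submatrix (fun k => ⟨i, k⟩) id

/-! ### The Riccati and gain operators -/

/-- `Q + Aᵀ P A - Aᵀ P B (R + Bᵀ P B)⁻¹ Bᵀ P A`. -/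
def riccatiOp {X U : Type*} [Fintype X] [Fintype U] [DecidableEq U]
    (P A : Matrix X X ℝ) (B : Matrix X U ℝ) (Q : Matrix X X ℝ) (R : Matrix U U ℝ) :
    Matrix X X ℝ :=
  Q + Aᵀ * P * A - Aᵀ * P * B * (R + Bᵀ * P * B)⁻¹ * Bᵀ * P * A

/-- `(R + Bᵀ P B)⁻¹ Bᵀ P A`. -/
def gainOp {X U : Type*} [Fintype X] [Fintype U] [DecidableEq U]
    (P A : Matrix X X ℝ) (B : Matrix X U ℝ) (R : Matrix U U ℝ) : Matrix U X ℝ :=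
  (R + Bᵀ * P * B)⁻¹ * Bᵀ * P * A

/-- The backward Riccati recursion: the matrix that is reached `k` steps before the terminal
time, when the terminal value is `QT`. -/
def riccatiSeq {X U : Type*} [Fintype X] [Fintype U] [DecidableEq U]
    (A : Matrix X X ℝ) (B : Matrix X U ℝ) (Q : Matrix X X ℝ) (R : Matrix U U ℝ)
    (QT : Matrix X X ℝ) : ℕ → Matrix X X ℝ
  | 0 => QT
  | k + 1 => riccatiOp (riccatiSeq A B Q R QT k) A B Q R

/-! ### The system -/

/-- A linear quadratic system with one major agent (index `0`) and `n` minor agents. The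
minor agent `i : Fin n` has the index `i.succ` among all the agents. -/
structure System (n : ℕ) where
  /-- dimensions of the states -/
  dx : Fin (n + 1) → ℕ
  /-- dimensions of the control actions -/
  du : Fin (n + 1) → ℕ
  /-- dimensions of the outputs of the minor agents -/
  dy : Fin n → ℕ
  A : Matrix (Σ i, Fin (dx i)) (Σ i, Fin (dx i)) ℝ
  B : Matrix (Σ i, Fin (dx i)) (Σ i, Fin (du i)) ℝ
  C : (i : Fin n) → Matrix (Fin (dy i)) (Fin (dx i.succ)) ℝ
  Q : Matrix (Σ i, Fin (dx i)) (Σ i, Fin (dx i)) ℝ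
  QT : Matrix (Σ i, Fin (dx i)) (Σ i, Fin (dx i)) ℝ
  R : Matrix (Σ i, Fin (du i)) (Σ i, Fin (du i)) ℝ
  /-- only the blocks `A_{i0}` and `A_{ii}` can be nonzero -/
  A_sparse : ∀ i j, j ≠ 0 → j ≠ i → block A i j = 0
  /-- only the blocks `B_{i0}` and `B_{ii}` can be nonzero -/
  B_sparse : ∀ i j, j ≠ 0 → j ≠ i → block B i j = 0
  Q_posSemidef : Q.PosSemidef
  QT_posSemidef : QT.PosSemidef
  R_posDef : R.PosDef

namespace System

variable {n : ℕ} (S : System n)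

abbrev State : Type := (Σ i, Fin (S.dx i)) → ℝ

abbrev Control : Type := (Σ i, Fin (S.du i)) → ℝ

/-- The global Riccati matrix `S^c(t)`, `1 ≤ t ≤ T`. -/
def riccatiC (T t : ℕ) : Matrix (Σ i, Fin (S.dx i)) (Σ i, Fin (S.dx i)) ℝ :=
  riccatiSeq S.A S.B S.Q S.R S.QT (T - t)

/-- The global gain `L^c(t)`, `1 ≤ t < T`. -/
def gainC (T t : ℕ) : Matrix (Σ i, Fin (S.du i)) (Σ i, Fin (S.dx i)) ℝ :=
  gainOp (S.riccatiC T (t + 1)) S.A S.B S.R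

/-- The local Riccati matrix `S^ℓ_i(t)`, `1 ≤ t ≤ T`, of a minor agent. -/
def riccatiL (T : ℕ) (i : Fin n) (t : ℕ) :
    Matrix (Fin (S.dx i.succ)) (Fin (S.dx i.succ)) ℝ :=
  riccatiSeq (block S.A i.succ i.succ) (block S.B i.succ i.succ) (block S.Q i.succ i.succ)
    (block S.R i.succ i.succ) (block S.QT i.succ i.succ) (T - t)

/-- The local gain `L^ℓ_i(t)`, `1 ≤ t < T`, of a minor agent. -/
def gainL (T : ℕ) (i : Fin n) (t : ℕ) :
    Matrix (Fin (S.du i.succ)) (Fin (S.dx i.succ)) ℝ :=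
  gainOp (S.riccatiL T i (t + 1)) (block S.A i.succ i.succ) (block S.B i.succ i.succ)
    (block S.R i.succ i.succ)

/-- Values of the information `I_0(t) = (x_0(1:t), u_0(1:t-1))` of the major agent. -/
abbrev InfoMajor (t : ℕ) : Type :=
  (Finset.Icc 1 t → Fin (S.dx 0) → ℝ) × (Finset.Ico 1 t → Fin (S.du 0) → ℝ)

/-- Values of the information `I_i(t) = (x_0(1:t), y_i(1:t), u_0(1:t-1), u_i(1:t-1))` of a
minor agent. -/
abbrev InfoMinor (i : Fin n) (t : ℕ) : Type :=
  (Finset.Icc 1 t → Fin (S.dx 0) → ℝ) × (Finset.Icc 1 t → Fin (S.dy i) → ℝ) ×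
    (Finset.Ico 1 t → Fin (S.du 0) → ℝ) × (Finset.Ico 1 t → Fin (S.du i.succ) → ℝ)

/-- A general control strategy: measurable control laws `g_{0,t}` and `g_{i,t}`. Only the laws
at the times `1 ≤ t < T` have an effect on the cost. -/
structure Strategy where
  major : (t : ℕ) → S.InfoMajor t → Fin (S.du 0) → ℝ
  minor : (i : Fin n) → (t : ℕ) → S.InfoMinor i t → Fin (S.du i.succ) → ℝ
  measurable_major : ∀ t, Measurable (major t)
  measurable_minor : ∀ i t, Measurable (minor i t)

/-- The index set of the primitive random variables up to time `T`: the initial states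
`x_i(1)`, the process noises `w_i(t)` and the observation noises `v_i(t)`, `1 ≤ t ≤ T`. -/
abbrev PrimIndex (_S : System n) (T : ℕ) : Type :=
  Fin (n + 1) ⊕ (Fin (n + 1) × Finset.Icc 1 T) ⊕ (Fin n × Finset.Icc 1 T)

/-- The dimension of a primitive random variable. -/
def primDim (T : ℕ) : S.PrimIndex T → ℕ
  | .inl i => S.dx i
  | .inr (.inl (i, _)) => S.dx i
  | .inr (.inr (i, _)) => S.dy i

end System

/-! ### Primitive random variables -/

/-- The primitive random variables of a system on a sample space `Ω`. -/
structure Primitives {n : ℕ} (S : System n) (Ω : Type*) where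
  /-- the initial states `x_i(1)` -/
  init : (i : Fin (n + 1)) → Ω → Fin (S.dx i) → ℝ
  /-- the process noises `w_i(t)` -/
  w : (i : Fin (n + 1)) → ℕ → Ω → Fin (S.dx i) → ℝ
  /-- the observation noises `v_i(t)` -/
  v : (i : Fin n) → ℕ → Ω → Fin (S.dy i) → ℝ

namespace Primitives

variable {n : ℕ} {S : System n} {Ω : Type*} (P : Primitives S Ω)

/-- All primitive random variables up to time `T`, as one family. -/
def family (T : ℕ) : (k : S.PrimIndex T) → Ω → Fin (S.primDim T k) → ℝ
  | .inl i => P.init i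
  | .inr (.inl (i, t)) => P.w i t
  | .inr (.inr (i, t)) => P.v i t

/-- The primitive random variables up to time `T` are independent and have zero mean and finite
variance. -/
structure Admissible [MeasurableSpace Ω] (T : ℕ) (μ : Measure Ω) : Prop where
  measurable : ∀ k, Measurable (P.family T k)
  memLp : ∀ k, MemLp (P.family T k) 2 μ
  mean_zero : ∀ k, ∫ ω, P.family T k ω ∂μ = 0
  indep : iIndepFun (P.family T) μ

/-! ### Closed-loop processes -/

/-- The states `x(1) = vec(x_0(1), …, x_n(1))`, `x(t+1) = A x(t) + B u(t) + w(t)` that result from a sequence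
`u(1), u(2), …` of control actions (the value at time `0` is not used). -/
def stateOf (ω : Ω) (u : ℕ → S.Control) : ℕ → S.State
  | 0 => 0
  | 1 => stack fun i => P.init i ω
  | t + 2 => S.A *ᵥ stateOf ω u (t + 1) + S.B *ᵥ u (t + 1) + stack fun i => P.w i (t + 1) ω

/-- The outputs `y_i(t) = C_{ii} x_i(t) + v_i(t)`. -/
def outputOf (ω : Ω) (u : ℕ → S.Control) (i : Fin n) (t : ℕ) : Fin (S.dy i) → ℝ :=
  S.C i *ᵥ comp (P.stateOf ω u t) i.succ + P.v i t ω

/-- `I_0(t)`, for a sequence of control actions. -/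
def infoMajorOf (ω : Ω) (u : ℕ → S.Control) (t : ℕ) : S.InfoMajor t :=
  (fun s => comp (P.stateOf ω u s) 0, fun s => comp (u s) 0)

/-- `I_i(t)`, for a sequence of control actions. -/
def infoMinorOf (ω : Ω) (u : ℕ → S.Control) (i : Fin n) (t : ℕ) : S.InfoMinor i t :=
  (fun s => comp (P.stateOf ω u s) 0, fun s => P.outputOf ω u i s,
    fun s => comp (u s) 0, fun s => comp (u s) i.succ)

/-- The control actions generated by the strategy `g` up to time `t` (and `0` afterwards). The
action at time `t + 1` is chosen from the information at time `t + 1`, which involves only the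
actions up to time `t`. -/
def controlUpTo (g : S.Strategy) (ω : Ω) : ℕ → ℕ → S.Control
  | 0 => 0
  | t + 1 => Function.update (controlUpTo g ω t) (t + 1)
      (stackMM (g.major (t + 1) (P.infoMajorOf ω (controlUpTo g ω t) (t + 1)))
        fun i => g.minor i (t + 1) (P.infoMinorOf ω (controlUpTo g ω t) i (t + 1)))

/-- The control actions `u(t)` under the strategy `g`. -/
def control (g : S.Strategy) (t : ℕ) (ω : Ω) : S.Control := P.controlUpTo g ω t t

/-- The states `x(t)` under the strategy `g`. -/
def state (g : S.Strategy) (t : ℕ) (ω : Ω) : S.State :=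
  P.stateOf ω (fun s => P.control g s ω) t

/-- The information `I_0(t)` under the strategy `g`. It is also the common information
`I^c(t)`. -/
def infoMajor (g : S.Strategy) (t : ℕ) (ω : Ω) : S.InfoMajor t :=
  P.infoMajorOf ω (fun s => P.control g s ω) t

/-- The information `I_i(t)` under the strategy `g`. -/
def infoMinor (g : S.Strategy) (i : Fin n) (t : ℕ) (ω : Ω) : S.InfoMinor i t :=
  P.infoMinorOf ω (fun s => P.control g s ω) i t

/-! ### Cost and optimality -/

/-- The cost of a realization: the per-step costs at the times `1, …, T - 1` and the terminal
cost at time `T`. -/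
def pathCost (T : ℕ) (g : S.Strategy) (ω : Ω) : ℝ :=
  ∑ t ∈ Finset.Ico 1 T,
      (P.state g t ω ⬝ᵥ S.Q *ᵥ P.state g t ω + P.control g t ω ⬝ᵥ S.R *ᵥ P.control g t ω)
    + P.state g T ω ⬝ᵥ S.QT *ᵥ P.state g T ω

variable [MeasurableSpace Ω]

/-- The performance `J(g) ∈ [0, ∞]`: the expectation of the nonnegative cost. -/
def cost (μ : Measure Ω) (T : ℕ) (g : S.Strategy) : ℝ≥0∞ :=
  ∫⁻ ω, ENNReal.ofReal (P.pathCost T g ω) ∂μ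

/-- `g` minimizes the total expected cost over all general strategies. -/
def IsOptimal (μ : Measure Ω) (T : ℕ) (g : S.Strategy) : Prop :=
  ∀ g' : S.Strategy, P.cost μ T g ≤ P.cost μ T g'

/-! ### MMSE estimates -/

/-- The σ-algebra generated by `I_0(t) = I^c(t)`. -/
abbrev sigmaMajor (g : S.Strategy) (t : ℕ) : MeasurableSpace Ω :=
  MeasurableSpace.comap (P.infoMajor g t) inferInstance

/-- The σ-algebra generated by `I_i(t)`. -/
abbrev sigmaMinor (g : S.Strategy) (i : Fin n) (t : ℕ) : MeasurableSpace Ω :=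
  MeasurableSpace.comap (P.infoMinor g i t) inferInstance

/-- The major agent's estimate `x̂(t|c) = E[x(t) | I^c(t)]`. -/
def estMajor (μ : Measure Ω) (g : S.Strategy) (t : ℕ) : Ω → S.State :=
  μ[P.state g t | P.sigmaMajor g t]

/-- The minor agent's estimate `x̂(t|i) = E[x(t) | I_i(t)]`. -/
def estMinor (μ : Measure Ω) (g : S.Strategy) (i : Fin n) (t : ℕ) : Ω → S.State :=
  μ[P.state g t | P.sigmaMinor g i t]

/-- The common control `u^c(t) = E[u(t) | I^c(t)]`. -/
def commonControl (μ : Measure Ω) (g : S.Strategy) (t : ℕ) : Ω → S.Control :=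
  μ[P.control g t | P.sigmaMajor g t]

end Primitives

/-! ### Densities and the Bayesian filter -/

/-- The random vector `X` admits the density `φ` (with respect to Lebesgue measure). -/
def HasDensity {Ω : Type*} [MeasurableSpace Ω] (μ : Measure Ω) {d : ℕ}
    (X : Ω → Fin d → ℝ) (φ : (Fin d → ℝ) → ℝ≥0∞) : Prop :=
  Measurable φ ∧ μ.map X = volume.withDensity φ

/-- `f` is a conditional density of the random vector `X` given `Y`: for almost every
realization of `Y`, the conditional distribution of `X` given `Y` has the density `f Y`. -/
def IsCondDensity {Ω 𝓨 : Type*} [MeasurableSpace Ω] [MeasurableSpace 𝓨] (μ : Measure Ω)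
    [IsFiniteMeasure μ] {d : ℕ} (X : Ω → Fin d → ℝ) (Y : Ω → 𝓨)
    (f : 𝓨 → (Fin d → ℝ) → ℝ≥0∞) : Prop :=
  Measurable (Function.uncurry f) ∧
    ∀ᵐ ω ∂μ, condDistrib X Y μ (Y ω) = volume.withDensity (f (Y ω))

namespace System

variable {n : ℕ} (S : System n)

/-- The part `I_i(t)` of the information `I_i(t+1)`. -/
def InfoMinor.prev {S : System n} {i : Fin n} {t : ℕ} (I : S.InfoMinor i (t + 1)) :
    S.InfoMinor i t :=
  (fun s => I.1 ⟨s, Finset.Icc_subset_Icc_right t.le_succ s.2⟩,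
    fun s => I.2.1 ⟨s, Finset.Icc_subset_Icc_right t.le_succ s.2⟩,
    fun s => I.2.2.1 ⟨s, Finset.Ico_subset_Ico_right t.le_succ s.2⟩,
    fun s => I.2.2.2 ⟨s, Finset.Ico_subset_Ico_right t.le_succ s.2⟩)

/-- The initial density of the filter, where `ξ` is the density of `x_i(1)` and `ν` the one of
`v_i(1)`: as a function of `x`, it is `ν(y_i(1) - C_{ii} x) ξ(x)`, normalized. -/
def bayesInit (i : Fin n) (ξ : (Fin (S.dx i.succ) → ℝ) → ℝ≥0∞)
    (ν : (Fin (S.dy i) → ℝ) → ℝ≥0∞) (I : S.InfoMinor i 1) (x : Fin (S.dx i.succ) → ℝ) :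
    ℝ≥0∞ :=
  let y := I.2.1 ⟨1, by simp⟩
  (ν (y - S.C i *ᵥ x) * ξ x) / ∫⁻ x', ν (y - S.C i *ᵥ x') * ξ x'

/-- The factor `γ_0(t+1) = φ_0(x_0(t+1) - A_{00} x_0(t) - B_{00} u_0(t))`. -/
def filterGamma0 {i : Fin n} {t : ℕ} (ht : 1 ≤ t) (φ₀ : (Fin (S.dx 0) → ℝ) → ℝ≥0∞)
    (I : S.InfoMinor i (t + 1)) : ℝ≥0∞ :=
  φ₀ (I.1 ⟨t + 1, by simp⟩ - block S.A 0 0 *ᵥ I.1 ⟨t, by simp [ht]⟩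
    - block S.B 0 0 *ᵥ I.2.2.1 ⟨t, by simp [ht]⟩)

/-- The factor
`γ_i(t+1) = φ_i(x_i(t+1) - A_{ii} x_i(t) - A_{i0} x_0(t) - B_{ii} u_i(t) - B_{i0} u_0(t))` at
`x = x_i(t+1)` and `x' = x_i(t)`. -/
def filterGamma {i : Fin n} {t : ℕ} (ht : 1 ≤ t) (φ : (Fin (S.dx i.succ) → ℝ) → ℝ≥0∞)
    (I : S.InfoMinor i (t + 1)) (x x' : Fin (S.dx i.succ) → ℝ) : ℝ≥0∞ :=
  φ (x - block S.A i.succ i.succ *ᵥ x' - block S.A i.succ 0 *ᵥ I.1 ⟨t, by simp [ht]⟩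
    - block S.B i.succ i.succ *ᵥ I.2.2.2 ⟨t, by simp [ht]⟩
    - block S.B i.succ 0 *ᵥ I.2.2.1 ⟨t, by simp [ht]⟩)

/-- The factor `β_i(t+1) = ν_i(y_i(t+1) - C_{ii} x_i(t+1))` at `x = x_i(t+1)`. -/
def filterBeta {i : Fin n} {t : ℕ} (ν : (Fin (S.dy i) → ℝ) → ℝ≥0∞)
    (I : S.InfoMinor i (t + 1)) (x : Fin (S.dx i.succ) → ℝ) : ℝ≥0∞ :=
  ν (I.2.1 ⟨t + 1, by simp⟩ - S.C i *ᵥ x)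

/-- One step of the Bayesian filter, from time `t` to time `t + 1`. It depends on the data
`I_i(t+1)`, but not on the strategy. -/
def bayesUpdate {i : Fin n} {t : ℕ} (ht : 1 ≤ t) (φ₀ : (Fin (S.dx 0) → ℝ) → ℝ≥0∞)
    (φ : (Fin (S.dx i.succ) → ℝ) → ℝ≥0∞) (ν : (Fin (S.dy i) → ℝ) → ℝ≥0∞)
    (f : S.InfoMinor i t → (Fin (S.dx i.succ) → ℝ) → ℝ≥0∞)
    (I : S.InfoMinor i (t + 1)) (x : Fin (S.dx i.succ) → ℝ) : ℝ≥0∞ :=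
  (S.filterBeta ν I x *
      ∫⁻ x', S.filterGamma ht φ I x x' * S.filterGamma0 ht φ₀ I * f (InfoMinor.prev I) x') /
    ∫⁻ z, S.filterBeta ν I z *
      ∫⁻ x', S.filterGamma ht φ I z x' * S.filterGamma0 ht φ₀ I * f (InfoMinor.prev I) x'

end System

end MajorMinor

end

noncomputable section

namespace MajorMinor

/-! ### Block vectors -/

section Block

variable {n : ℕ} {d e : Fin (n + 1) → ℕ}

@[simp] lemma comp_stack (x : (i : Fin (n + 1)) → Fin (d i) → ℝ) (i : Fin (n + 1)) :
    comp (stack x) i = x i := rfl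

@[simp] lemma comp_stackMM_zero (a : Fin (d 0) → ℝ) (b : (i : Fin n) → Fin (d i.succ) → ℝ) :
    comp (stackMM a b) 0 = a := rfl

@[simp] lemma comp_stackMM_succ (a : Fin (d 0) → ℝ) (b : (i : Fin n) → Fin (d i.succ) → ℝ)
    (i : Fin n) : comp (stackMM a b) i.succ = b i := rfl

@[simp] lemma comp_add (x y : (Σ i, Fin (d i)) → ℝ) (i : Fin (n + 1)) :
    comp (x + y) i = comp x i + comp y i := rfl

@[simp] lemma comp_sub (x y : (Σ i, Fin (d i)) → ℝ) (i : Fin (n + 1)) :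
    comp (x - y) i = comp x i - comp y i := rfl

@[simp] lemma comp_neg (x : (Σ i, Fin (d i)) → ℝ) (i : Fin (n + 1)) :
    comp (-x) i = -comp x i := rfl

lemma ext_comp {x y : (Σ i, Fin (d i)) → ℝ} (h : ∀ i, comp x i = comp y i) : x = y := by
  funext ⟨i, k⟩
  exact congrFun (h i) k

lemma comp_mulVec (M : Matrix (Σ i, Fin (d i)) (Σ i, Fin (e i)) ℝ) (x : (Σ i, Fin (e i)) → ℝ)
    (i : Fin (n + 1)) : comp (M *ᵥ x) i = blockRow M i *ᵥ x := rfl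

lemma comp_mulVec_eq_sum (M : Matrix (Σ i, Fin (d i)) (Σ i, Fin (e i)) ℝ)
    (x : (Σ i, Fin (e i)) → ℝ) (i : Fin (n + 1)) :
    comp (M *ᵥ x) i = ∑ j, block M i j *ᵥ comp x j := by
  funext k
  simp [comp, Matrix.mulVec, dotProduct, block, Finset.sum_apply, Fintype.sum_sigma]

/-- The product with a matrix whose only nonzero blocks are `M_{i0}` and `M_{ii}`. -/
lemma comp_mulVec_zero_of_sparse {M : Matrix (Σ i, Fin (d i)) (Σ i, Fin (e i)) ℝ}
    (hM : ∀ i j, j ≠ 0 → j ≠ i → block M i j = 0) (x : (Σ i, Fin (e i)) → ℝ) :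
    comp (M *ᵥ x) 0 = block M 0 0 *ᵥ comp x 0 := by
  rw [comp_mulVec_eq_sum]
  refine Fintype.sum_eq_single _ fun j hj => ?_
  rw [hM 0 j hj hj, Matrix.zero_mulVec]

lemma comp_mulVec_succ_of_sparse {M : Matrix (Σ i, Fin (d i)) (Σ i, Fin (e i)) ℝ}
    (hM : ∀ i j, j ≠ 0 → j ≠ i → block M i j = 0) (x : (Σ i, Fin (e i)) → ℝ) (i : Fin n) :
    comp (M *ᵥ x) i.succ
      = block M i.succ 0 *ᵥ comp x 0 + block M i.succ i.succ *ᵥ comp x i.succ := by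
  rw [comp_mulVec_eq_sum]
  refine Fintype.sum_eq_add _ _ (Fin.succ_ne_zero i).symm fun j hj => ?_
  rw [hM i.succ j hj.1 hj.2, Matrix.zero_mulVec]

lemma measurable_comp (i : Fin (n + 1)) :
    Measurable fun x : (Σ i, Fin (d i)) → ℝ => comp x i :=
  measurable_pi_lambda _ fun _ => measurable_pi_apply _

lemma measurable_of_comp {Ω : Type*} [MeasurableSpace Ω] {X : Ω → (Σ i, Fin (d i)) → ℝ}
    (h : ∀ i, Measurable fun ω => comp (X ω) i) : Measurable X :=
  measurable_pi_lambda _ fun ⟨i, k⟩ => (measurable_pi_apply k).comp (h i)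

end Block

/-- Multiplication by a matrix, as a continuous linear map. -/
def mulVecCLM {X Y : Type*} [Fintype X] [Fintype Y] (M : Matrix Y X ℝ) :
    (X → ℝ) →L[ℝ] (Y → ℝ) :=
  LinearMap.toContinuousLinearMap (Matrix.mulVecLin M)

lemma _root_.Measurable.mulVec {Ω X Y : Type*} [MeasurableSpace Ω] [Fintype X] [Fintype Y]
    {f : Ω → X → ℝ} (hf : Measurable f) (M : Matrix Y X ℝ) : Measurable fun ω => M *ᵥ f ω :=
  (mulVecCLM M).continuous.measurable.comp hf

/-! ### Recursions for the closed-loop processes -/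

namespace Primitives

variable {n : ℕ} {S : System n} {Ω : Type*} (P : Primitives S Ω)

lemma stateOf_congr {ω : Ω} {u u' : ℕ → S.Control} {t : ℕ}
    (h : ∀ s, 1 ≤ s → s < t → u s = u' s) : P.stateOf ω u t = P.stateOf ω u' t := by
  induction t with
  | zero => rfl
  | succ t ih =>
    cases t with
    | zero => rfl
    | succ t =>
      rw [stateOf, stateOf, ih fun s h1 h2 => h s h1 (h2.trans (Nat.lt_succ_self _)),
        h (t + 1) (by omega) (by omega)]

lemma infoMajorOf_congr {ω : Ω} {u u' : ℕ → S.Control} {t : ℕ}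
    (h : ∀ s, 1 ≤ s → s < t → u s = u' s) : P.infoMajorOf ω u t = P.infoMajorOf ω u' t := by
  refine Prod.ext (funext fun s => ?_) (funext fun s => ?_)
  · have := Finset.mem_Icc.1 s.2
    simp only [infoMajorOf]
    rw [P.stateOf_congr fun r h1 h2 => h r h1 (by omega)]
  · have := Finset.mem_Ico.1 s.2
    simp only [infoMajorOf]
    rw [h s this.1 this.2]

lemma infoMinorOf_congr {ω : Ω} {u u' : ℕ → S.Control} {i : Fin n} {t : ℕ}
    (h : ∀ s, 1 ≤ s → s < t → u s = u' s) :
    P.infoMinorOf ω u i t = P.infoMinorOf ω u' i t := by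
  refine Prod.ext (funext fun s => ?_) (Prod.ext (funext fun s => ?_)
    (Prod.ext (funext fun s => ?_) (funext fun s => ?_)))
  · have := Finset.mem_Icc.1 s.2
    simp only [infoMinorOf]
    rw [P.stateOf_congr fun r h1 h2 => h r h1 (by omega)]
  · have := Finset.mem_Icc.1 s.2
    simp only [infoMinorOf, outputOf]
    rw [P.stateOf_congr fun r h1 h2 => h r h1 (by omega)]
  · have := Finset.mem_Ico.1 s.2
    simp only [infoMinorOf]
    rw [h s this.1 this.2]
  · have := Finset.mem_Ico.1 s.2
    simp only [infoMinorOf]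
    rw [h s this.1 this.2]

lemma controlUpTo_eq_control (g : S.Strategy) (ω : Ω) {s t : ℕ} (h : s ≤ t) :
    P.controlUpTo g ω t s = P.control g s ω := by
  induction t with
  | zero => obtain rfl : s = 0 := by omega
            rfl
  | succ t ih =>
    rcases Nat.lt_or_ge t s with hs | hs
    · obtain rfl : s = t + 1 := by omega
      rfl
    · rw [controlUpTo, Function.update_of_ne (by omega), ih hs]

lemma control_succ (g : S.Strategy) (t : ℕ) (ω : Ω) :
    P.control g (t + 1) ω = stackMM (g.major (t + 1) (P.infoMajor g (t + 1) ω))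
      fun i => g.minor i (t + 1) (P.infoMinor g i (t + 1) ω) := by
  have h : ∀ s, 1 ≤ s → s < t + 1 → P.controlUpTo g ω t s = P.control g s ω := fun s _ hs =>
    P.controlUpTo_eq_control g ω (by omega)
  rw [control, controlUpTo, Function.update_self, P.infoMajorOf_congr h, infoMajor]
  congr 1
  funext i
  rw [P.infoMinorOf_congr h, infoMinor]

lemma comp_control_zero (g : S.Strategy) {t : ℕ} (ht : 1 ≤ t) (ω : Ω) :
    comp (P.control g t ω) 0 = g.major t (P.infoMajor g t ω) := by
  obtain ⟨t, rfl⟩ := Nat.exists_eq_add_of_le' ht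
  rw [control_succ, comp_stackMM_zero]

lemma comp_control_succ (g : S.Strategy) {t : ℕ} (ht : 1 ≤ t) (ω : Ω) (i : Fin n) :
    comp (P.control g t ω) i.succ = g.minor i t (P.infoMinor g i t ω) := by
  obtain ⟨t, rfl⟩ := Nat.exists_eq_add_of_le' ht
  rw [control_succ, comp_stackMM_succ]

lemma state_one (g : S.Strategy) (ω : Ω) : P.state g 1 ω = stack fun i => P.init i ω := rfl

lemma state_succ (g : S.Strategy) {t : ℕ} (ht : 1 ≤ t) (ω : Ω) :
    P.state g (t + 1) ω
      = S.A *ᵥ P.state g t ω + S.B *ᵥ P.control g t ω + stack fun i => P.w i t ω := by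
  obtain ⟨t, rfl⟩ := Nat.exists_eq_add_of_le' ht
  rfl

lemma comp_state_succ_zero (g : S.Strategy) {t : ℕ} (ht : 1 ≤ t) (ω : Ω) :
    comp (P.state g (t + 1) ω) 0 = block S.A 0 0 *ᵥ comp (P.state g t ω) 0
      + block S.B 0 0 *ᵥ comp (P.control g t ω) 0 + P.w 0 t ω := by
  rw [P.state_succ g ht, comp_add, comp_add, comp_mulVec_zero_of_sparse S.A_sparse,
    comp_mulVec_zero_of_sparse S.B_sparse, comp_stack]

lemma comp_state_succ_succ (g : S.Strategy) {t : ℕ} (ht : 1 ≤ t) (ω : Ω) (i : Fin n) :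
    comp (P.state g (t + 1) ω) i.succ
      = (block S.A i.succ 0 *ᵥ comp (P.state g t ω) 0
          + block S.A i.succ i.succ *ᵥ comp (P.state g t ω) i.succ)
        + (block S.B i.succ 0 *ᵥ comp (P.control g t ω) 0
          + block S.B i.succ i.succ *ᵥ comp (P.control g t ω) i.succ) + P.w i.succ t ω := by
  rw [P.state_succ g ht, comp_add, comp_add, comp_mulVec_succ_of_sparse S.A_sparse,
    comp_mulVec_succ_of_sparse S.B_sparse, comp_stack]

/-- The output `y_i(t)` under the strategy `g`. -/
def output (g : S.Strategy) (i : Fin n) (t : ℕ) (ω : Ω) : Fin (S.dy i) → ℝ :=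
  S.C i *ᵥ comp (P.state g t ω) i.succ + P.v i t ω

/-- Strategies with the same laws before the time `t` generate the same actions before `t`. -/
lemma control_congr {g g' : S.Strategy} {t : ℕ}
    (h0 : ∀ s, 1 ≤ s → s < t → g.major s = g'.major s)
    (hi : ∀ i s, 1 ≤ s → s < t → g.minor i s = g'.minor i s) (ω : Ω) :
    ∀ s, 1 ≤ s → s < t → P.control g s ω = P.control g' s ω := by
  intro s
  induction s using Nat.strong_induction_on with
  | _ s ih =>
    intro h1 h2
    have hc : ∀ r, 1 ≤ r → r < s → P.control g r ω = P.control g' r ω :=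
      fun r h3 h4 => ih r h4 h3 (h4.trans h2)
    obtain ⟨s, rfl⟩ := Nat.exists_eq_add_of_le' h1
    rw [control_succ, control_succ, h0 _ h1 h2, infoMajor, infoMajor, P.infoMajorOf_congr hc]
    congr 1
    funext i
    rw [hi i _ h1 h2, infoMinor, infoMinor, P.infoMinorOf_congr hc]

/-! ### Measurability of the closed-loop processes -/

lemma measurable_infoMajor_iff [MeasurableSpace Ω] (g : S.Strategy) (t : ℕ) :
    Measurable (P.infoMajor g t) ↔
      (∀ s, 1 ≤ s → s ≤ t → Measurable fun ω => comp (P.state g s ω) 0) ∧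
      ∀ s, 1 ≤ s → s < t → Measurable fun ω => comp (P.control g s ω) 0 := by
  constructor
  · intro h
    exact ⟨fun s h1 h2 =>
        (measurable_pi_apply (⟨s, Finset.mem_Icc.2 ⟨h1, h2⟩⟩ : Finset.Icc 1 t)).comp h.fst,
      fun s h1 h2 =>
        (measurable_pi_apply (⟨s, Finset.mem_Ico.2 ⟨h1, h2⟩⟩ : Finset.Ico 1 t)).comp h.snd⟩
  · rintro ⟨hx, hu⟩
    refine Measurable.prodMk (measurable_pi_lambda _ fun s => ?_)
      (measurable_pi_lambda _ fun s => ?_)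
    · exact hx s (Finset.mem_Icc.1 s.2).1 (Finset.mem_Icc.1 s.2).2
    · exact hu s (Finset.mem_Ico.1 s.2).1 (Finset.mem_Ico.1 s.2).2

lemma measurable_infoMinor_iff [MeasurableSpace Ω] (g : S.Strategy) (i : Fin n) (t : ℕ) :
    Measurable (P.infoMinor g i t) ↔
      (∀ s, 1 ≤ s → s ≤ t → Measurable fun ω => comp (P.state g s ω) 0) ∧
      (∀ s, 1 ≤ s → s ≤ t → Measurable (P.output g i s)) ∧
      (∀ s, 1 ≤ s → s < t → Measurable fun ω => comp (P.control g s ω) 0) ∧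
      ∀ s, 1 ≤ s → s < t → Measurable fun ω => comp (P.control g s ω) i.succ := by
  constructor
  · intro h
    exact ⟨fun s h1 h2 =>
        (measurable_pi_apply (⟨s, Finset.mem_Icc.2 ⟨h1, h2⟩⟩ : Finset.Icc 1 t)).comp h.fst,
      fun s h1 h2 =>
        (measurable_pi_apply (⟨s, Finset.mem_Icc.2 ⟨h1, h2⟩⟩ : Finset.Icc 1 t)).comp h.snd.fst,
      fun s h1 h2 =>
        (measurable_pi_apply (⟨s, Finset.mem_Ico.2 ⟨h1, h2⟩⟩ : Finset.Ico 1 t)).comp h.snd.snd.fst,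
      fun s h1 h2 =>
        (measurable_pi_apply (⟨s, Finset.mem_Ico.2 ⟨h1, h2⟩⟩ : Finset.Ico 1 t)).comp h.snd.snd.snd⟩
  · rintro ⟨hx, hy, hu, hv⟩
    refine Measurable.prodMk (measurable_pi_lambda _ fun s => ?_)
      (Measurable.prodMk (measurable_pi_lambda _ fun s => ?_)
        (Measurable.prodMk (measurable_pi_lambda _ fun s => ?_)
          (measurable_pi_lambda _ fun s => ?_)))
    · exact hx s (Finset.mem_Icc.1 s.2).1 (Finset.mem_Icc.1 s.2).2
    · exact hy s (Finset.mem_Icc.1 s.2).1 (Finset.mem_Icc.1 s.2).2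
    · exact hu s (Finset.mem_Ico.1 s.2).1 (Finset.mem_Ico.1 s.2).2
    · exact hv s (Finset.mem_Ico.1 s.2).1 (Finset.mem_Ico.1 s.2).2

/-- If the primitive random variables of the major agent are measurable, then so are its states
and actions. -/
lemma measurable_major [MeasurableSpace Ω] (g : S.Strategy) {t : ℕ}
    (hinit : Measurable (P.init 0)) (hw : ∀ s, 1 ≤ s → s < t → Measurable (P.w 0 s)) :
    ∀ s, 1 ≤ s → s ≤ t → (Measurable fun ω => comp (P.state g s ω) 0) ∧
      Measurable fun ω => comp (P.control g s ω) 0 := by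
  intro s
  induction s using Nat.strong_induction_on with
  | _ s ih =>
    intro h1 h2
    have hx : Measurable fun ω => comp (P.state g s ω) 0 := by
      rcases h1.eq_or_lt with rfl | h1'
      · exact hinit
      · obtain ⟨r, rfl⟩ := Nat.exists_eq_add_of_le' h1
        have hr := ih r (by omega) (by omega) (by omega)
        simp only [P.comp_state_succ_zero g (show 1 ≤ r by omega)]
        exact ((hr.1.mulVec _).add (hr.2.mulVec _)).add (hw r (by omega) (by omega))
    refine ⟨hx, ?_⟩
    simp only [P.comp_control_zero g h1]
    refine (g.measurable_major s).comp ((P.measurable_infoMajor_iff g s).2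
      ⟨fun r h3 h4 => ?_, fun r h3 h4 => (ih r h4 h3 (by omega)).2⟩)
    rcases h4.eq_or_lt with rfl | h4
    · exact hx
    · exact (ih r h4 h3 (by omega)).1

/-- If the primitive random variables of the major agent and of a minor agent are measurable,
then so are the states, outputs and actions of the minor agent. -/
lemma measurable_minor [MeasurableSpace Ω] (g : S.Strategy) (i : Fin n) {t : ℕ}
    (hinit : Measurable (P.init 0)) (hw : ∀ s, 1 ≤ s → s < t → Measurable (P.w 0 s))
    (hinit' : Measurable (P.init i.succ))
    (hw' : ∀ s, 1 ≤ s → s < t → Measurable (P.w i.succ s))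
    (hv : ∀ s, 1 ≤ s → s ≤ t → Measurable (P.v i s)) :
    ∀ s, 1 ≤ s → s ≤ t → (Measurable fun ω => comp (P.state g s ω) i.succ) ∧
      Measurable (P.output g i s) ∧ Measurable fun ω => comp (P.control g s ω) i.succ := by
  have hmaj := P.measurable_major g hinit hw
  intro s
  induction s using Nat.strong_induction_on with
  | _ s ih =>
    intro h1 h2
    have hx : Measurable fun ω => comp (P.state g s ω) i.succ := by
      rcases h1.eq_or_lt with rfl | h1'
      · exact hinit'
      · obtain ⟨r, rfl⟩ := Nat.exists_eq_add_of_le' h1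
        have hr := ih r (by omega) (by omega) (by omega)
        have hr0 := hmaj r (by omega) (by omega)
        simp only [P.comp_state_succ_succ g (show 1 ≤ r by omega)]
        exact (((hr0.1.mulVec _).add (hr.1.mulVec _)).add
          ((hr0.2.mulVec _).add (hr.2.2.mulVec _))).add (hw' r (by omega) (by omega))
    have hy : Measurable (P.output g i s) := (hx.mulVec _).add (hv s h1 h2)
    refine ⟨hx, hy, ?_⟩
    simp only [P.comp_control_succ g h1]
    refine (g.measurable_minor i s).comp ((P.measurable_infoMinor_iff g i s).2
      ⟨fun r h3 h4 => (hmaj r h3 (by omega)).1, fun r h3 h4 => ?_,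
        fun r h3 h4 => (hmaj r h3 (by omega)).2, fun r h3 h4 => (ih r h4 h3 (by omega)).2.2⟩)
    rcases h4.eq_or_lt with rfl | h4
    · exact hy
    · exact (ih r h4 h3 (by omega)).2.1

/-- The information of a minor agent under one strategy determines its information under any
other strategy, and the difference of its states under the two strategies. -/
lemma measurable_minor_of_infoMinor [MeasurableSpace Ω] (g g' : S.Strategy) (i : Fin n) {t : ℕ}
    (h : Measurable (P.infoMinor g' i t)) :
    ∀ s, 1 ≤ s → s ≤ t → (Measurable fun ω => comp (P.state g s ω) i.succ
        - comp (P.state g' s ω) i.succ) ∧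
      Measurable (P.output g i s) ∧ (Measurable fun ω => comp (P.state g s ω) 0) ∧
      (Measurable fun ω => comp (P.control g s ω) 0) ∧
      Measurable fun ω => comp (P.control g s ω) i.succ := by
  obtain ⟨hx', hy', hu', hv'⟩ := (P.measurable_infoMinor_iff g' i t).1 h
  intro s
  induction s using Nat.strong_induction_on with
  | _ s ih =>
    intro h1 h2
    have hx : (Measurable fun ω => comp (P.state g s ω) i.succ - comp (P.state g' s ω) i.succ) ∧
        Measurable fun ω => comp (P.state g s ω) 0 := by
      rcases h1.eq_or_lt with rfl | h1'
      · refine ⟨?_, hx' 1 le_rfl h2⟩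
        simp only [state_one, sub_self]
        exact measurable_const
      · obtain ⟨r, rfl⟩ := Nat.exists_eq_add_of_le' h1
        have h3 : 1 ≤ r := by omega
        obtain ⟨hd, -, h0, hc0, hc⟩ := ih r (by omega) h3 (by omega)
        have h0' := hx' r h3 (by omega)
        have hc0' := hu' r h3 (by omega)
        have hc' := hv' r h3 (by omega)
        constructor
        · have : (fun ω => comp (P.state g (r + 1) ω) i.succ - comp (P.state g' (r + 1) ω) i.succ)
              = fun ω => block S.A i.succ 0 *ᵥ (comp (P.state g r ω) 0 - comp (P.state g' r ω) 0)
                + block S.A i.succ i.succ *ᵥ (comp (P.state g r ω) i.succ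
                  - comp (P.state g' r ω) i.succ)
                + block S.B i.succ 0 *ᵥ (comp (P.control g r ω) 0 - comp (P.control g' r ω) 0)
                + block S.B i.succ i.succ *ᵥ (comp (P.control g r ω) i.succ
                  - comp (P.control g' r ω) i.succ) := by
            funext ω
            rw [P.comp_state_succ_succ g h3, P.comp_state_succ_succ g' h3]
            simp only [Matrix.mulVec_sub]
            abel
          rw [this]
          exact (((((h0.sub h0').mulVec _).add (hd.mulVec _)).add ((hc0.sub hc0').mulVec _)).add
            ((hc.sub hc').mulVec _))
        · have : (fun ω => comp (P.state g (r + 1) ω) 0)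
              = fun ω => comp (P.state g' (r + 1) ω) 0
                + block S.A 0 0 *ᵥ (comp (P.state g r ω) 0 - comp (P.state g' r ω) 0)
                + block S.B 0 0 *ᵥ (comp (P.control g r ω) 0 - comp (P.control g' r ω) 0) := by
            funext ω
            rw [P.comp_state_succ_zero g h3, P.comp_state_succ_zero g' h3]
            simp only [Matrix.mulVec_sub]
            abel
          rw [this]
          exact (((hx' (r + 1) h1 h2).add ((h0.sub h0').mulVec _)).add ((hc0.sub hc0').mulVec _))
    have hy : Measurable (P.output g i s) := by
      have : P.output g i s = fun ω => P.output g' i s ω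
          + S.C i *ᵥ (comp (P.state g s ω) i.succ - comp (P.state g' s ω) i.succ) := by
        funext ω
        simp only [output, Matrix.mulVec_sub]
        abel
      rw [this]
      exact (hy' s h1 h2).add (hx.1.mulVec _)
    have hle : ∀ r, 1 ≤ r → r ≤ s → Measurable (P.output g i r) ∧
        Measurable fun ω => comp (P.state g r ω) 0 := by
      intro r h3 h4
      rcases h4.eq_or_lt with rfl | h4
      · exact ⟨hy, hx.2⟩
      · exact ⟨(ih r h4 h3 (by omega)).2.1, (ih r h4 h3 (by omega)).2.2.1⟩
    have hI0 : Measurable (P.infoMajor g s) := (P.measurable_infoMajor_iff g s).2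
      ⟨fun r h3 h4 => (hle r h3 h4).2, fun r h3 h4 => (ih r h4 h3 (by omega)).2.2.2.1⟩
    have hI : Measurable (P.infoMinor g i s) := (P.measurable_infoMinor_iff g i s).2
      ⟨fun r h3 h4 => (hle r h3 h4).2, fun r h3 h4 => (hle r h3 h4).1,
        fun r h3 h4 => (ih r h4 h3 (by omega)).2.2.2.1,
        fun r h3 h4 => (ih r h4 h3 (by omega)).2.2.2.2⟩
    refine ⟨hx.1, hy, hx.2, ?_, ?_⟩
    · simp only [P.comp_control_zero g h1]
      exact (g.measurable_major s).comp hI0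
    · simp only [P.comp_control_succ g h1]
      exact (g.measurable_minor i s).comp hI

/-- The σ-algebra generated by the information of a minor agent does not depend on the
strategy. -/
lemma sigmaMinor_eq (g g' : S.Strategy) (i : Fin n) (t : ℕ) :
    P.sigmaMinor g i t = P.sigmaMinor g' i t := by
  suffices h : ∀ g g' : S.Strategy, P.sigmaMinor g i t ≤ P.sigmaMinor g' i t from
    le_antisymm (h g g') (h g' g)
  intro g g'
  let _ : MeasurableSpace Ω := P.sigmaMinor g' i t
  have h := P.measurable_minor_of_infoMinor g g' i (comap_measurable (P.infoMinor g' i t))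
  exact Measurable.comap_le ((P.measurable_infoMinor_iff g i t).2
    ⟨fun s h1 h2 => (h s h1 h2).2.2.1, fun s h1 h2 => (h s h1 h2).2.1,
      fun s h1 h2 => (h s h1 h2.le).2.2.2.1, fun s h1 h2 => (h s h1 h2.le).2.2.2.2⟩)

lemma measurable_sub_state (g g' : S.Strategy) (i : Fin n) {t : ℕ}
    (ht : 1 ≤ t) :
    Measurable[P.sigmaMinor g' i t] fun ω => comp (P.state g t ω) i.succ
      - comp (P.state g' t ω) i.succ := by
  let _ : MeasurableSpace Ω := P.sigmaMinor g' i t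
  exact (P.measurable_minor_of_infoMinor g g' i
    (comap_measurable (P.infoMinor g' i t)) t ht le_rfl).1

end Primitives

/-! ### Conditional expectations -/

section CondExp

variable {Ω E : Type*} {mΩ : MeasurableSpace Ω} {μ : Measure Ω}
  [NormedAddCommGroup E] [NormedSpace ℝ E] [CompleteSpace E]

lemma setIntegral_eq_smul_of_indep [IsFiniteMeasure μ] {m₁ m₂ : MeasurableSpace Ω}
    (h₁ : m₁ ≤ mΩ) (h₂ : m₂ ≤ mΩ) (hind : Indep m₁ m₂ μ) {f : Ω → E}
    (hf : StronglyMeasurable[m₁] f) (hfi : Integrable f μ) {b : Set Ω} (hb : MeasurableSet[m₂] b) :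
    ∫ ω in b, f ω ∂μ = μ.real b • ∫ ω, f ω ∂μ := by
  rw [← setIntegral_condExp h₂ hfi hb,
    setIntegral_congr_ae (h₂ _ hb) ((condExp_indep_eq h₁ h₂ hf hind).mono fun ω h _ => h),
    setIntegral_const]

/-- Adding to the conditioning σ-algebra `m` a σ-algebra that is independent of `m` and of the
random variable does not change the conditional expectation. -/
lemma condExp_sup_of_indep [IsFiniteMeasure μ] {m m₁ m₂ : MeasurableSpace Ω}
    (hm : m ≤ m₁) (h₁ : m₁ ≤ mΩ) (h₂ : m₂ ≤ mΩ) (hind : Indep m₁ m₂ μ) {f : Ω → E}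
    (hf : StronglyMeasurable[m₁] f) (hfi : Integrable f μ) :
    μ[f | m ⊔ m₂] =ᵐ[μ] μ[f | m] := by
  have hsup : m ⊔ m₂ ≤ mΩ := sup_le (hm.trans h₁) h₂
  symm
  refine ae_eq_condExp_of_forall_setIntegral_eq hsup hfi
    (fun s _ _ => integrable_condExp.integrableOn) (fun s hs _ => ?_)
    (stronglyMeasurable_condExp.mono le_sup_left).aestronglyMeasurable
  let π : Set (Set Ω) := {s | ∃ a b, MeasurableSet[m] a ∧ MeasurableSet[m₂] b ∧ a ∩ b = s}
  have hgen : m ⊔ m₂ = MeasurableSpace.generateFrom π := by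
    refine le_antisymm (sup_le (fun a ha => ?_) fun b hb => ?_)
      (MeasurableSpace.generateFrom_le ?_)
    · exact MeasurableSpace.measurableSet_generateFrom
        ⟨a, Set.univ, ha, MeasurableSet.univ, Set.inter_univ a⟩
    · exact MeasurableSpace.measurableSet_generateFrom
        ⟨Set.univ, b, MeasurableSet.univ, hb, Set.univ_inter b⟩
    · rintro _ ⟨a, b, ha, hb, rfl⟩
      exact MeasurableSet.inter (le_sup_left (a := m) (b := m₂) a ha)
        (le_sup_right (a := m) (b := m₂) b hb)
  have hpi : IsPiSystem π := by
    rintro _ ⟨a, b, ha, hb, rfl⟩ _ ⟨a', b', ha', hb', rfl⟩ -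
    exact ⟨a ∩ a', b ∩ b', ha.inter ha', hb.inter hb', by
      ext; simp only [Set.mem_inter_iff]; tauto⟩
  have hrect : ∀ a b, MeasurableSet[m] a → MeasurableSet[m₂] b → ∀ h : Ω → E,
      StronglyMeasurable[m₁] h → Integrable h μ →
      ∫ ω in a ∩ b, h ω ∂μ = μ.real b • ∫ ω in a, h ω ∂μ := by
    intro a b ha hb h hh hhi
    have ha' : MeasurableSet[mΩ] a := h₁ _ (hm _ ha)
    rw [Set.inter_comm, ← setIntegral_indicator ha',
      setIntegral_eq_smul_of_indep h₁ h₂ hind (hh.indicator (hm _ ha)) (hhi.indicator ha') hb,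
      integral_indicator ha']
  induction s, hs using MeasurableSpace.induction_on_inter hgen hpi with
  | empty => simp
  | basic s hs =>
    obtain ⟨a, b, ha, hb, rfl⟩ := hs
    rw [hrect a b ha hb _ (stronglyMeasurable_condExp.mono hm) integrable_condExp,
      hrect a b ha hb _ hf hfi, setIntegral_condExp (hm.trans h₁) hfi ha]
  | compl s hs ih =>
    have h := integral_add_compl (hsup _ hs) (integrable_condExp (μ := μ) (m := m) (f := f))
    have h' := integral_add_compl (hsup _ hs) hfi
    rw [integral_condExp (hm.trans h₁), ← h'] at h
    simpa [ih (measure_lt_top _ _)] using h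
  | iUnion s hd hs ih =>
    rw [integral_iUnion (fun k => hsup _ (hs k)) hd integrable_condExp.integrableOn,
      integral_iUnion (fun k => hsup _ (hs k)) hd hfi.integrableOn]
    exact tsum_congr fun k => ih k (measure_lt_top _ _)

lemma condExp_mulVec {X Y : Type*} [Fintype X] [Fintype Y] {m : MeasurableSpace Ω}
    (M : Matrix Y X ℝ) {f : Ω → X → ℝ} (hf : Integrable f μ) :
    μ[fun ω => M *ᵥ f ω | m] =ᵐ[μ] fun ω => M *ᵥ μ[f | m] ω :=
  ((mulVecCLM M).comp_condExp_comm hf).symm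

/-- The projection to a component, as a continuous linear map. -/
def compCLM {n : ℕ} (d : Fin (n + 1) → ℕ) (i : Fin (n + 1)) :
    ((Σ i, Fin (d i)) → ℝ) →L[ℝ] (Fin (d i) → ℝ) :=
  ContinuousLinearMap.pi fun k => ContinuousLinearMap.proj ⟨i, k⟩

lemma condExp_comp {n : ℕ} {d : Fin (n + 1) → ℕ} {m : MeasurableSpace Ω}
    {f : Ω → (Σ i, Fin (d i)) → ℝ} (hf : Integrable f μ) (i : Fin (n + 1)) :
    μ[fun ω => comp (f ω) i | m] =ᵐ[μ] fun ω => comp (μ[f | m] ω) i :=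
  ((compCLM d i).comp_condExp_comm hf).symm

lemma condExp_apply {X : Type*} [Fintype X] {m : MeasurableSpace Ω} {f : Ω → X → ℝ}
    (hf : Integrable f μ) (k : X) :
    μ[fun ω => f ω k | m] =ᵐ[μ] fun ω => μ[f | m] ω k :=
  ((ContinuousLinearMap.proj (R := ℝ) (φ := fun _ : X => ℝ) k).comp_condExp_comm hf).symm

lemma _root_.MeasureTheory.Integrable.mulVec {X Y : Type*} [Fintype X] [Fintype Y]
    {f : Ω → X → ℝ} (hf : Integrable f μ) (M : Matrix Y X ℝ) :
    Integrable (fun ω => M *ᵥ f ω) μ :=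
  (mulVecCLM M).integrable_comp hf

lemma _root_.MeasureTheory.MemLp.mulVec {X Y : Type*} [Fintype X] [Fintype Y] {p : ℝ≥0∞}
    {f : Ω → X → ℝ} (hf : MemLp f p μ) (M : Matrix Y X ℝ) :
    MemLp (fun ω => M *ᵥ f ω) p μ :=
  (mulVecCLM M).comp_memLp' hf

lemma memLp_comp {n : ℕ} {d : Fin (n + 1) → ℕ} {p : ℝ≥0∞}
    {f : Ω → (Σ i, Fin (d i)) → ℝ} (hf : MemLp f p μ) (i : Fin (n + 1)) :
    MemLp (fun ω => comp (f ω) i) p μ :=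
  (compCLM d i).comp_memLp' hf

lemma integrable_comp {n : ℕ} {d : Fin (n + 1) → ℕ}
    {f : Ω → (Σ i, Fin (d i)) → ℝ} (hf : Integrable f μ) (i : Fin (n + 1)) :
    Integrable (fun ω => comp (f ω) i) μ :=
  (compCLM d i).integrable_comp hf

lemma memLp_of_comp {n : ℕ} {d : Fin (n + 1) → ℕ} {p : ℝ≥0∞}
    {f : Ω → (Σ i, Fin (d i)) → ℝ} (hf : ∀ i, MemLp (fun ω => comp (f ω) i) p μ) :
    MemLp f p μ :=
  memLp_pi_iff.2 fun ⟨i, k⟩ => memLp_pi_iff.1 (hf i) k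

end CondExp

/-! ### The σ-algebras generated by the primitive random variables -/

namespace System

variable {n : ℕ} (S : System n) (T : ℕ)

/-- The agent that a primitive random variable belongs to. -/
def owner : S.PrimIndex T → Fin (n + 1)
  | .inl i => i
  | .inr (.inl (i, _)) => i
  | .inr (.inr (i, _)) => i.succ

/-- The primitive random variables that have an effect up to the observation at time `t`. -/
def IsRealized (t : ℕ) : S.PrimIndex T → Prop
  | .inl _ => True
  | .inr (.inl (_, s)) => (s : ℕ) < t
  | .inr (.inr (_, s)) => (s : ℕ) ≤ t

/-- The primitive random variables of the agents in `a` that are realized at time `t`. -/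
def prims (a : Set (Fin (n + 1))) (t : ℕ) : Set (S.PrimIndex T) :=
  {k | S.owner T k ∈ a ∧ S.IsRealized T t k}

variable {S T}

lemma prims_mono {a b : Set (Fin (n + 1))} (h : a ⊆ b) (t : ℕ) :
    S.prims T a t ⊆ S.prims T b t := fun _ hk => ⟨h hk.1, hk.2⟩

lemma prims_union (a b : Set (Fin (n + 1))) (t : ℕ) :
    S.prims T (a ∪ b) t = S.prims T a t ∪ S.prims T b t := by
  ext k
  simp only [prims, Set.mem_ofPred_eq, Set.mem_union]
  tauto

lemma prims_disjoint {a b : Set (Fin (n + 1))} (h : Disjoint a b) (s t : ℕ) :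
    Disjoint (S.prims T a s) (S.prims T b t) :=
  Set.disjoint_left.2 fun _ h1 h2 => Set.disjoint_left.1 h h1.1 h2.1

lemma prims_zero_succ {t : ℕ} (h1 : 1 ≤ t) (h2 : t ≤ T) :
    S.prims T {0} (t + 1)
      = S.prims T {0} t ∪ {.inr (.inl (0, ⟨t, Finset.mem_Icc.2 ⟨h1, h2⟩⟩))} := by
  ext k
  rcases k with i | ⟨i, s, hs⟩ | ⟨i, s⟩
  · simp [prims, owner, IsRealized]
  · simp only [prims, owner, IsRealized, Set.mem_ofPred_eq, Set.mem_union, Set.mem_singleton_iff,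
      Sum.inr.injEq, Sum.inl.injEq, Prod.mk.injEq, Subtype.mk.injEq]
    constructor
    · rintro ⟨rfl, h⟩
      rcases (Nat.lt_succ_iff.1 h).eq_or_lt with h | h
      · exact Or.inr ⟨rfl, h⟩
      · exact Or.inl ⟨rfl, h⟩
    · rintro (⟨rfl, h⟩ | ⟨rfl, rfl⟩)
      · exact ⟨rfl, h.trans (Nat.lt_succ_self _)⟩
      · exact ⟨rfl, Nat.lt_succ_self _⟩
  · simp [prims, owner, Fin.succ_ne_zero]

end System

namespace Primitives

variable {n : ℕ} {S : System n} {Ω : Type*} (P : Primitives S Ω)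

/-- The σ-algebra generated by the primitive random variables in `s`. -/
abbrev sig (T : ℕ) (s : Set (S.PrimIndex T)) : MeasurableSpace Ω :=
  ⨆ k ∈ s, MeasurableSpace.comap (P.family T k) inferInstance

variable {P} {T : ℕ}

lemma sig_mono {s s' : Set (S.PrimIndex T)} (h : s ⊆ s') : P.sig T s ≤ P.sig T s' :=
  biSup_mono h

lemma sig_union (s s' : Set (S.PrimIndex T)) : P.sig T (s ∪ s') = P.sig T s ⊔ P.sig T s' :=
  iSup_union

lemma measurable_sig {s : Set (S.PrimIndex T)} {k : S.PrimIndex T} (hk : k ∈ s) :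
    Measurable[P.sig T s] (P.family T k) :=
  Measurable.of_comap_le (le_biSup
    (fun k => MeasurableSpace.comap (P.family T k) inferInstance) hk)

lemma measurable_sig_init {s : Set (S.PrimIndex T)} (i : Fin (n + 1)) (h : .inl i ∈ s) :
    Measurable[P.sig T s] (P.init i) :=
  measurable_sig h

lemma measurable_sig_w {s : Set (S.PrimIndex T)} (i : Fin (n + 1)) {t : ℕ}
    (ht : t ∈ Finset.Icc 1 T) (h : .inr (.inl (i, ⟨t, ht⟩)) ∈ s) :
    Measurable[P.sig T s] (P.w i t) :=
  measurable_sig h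

lemma measurable_sig_v {s : Set (S.PrimIndex T)} (i : Fin n) {t : ℕ}
    (ht : t ∈ Finset.Icc 1 T) (h : .inr (.inr (i, ⟨t, ht⟩)) ∈ s) :
    Measurable[P.sig T s] (P.v i t) :=
  measurable_sig h

/-- The states and actions of the major agent, relative to its primitive random variables. -/
lemma measurable_sig_major (g : S.Strategy) {a : Set (Fin (n + 1))} (h0 : 0 ∈ a) {t : ℕ}
    (h1 : 1 ≤ t) (h2 : t ≤ T) :
    (Measurable[P.sig T (S.prims T a t)] fun ω => comp (P.state g t ω) 0) ∧
    (Measurable[P.sig T (S.prims T a t)] fun ω => comp (P.control g t ω) 0) ∧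
    Measurable[P.sig T (S.prims T a t)] (P.infoMajor g t) := by
  let _ : MeasurableSpace Ω := P.sig T (S.prims T a t)
  have h := P.measurable_major g (t := t) (measurable_sig_init 0 ⟨h0, trivial⟩)
    fun s h3 h4 => measurable_sig_w 0 (Finset.mem_Icc.2 ⟨h3, by omega⟩) ⟨h0, h4⟩
  exact ⟨(h t h1 le_rfl).1, (h t h1 le_rfl).2, (P.measurable_infoMajor_iff g t).2
    ⟨fun s h3 h4 => (h s h3 h4).1, fun s h3 h4 => (h s h3 h4.le).2⟩⟩

/-- The states, outputs and actions of a minor agent, relative to its primitive random variables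
and those of the major agent. -/
lemma measurable_sig_minor (g : S.Strategy) {a : Set (Fin (n + 1))} (h0 : 0 ∈ a) {i : Fin n}
    (hi : i.succ ∈ a) {t : ℕ} (h1 : 1 ≤ t) (h2 : t ≤ T) :
    (Measurable[P.sig T (S.prims T a t)] fun ω => comp (P.state g t ω) i.succ) ∧
    (Measurable[P.sig T (S.prims T a t)] fun ω => comp (P.control g t ω) i.succ) ∧
    Measurable[P.sig T (S.prims T a t)] (P.infoMinor g i t) := by
  let _ : MeasurableSpace Ω := P.sig T (S.prims T a t)
  have hinit : Measurable (P.init 0) := measurable_sig_init 0 ⟨h0, trivial⟩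
  have hw : ∀ s, 1 ≤ s → s < t → Measurable (P.w 0 s) :=
    fun s h3 h4 => measurable_sig_w 0 (Finset.mem_Icc.2 ⟨h3, by omega⟩) ⟨h0, h4⟩
  have h' := P.measurable_major g hinit hw
  have h := P.measurable_minor g i (t := t) hinit hw (measurable_sig_init i.succ ⟨hi, trivial⟩)
    (fun s h3 h4 => measurable_sig_w i.succ (Finset.mem_Icc.2 ⟨h3, by omega⟩) ⟨hi, h4⟩)
    fun s h3 h4 => measurable_sig_v i (Finset.mem_Icc.2 ⟨h3, by omega⟩) ⟨hi, h4⟩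
  exact ⟨(h t h1 le_rfl).1, (h t h1 le_rfl).2.2, (P.measurable_infoMinor_iff g i t).2
    ⟨fun s h3 h4 => (h' s h3 h4).1, fun s h3 h4 => (h s h3 h4).2.1,
      fun s h3 h4 => (h' s h3 h4.le).2, fun s h3 h4 => (h s h3 h4.le).2.2⟩⟩

lemma measurable_sig_state (g : S.Strategy) {t : ℕ} (h1 : 1 ≤ t) (h2 : t ≤ T) :
    Measurable[P.sig T (S.prims T Set.univ t)] (P.state g t) := by
  let _ : MeasurableSpace Ω := P.sig T (S.prims T Set.univ t)
  refine measurable_of_comp fun i => ?_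
  cases i using Fin.cases with
  | zero => exact (measurable_sig_major g (Set.mem_univ _) h1 h2).1
  | succ i => exact (measurable_sig_minor g (Set.mem_univ _) (Set.mem_univ _) h1 h2).1

lemma measurable_sig_control (g : S.Strategy) {t : ℕ} (h1 : 1 ≤ t) (h2 : t ≤ T) :
    Measurable[P.sig T (S.prims T Set.univ t)] (P.control g t) := by
  let _ : MeasurableSpace Ω := P.sig T (S.prims T Set.univ t)
  refine measurable_of_comp fun i => ?_
  cases i using Fin.cases with
  | zero => exact (measurable_sig_major g (Set.mem_univ _) h1 h2).2.1
  | succ i => exact (measurable_sig_minor g (Set.mem_univ _) (Set.mem_univ _) h1 h2).2.1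

/-- The information of the major agent is equivalent to the knowledge of its primitive random
variables, whatever the strategy. -/
lemma sigmaMajor_eq (g : S.Strategy) {t : ℕ} (h1 : 1 ≤ t) (h2 : t ≤ T) :
    P.sigmaMajor g t = P.sig T (S.prims T {0} t) := by
  refine le_antisymm (measurable_sig_major g (Set.mem_singleton 0) h1 h2).2.2.comap_le ?_
  let _ : MeasurableSpace Ω := P.sigmaMajor g t
  obtain ⟨hx, hu⟩ := (P.measurable_infoMajor_iff g t).1 (comap_measurable (P.infoMajor g t))
  refine iSup₂_le fun k hk => ?_
  rcases k with i | ⟨i, s, hs⟩ | ⟨i, s⟩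
  · obtain ⟨rfl, -⟩ := hk
    exact Measurable.comap_le (hx 1 le_rfl h1)
  · obtain ⟨rfl, hk⟩ := hk
    have h3 : 1 ≤ s := (Finset.mem_Icc.1 hs).1
    have hk : s < t := hk
    have : P.w 0 s = fun ω => comp (P.state g (s + 1) ω) 0
        - block S.A 0 0 *ᵥ comp (P.state g s ω) 0
        - block S.B 0 0 *ᵥ comp (P.control g s ω) 0 := by
      funext ω
      rw [P.comp_state_succ_zero g h3]
      abel
    refine Measurable.comap_le (f := P.w 0 s) ?_
    rw [this]
    exact ((hx (s + 1) (by omega) hk).sub ((hx s h3 hk.le).mulVec _)).sub ((hu s h3 hk).mulVec _)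
  · exact absurd hk.1 (Fin.succ_ne_zero i)

lemma sigmaMinor_le_sig (g : S.Strategy) (i : Fin n) {t : ℕ} (h1 : 1 ≤ t) (h2 : t ≤ T) :
    P.sigmaMinor g i t ≤ P.sig T (S.prims T {0, i.succ} t) :=
  (measurable_sig_minor g (by simp) (by simp) h1 h2).2.2.comap_le

lemma sigmaMajor_le_sigmaMinor (g : S.Strategy) (i : Fin n) (t : ℕ) :
    P.sigmaMajor g t ≤ P.sigmaMinor g i t := by
  let _ : MeasurableSpace Ω := P.sigmaMinor g i t
  obtain ⟨hx, -, hu, -⟩ :=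
    (P.measurable_infoMinor_iff g i t).1 (comap_measurable (P.infoMinor g i t))
  exact Measurable.comap_le ((P.measurable_infoMajor_iff g t).2 ⟨hx, hu⟩)

lemma measurable_sigmaMajor (g : S.Strategy) {t : ℕ} (ht : 1 ≤ t) :
    (Measurable[P.sigmaMajor g t] fun ω => comp (P.state g t ω) 0) ∧
      Measurable[P.sigmaMajor g t] fun ω => comp (P.control g t ω) 0 := by
  let _ : MeasurableSpace Ω := P.sigmaMajor g t
  have hI : Measurable (P.infoMajor g t) := comap_measurable _
  refine ⟨((P.measurable_infoMajor_iff g t).1 hI).1 t ht le_rfl, ?_⟩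
  simp only [P.comp_control_zero g ht]
  exact (g.measurable_major t).comp hI

lemma measurable_sigmaMinor_control (g : S.Strategy) (i : Fin n) {t : ℕ} (ht : 1 ≤ t) :
    Measurable[P.sigmaMinor g i t] fun ω => comp (P.control g t ω) i.succ := by
  let _ : MeasurableSpace Ω := P.sigmaMinor g i t
  simp only [P.comp_control_succ g ht]
  exact (g.measurable_minor i t).comp (comap_measurable (P.infoMinor g i t))

namespace Admissible

variable [mΩ : MeasurableSpace Ω] {μ : Measure Ω} (hP : P.Admissible T μ)

include hP

lemma sig_le (s : Set (S.PrimIndex T)) : P.sig T s ≤ mΩ :=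
  iSup₂_le fun k _ => (hP.measurable k).comap_le

lemma sigmaMajor_le (g : S.Strategy) {t : ℕ} (h1 : 1 ≤ t) (h2 : t ≤ T) :
    P.sigmaMajor g t ≤ mΩ := by
  rw [sigmaMajor_eq g h1 h2]
  exact hP.sig_le _

lemma sigmaMinor_le (g : S.Strategy) (i : Fin n) {t : ℕ} (h1 : 1 ≤ t) (h2 : t ≤ T) :
    P.sigmaMinor g i t ≤ mΩ :=
  (sigmaMinor_le_sig g i h1 h2).trans (hP.sig_le _)

lemma indep_sig {s s' : Set (S.PrimIndex T)} (h : Disjoint s s') :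
    Indep (P.sig T s) (P.sig T s') μ :=
  indep_iSup_of_disjoint (fun k => (hP.measurable k).comap_le) hP.indep.iIndep h

/-- Independent primitive random variables can be dropped from the conditioning. -/
lemma condExp_sig_union [IsFiniteMeasure μ] {E : Type*} [NormedAddCommGroup E] [NormedSpace ℝ E]
    [CompleteSpace E] {a b c : Set (S.PrimIndex T)} (hb : b ⊆ a) (hc : Disjoint a c)
    {f : Ω → E} (hf : StronglyMeasurable[P.sig T a] f) (hfi : Integrable f μ) :
    μ[f | P.sig T (b ∪ c)] =ᵐ[μ] μ[f | P.sig T b] := by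
  rw [sig_union]
  exact condExp_sup_of_indep (sig_mono hb) (hP.sig_le _) (hP.sig_le _) (hP.indep_sig hc) hf hfi

lemma condExp_family_eq_zero [IsFiniteMeasure μ] {k : S.PrimIndex T} {a : Set (S.PrimIndex T)}
    (hk : k ∉ a) : μ[P.family T k | P.sig T a] =ᵐ[μ] 0 := by
  have h := condExp_indep_eq (hP.sig_le {k}) (hP.sig_le a)
    (measurable_sig (P := P) (Set.mem_singleton k)).stronglyMeasurable
    (hP.indep_sig (Set.disjoint_singleton_left.2 hk))
  rw [hP.mean_zero k] at h
  exact h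

lemma measurable_state (g : S.Strategy) {t : ℕ} (h1 : 1 ≤ t) (h2 : t ≤ T) :
    Measurable (P.state g t) :=
  (measurable_sig_state g h1 h2).mono (hP.sig_le _) le_rfl

lemma measurable_control (g : S.Strategy) {t : ℕ} (h1 : 1 ≤ t) (h2 : t ≤ T) :
    Measurable (P.control g t) :=
  (measurable_sig_control g h1 h2).mono (hP.sig_le _) le_rfl

lemma measurable_infoMajor (g : S.Strategy) {t : ℕ} (h1 : 1 ≤ t) (h2 : t ≤ T) :
    Measurable (P.infoMajor g t) :=
  Measurable.of_comap_le (hP.sigmaMajor_le g h1 h2)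

lemma measurable_infoMinor (g : S.Strategy) (i : Fin n) {t : ℕ} (h1 : 1 ≤ t) (h2 : t ≤ T) :
    Measurable (P.infoMinor g i t) :=
  Measurable.of_comap_le (hP.sigmaMinor_le g i h1 h2)

lemma memLp_init (i : Fin (n + 1)) : MemLp (P.init i) 2 μ := hP.memLp (.inl i)

lemma memLp_w (i : Fin (n + 1)) {t : ℕ} (h1 : 1 ≤ t) (h2 : t ≤ T) : MemLp (P.w i t) 2 μ :=
  hP.memLp (.inr (.inl (i, ⟨t, Finset.mem_Icc.2 ⟨h1, h2⟩⟩)))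

lemma memLp_stack_w {t : ℕ} (h1 : 1 ≤ t) (h2 : t ≤ T) :
    MemLp (fun ω => stack fun i => P.w i t ω) 2 μ :=
  memLp_of_comp fun i => hP.memLp_w i h1 h2

lemma memLp_state_one (g : S.Strategy) : MemLp (P.state g 1) 2 μ :=
  memLp_of_comp fun i => hP.memLp_init i

lemma memLp_state_succ (g : S.Strategy) {t : ℕ} (h1 : 1 ≤ t) (h2 : t ≤ T) {p : ℝ≥0∞}
    [IsFiniteMeasure μ] (hp : p ≤ 2)
    (hx : MemLp (P.state g t) p μ) (hu : MemLp (P.control g t) p μ) :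
    MemLp (P.state g (t + 1)) p μ := by
  have : P.state g (t + 1) = fun ω => S.A *ᵥ P.state g t ω + S.B *ᵥ P.control g t ω
      + stack fun i => P.w i t ω := funext fun ω => P.state_succ g h1 ω
  rw [this]
  exact ((hx.mulVec S.A).add (hu.mulVec S.B)).add ((hP.memLp_stack_w h1 h2).mono_exponent hp)

lemma memLp_state (g : S.Strategy) {p : ℝ≥0∞} [IsFiniteMeasure μ] (hp : p ≤ 2)
    (hu : ∀ t, 1 ≤ t → t < T → MemLp (P.control g t) p μ) {t : ℕ} (h1 : 1 ≤ t) (h2 : t ≤ T) :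
    MemLp (P.state g t) p μ := by
  induction t, h1 using Nat.le_induction with
  | base => exact (hP.memLp_state_one g).mono_exponent hp
  | succ t h1 ih => exact hP.memLp_state_succ g h1 (by omega) hp (ih (by omega)) (hu t h1 h2)

lemma integrable_state (g : S.Strategy) [IsFiniteMeasure μ]
    (hu : ∀ t, 1 ≤ t → t < T → Integrable (P.control g t) μ) {t : ℕ} (h1 : 1 ≤ t) (h2 : t ≤ T) :
    Integrable (P.state g t) μ :=
  memLp_one_iff_integrable.1 (hP.memLp_state g (by norm_num)
    (fun s h3 h4 => memLp_one_iff_integrable.2 (hu s h3 h4)) h1 h2)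

end Admissible

end Primitives

/-! ### The major agent's estimate -/

namespace Primitives.Admissible

variable {n : ℕ} {S : System n} {Ω : Type*} {P : Primitives S Ω} {T : ℕ}
  [mΩ : MeasurableSpace Ω] {μ : Measure Ω} (hP : P.Admissible T μ)

include hP

lemma comp_estMajor_zero [IsFiniteMeasure μ] (g : S.Strategy) {t : ℕ} (h1 : 1 ≤ t) (h2 : t ≤ T)
    (hx : Integrable (P.state g t) μ) :
    ∀ᵐ ω ∂μ, comp (P.estMajor μ g t ω) 0 = comp (P.state g t ω) 0 := by
  have h := condExp_of_stronglyMeasurable (hP.sigmaMajor_le g h1 h2)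
    (measurable_sigmaMajor (P := P) g h1).1.stronglyMeasurable (integrable_comp hx 0)
  filter_upwards [condExp_comp (m := P.sigmaMajor g t) hx 0] with ω hω
  rw [estMajor, ← hω, h]

lemma comp_commonControl_zero [IsFiniteMeasure μ] (g : S.Strategy) {t : ℕ} (h1 : 1 ≤ t)
    (h2 : t ≤ T) (hu : Integrable (P.control g t) μ) :
    ∀ᵐ ω ∂μ, comp (P.commonControl μ g t ω) 0 = comp (P.control g t ω) 0 := by
  have h := condExp_of_stronglyMeasurable (hP.sigmaMajor_le g h1 h2)
    (measurable_sigmaMajor (P := P) g h1).2.stronglyMeasurable (integrable_comp hu 0)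
  filter_upwards [condExp_comp (m := P.sigmaMajor g t) hu 0] with ω hω
  rw [commonControl, ← hω, h]

lemma estMajor_one [IsFiniteMeasure μ] (hT : 1 ≤ T) (g : S.Strategy) :
    ∀ᵐ ω ∂μ, P.estMajor μ g 1 ω = stackMM (comp (P.state g 1 ω) 0) fun _ => 0 := by
  have hx : Integrable (P.state g 1) μ := (hP.memLp_state_one g).integrable (by norm_num)
  have hi : ∀ i : Fin n, ∀ᵐ ω ∂μ, comp (P.estMajor μ g 1 ω) i.succ = 0 := by
    intro i
    have h : μ[P.init i.succ | P.sig T (S.prims T {0} 1)] =ᵐ[μ] 0 :=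
      hP.condExp_family_eq_zero (k := .inl i.succ) fun h => Fin.succ_ne_zero i h.1
    filter_upwards [condExp_comp (m := P.sigmaMajor g 1) hx i.succ, h] with ω h3 h4
    rw [estMajor, ← h3, sigmaMajor_eq g le_rfl hT]
    exact h4
  filter_upwards [hP.comp_estMajor_zero g le_rfl hT hx, ae_all_iff.2 hi] with ω h3 h4
  refine ext_comp fun i => ?_
  cases i using Fin.cases with
  | zero => rw [h3, comp_stackMM_zero]
  | succ i => rw [h4, comp_stackMM_succ]

lemma condExp_stack_w [IsFiniteMeasure μ] {t : ℕ} (h1 : 1 ≤ t) (h2 : t ≤ T) :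
    ∀ᵐ ω ∂μ, μ[fun ω => stack (d := S.dx) fun i => P.w i t ω | P.sig T (S.prims T {0} (t + 1))] ω
      = stackMM (P.w 0 t ω) fun _ => 0 := by
  have hw := (hP.memLp_stack_w h1 h2).integrable (by norm_num)
  have ht : t ∈ Finset.Icc 1 T := Finset.mem_Icc.2 ⟨h1, h2⟩
  have h0 := condExp_of_stronglyMeasurable (μ := μ) (hP.sig_le (S.prims T {0} (t + 1)))
    (measurable_sig_w (P := P) (s := S.prims T {0} (t + 1)) 0 ht
      ⟨Set.mem_singleton 0, Nat.lt_succ_self t⟩).stronglyMeasurable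
    ((hP.memLp_w 0 h1 h2).integrable (by norm_num))
  have hi : ∀ i : Fin n, μ[P.w i.succ t | P.sig T (S.prims T {0} (t + 1))] =ᵐ[μ] 0 := fun i =>
    hP.condExp_family_eq_zero (k := .inr (.inl (i.succ, ⟨t, ht⟩)))
      fun h => Fin.succ_ne_zero i h.1
  filter_upwards [ae_all_iff.2 fun i =>
    condExp_comp (m := P.sig T (S.prims T {0} (t + 1))) hw i, ae_all_iff.2 hi] with ω h3 h4
  refine ext_comp fun i => ?_
  rw [← h3 i]
  simp only [comp_stack]
  cases i using Fin.cases with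
  | zero => exact congrFun h0 ω
  | succ i => exact h4 i

/-- The recursion of the major agent's estimate. -/
lemma estMajor_succ [IsFiniteMeasure μ] (g : S.Strategy) {t : ℕ} (h1 : 1 ≤ t) (h2 : t < T)
    (hx : Integrable (P.state g t) μ) (hu : Integrable (P.control g t) μ) :
    ∀ᵐ ω ∂μ, P.estMajor μ g (t + 1) ω = S.A *ᵥ P.estMajor μ g t ω
      + S.B *ᵥ P.commonControl μ g t ω + stackMM (P.w 0 t ω) fun _ => 0 := by
  have hw := (hP.memLp_stack_w h1 h2.le).integrable (by norm_num)
  have heq : P.state g (t + 1) = (fun ω => S.A *ᵥ P.state g t ω)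
      + (fun ω => S.B *ᵥ P.control g t ω) + fun ω => stack fun i => P.w i t ω :=
    funext fun ω => P.state_succ g h1 ω
  have hdrop : ∀ {E : Type} [NormedAddCommGroup E] [NormedSpace ℝ E] [CompleteSpace E]
      {f : Ω → E}, StronglyMeasurable[P.sig T (S.prims T Set.univ t)] f → Integrable f μ →
      μ[f | P.sigmaMajor g (t + 1)] =ᵐ[μ] μ[f | P.sigmaMajor g t] := by
    intro E _ _ _ f hf hfi
    rw [sigmaMajor_eq g (by omega) h2, sigmaMajor_eq g h1 h2.le, System.prims_zero_succ h1 h2.le]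
    refine hP.condExp_sig_union (System.prims_mono (Set.subset_univ _) t)
      (Set.disjoint_singleton_right.2 ?_) hf hfi
    exact fun h => lt_irrefl t h.2
  have e1 := condExp_add ((hx.mulVec S.A).add (hu.mulVec S.B)) hw (P.sigmaMajor g (t + 1))
  have e2 := condExp_add (hx.mulVec S.A) (hu.mulVec S.B) (P.sigmaMajor g (t + 1))
  have e3 := hP.condExp_stack_w h1 h2.le
  rw [← sigmaMajor_eq g (by omega) h2] at e3
  filter_upwards [e1, e2, e3, condExp_mulVec (m := P.sigmaMajor g (t + 1)) S.A hx,
    condExp_mulVec (m := P.sigmaMajor g (t + 1)) S.B hu,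
    hdrop (measurable_sig_state g h1 h2.le).stronglyMeasurable hx,
    hdrop (measurable_sig_control g h1 h2.le).stronglyMeasurable hu]
    with ω e1 e2 e3 e4 e5 e6 e7
  rw [estMajor, heq, e1, Pi.add_apply, e2, Pi.add_apply, e3, e4, e5, e6, e7]
  rfl

end Primitives.Admissible

/-! ### Conditional densities -/

section Density

variable {Ω 𝓨 : Type*} [MeasurableSpace Ω] [MeasurableSpace 𝓨] {μ : Measure Ω} {d : ℕ}

/-- The conditional expectation is the mean of a conditional density. -/
lemma IsCondDensity.condExp_eq_integral [IsFiniteMeasure μ] {X : Ω → Fin d → ℝ} {Y : Ω → 𝓨}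
    {f : 𝓨 → (Fin d → ℝ) → ℝ≥0∞} (hf : IsCondDensity μ X Y f) (hX : Integrable X μ)
    (hY : Measurable Y) :
    ∀ᵐ ω ∂μ, Integrable (fun x => (f (Y ω) x).toReal • x) volume ∧
      μ[X | MeasurableSpace.comap Y inferInstance] ω = ∫ x, (f (Y ω) x).toReal • x := by
  have hXm := hX.1.aemeasurable
  have hint : ∀ᵐ ω ∂μ, Integrable (fun x => x) (condDistrib X Y μ (Y ω)) :=
    Integrable.condDistrib_ae hY.aemeasurable hXm (f := fun p : 𝓨 × (Fin d → ℝ) => p.2)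
      ((integrable_map_measure measurable_snd.aestronglyMeasurable
        (hY.aemeasurable.prodMk hXm)).2 hX)
  filter_upwards [hf.2, hint, condExp_ae_eq_integral_condDistrib' hY hX] with ω h1 h2 h3
  have hm : Measurable (f (Y ω)) := hf.1.comp measurable_prodMk_left
  have hfin : ∀ᵐ x, f (Y ω) x < ∞ := by
    refine ae_lt_top hm ?_
    have : (condDistrib X Y μ (Y ω)) Set.univ = 1 := measure_univ
    rw [h1, withDensity_apply _ MeasurableSet.univ, setLIntegral_univ] at this
    rw [this]
    exact ENNReal.one_ne_top
  rw [h1] at h2 h3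
  refine ⟨(integrable_withDensity_iff_integrable_smul' hm hfin).1 h2, ?_⟩
  rw [h3, integral_withDensity_eq_integral_toReal_smul hm hfin]

/-- Bayes' rule: if the pair `(Y, X)` has the joint density `q` with respect to `ρ ⊗ dx`, then
`q(y, x) / ∫ q(y, x') dx'` is a conditional density of `X` given `Y`. -/
lemma isCondDensity_of_joint [IsFiniteMeasure μ] {X : Ω → Fin d → ℝ} {Y : Ω → 𝓨}
    (hX : Measurable X) (hY : Measurable Y) (ρ : Measure 𝓨)
    {q : 𝓨 → (Fin d → ℝ) → ℝ≥0∞} (hq : Measurable (Function.uncurry q))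
    (hjoint : ∀ h : 𝓨 × (Fin d → ℝ) → ℝ≥0∞, Measurable h →
      ∫⁻ ω, h (Y ω, X ω) ∂μ = ∫⁻ y, (∫⁻ x, q y x * h (y, x)) ∂ρ) :
    IsCondDensity μ X Y fun y x => q y x / ∫⁻ x', q y x' := by
  set D : 𝓨 → ℝ≥0∞ := fun y => ∫⁻ x', q y x' with hD
  have hDm : Measurable D := hq.lintegral_prod_right'
  have hqm : ∀ y, Measurable (q y) := fun y => hq.comp measurable_prodMk_left
  have hrm : Measurable (Function.uncurry fun y x => q y x / D y) :=
    hq.div (hDm.comp measurable_fst)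
  refine ⟨hrm, ?_⟩
  have hDint : ∫⁻ y, D y ∂ρ = μ Set.univ := by
    have := hjoint 1 measurable_one
    simpa [hD] using this.symm
  have hDtop : ∀ᵐ y ∂ρ, D y < ∞ :=
    ae_lt_top hDm (by rw [hDint]; exact measure_ne_top _ _)
  let κ : Kernel 𝓨 (Fin d → ℝ) :=
    Kernel.withDensity (Kernel.const 𝓨 volume) fun y x => q y x / D y
  have hκ : ∀ y, κ y = volume.withDensity fun x => q y x / D y := fun y => by
    rw [Kernel.withDensity_apply _ hrm, Kernel.const_apply]
  have hfin : IsFiniteKernel κ := by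
    refine ⟨⟨1, ENNReal.one_lt_top, fun y => ?_⟩⟩
    rw [hκ, withDensity_apply _ MeasurableSet.univ, setLIntegral_univ]
    simp only [div_eq_mul_inv]
    rw [lintegral_mul_const _ (hqm y)]
    exact ENNReal.div_self_le_one
  have hlawY : ∀ h : 𝓨 → ℝ≥0∞, Measurable h → ∫⁻ ω, h (Y ω) ∂μ = ∫⁻ y, D y * h y ∂ρ := by
    intro h hh
    rw [hjoint (fun p => h p.1) (hh.comp measurable_fst)]
    exact lintegral_congr fun y => lintegral_mul_const (h y) (hqm y)
  have hcomp : μ.map (fun ω => (Y ω, X ω)) = μ.map Y ⊗ₘ κ := by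
    refine Measure.ext_of_lintegral _ fun h hh => ?_
    rw [lintegral_map hh (hY.prodMk hX), Measure.lintegral_compProd hh,
      lintegral_map (hh.lintegral_kernel_prod_right' ) hY, hjoint h hh,
      hlawY (fun y => ∫⁻ x, h (y, x) ∂κ y) (hh.lintegral_kernel_prod_right')]
    refine lintegral_congr_ae ?_
    filter_upwards [hDtop] with y hy
    have hhy : Measurable fun x => h (y, x) := hh.comp measurable_prodMk_left
    have hry : Measurable fun x => q y x / D y := hrm.comp measurable_prodMk_left
    rw [hκ, lintegral_withDensity_eq_lintegral_mul _ hry hhy, ← lintegral_const_mul _ (hry.mul hhy)]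
    by_cases h0 : D y = 0
    · have : q y =ᵐ[volume] 0 := (lintegral_eq_zero_iff (hqm y)).1 h0
      refine lintegral_congr_ae ?_
      filter_upwards [this] with x hx
      simp [hx, h0]
    · refine lintegral_congr fun x => ?_
      simp only [Pi.mul_apply]
      rw [← mul_assoc, ENNReal.mul_div_cancel h0 hy.ne]
  have h := condDistrib_ae_eq_of_measure_eq_compProd_of_measurable hY hX hcomp
  filter_upwards [ae_of_ae_map hY.aemeasurable h] with ω hω
  rw [hω, hκ]

lemma HasDensity.lintegral {X : Ω → Fin d → ℝ} {φ : (Fin d → ℝ) → ℝ≥0∞} (h : HasDensity μ X φ)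
    {G : (Fin d → ℝ) → ℝ≥0∞} (hG : Measurable G) :
    ∫⁻ x, G x ∂(μ.map X) = ∫⁻ x, φ x * G x := by
  rw [h.2, lintegral_withDensity_eq_lintegral_mul _ h.1 hG]
  rfl

lemma IsCondDensity.lintegral [IsFiniteMeasure μ] {X : Ω → Fin d → ℝ} {Y : Ω → 𝓨}
    {f : 𝓨 → (Fin d → ℝ) → ℝ≥0∞} (hf : IsCondDensity μ X Y f) (hX : Measurable X)
    (hY : Measurable Y) {G : 𝓨 × (Fin d → ℝ) → ℝ≥0∞} (hG : Measurable G) :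
    ∫⁻ p, G p ∂(μ.map fun ω => (Y ω, X ω)) = ∫⁻ y, (∫⁻ x, f y x * G (y, x)) ∂(μ.map Y) := by
  have hfG : Measurable fun p : 𝓨 × (Fin d → ℝ) => f p.1 p.2 * G p := hf.1.mul hG
  rw [← compProd_map_condDistrib hX.aemeasurable, Measure.lintegral_compProd hG,
    lintegral_map hG.lintegral_kernel_prod_right' hY,
    lintegral_map hfG.lintegral_prod_right' hY]
  refine lintegral_congr_ae ?_
  filter_upwards [hf.2] with ω hω
  have h1 : Measurable (f (Y ω)) := hf.1.comp measurable_prodMk_left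
  have h2 : Measurable fun x => G (Y ω, x) := hG.comp measurable_prodMk_left
  rw [hω, lintegral_withDensity_eq_lintegral_mul _ h1 h2]
  rfl

lemma lintegral_reorder {A B C D : Type*} [MeasurableSpace A] [MeasurableSpace B]
    [MeasurableSpace C] [MeasurableSpace D] {μA : Measure A} {μB : Measure B} {μC : Measure C}
    {μD : Measure D} [SFinite μA] [SFinite μB] [SFinite μC] [SFinite μD]
    {K : A → B → C → D → ℝ≥0∞}
    (hK : Measurable fun p : A × B × C × D => K p.1 p.2.1 p.2.2.1 p.2.2.2) :
    ∫⁻ a, ∫⁻ b, ∫⁻ c, ∫⁻ d, K a b c d ∂μD ∂μC ∂μB ∂μA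
      = ∫⁻ b, ∫⁻ d, ∫⁻ c, ∫⁻ a, K a b c d ∂μA ∂μC ∂μD ∂μB := by
  have h1 : Measurable fun p : A × B => ∫⁻ c, ∫⁻ d, K p.1 p.2 c d ∂μD ∂μC := by
    refine Measurable.lintegral_prod_right (f := fun (p : A × B) c => ∫⁻ d, K p.1 p.2 c d ∂μD) ?_
    refine Measurable.lintegral_prod_right (f := fun (p : (A × B) × C) d => K p.1.1 p.1.2 p.2 d) ?_
    exact hK.comp (f := fun p : ((A × B) × C) × D => (p.1.1.1, p.1.1.2, p.1.2, p.2))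
      (by fun_prop)
  rw [lintegral_lintegral_swap h1.aemeasurable]
  refine lintegral_congr fun b => ?_
  have h2 : ∀ a, Measurable fun p : C × D => K a b p.1 p.2 := fun a =>
    hK.comp (f := fun p : C × D => (a, b, p.1, p.2)) (by fun_prop)
  have h3 : Measurable fun p : A × D => ∫⁻ c, K p.1 b c p.2 ∂μC := by
    refine Measurable.lintegral_prod_right (f := fun (p : A × D) c => K p.1 b c p.2) ?_
    exact hK.comp (f := fun p : (A × D) × C => (p.1.1, b, p.2, p.1.2)) (by fun_prop)
  rw [lintegral_congr fun a => lintegral_lintegral_swap (h2 a).aemeasurable,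
    lintegral_lintegral_swap h3.aemeasurable]
  refine lintegral_congr fun d => lintegral_lintegral_swap (Measurable.aemeasurable ?_)
  exact hK.comp (f := fun p : A × C => (p.1, b, p.2, d)) (by fun_prop)

/-- The joint law of a new state `F(Z, X) + W`, and of the data that consist of the old data `Z`,
of `α(Z) + W₀` and of an observation `c(F(Z, X) + W) + V`. -/
lemma lintegral_filter_step [IsProbabilityMeasure μ] {𝓘 : Type*} [MeasurableSpace 𝓘]
    {d₀ d' : ℕ} {Z : Ω → 𝓨} {X : Ω → Fin d → ℝ} {W₀ : Ω → Fin d₀ → ℝ} {W : Ω → Fin d → ℝ}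
    {V : Ω → Fin d' → ℝ} (hZ : Measurable Z) (hX : Measurable X) (hW₀ : Measurable W₀)
    (hW : Measurable W) (hV : Measurable V)
    (hind₁ : IndepFun (fun ω => (Z ω, X ω)) (fun ω => (W₀ ω, W ω, V ω)) μ)
    (hind₂ : IndepFun W₀ (fun ω => (W ω, V ω)) μ) (hind₃ : IndepFun W V μ)
    {f : 𝓨 → (Fin d → ℝ) → ℝ≥0∞} (hf : IsCondDensity μ X Z f)
    {φ₀ : (Fin d₀ → ℝ) → ℝ≥0∞} {φ : (Fin d → ℝ) → ℝ≥0∞} {ν : (Fin d' → ℝ) → ℝ≥0∞}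
    (hφ₀ : HasDensity μ W₀ φ₀) (hφ : HasDensity μ W φ) (hν : HasDensity μ V ν)
    {α : 𝓨 → Fin d₀ → ℝ} {F : 𝓨 → (Fin d → ℝ) → Fin d → ℝ} {c : (Fin d → ℝ) → Fin d' → ℝ}
    (hα : Measurable α) (hF : Measurable (Function.uncurry F)) (hc : Measurable c)
    {N : 𝓨 × (Fin d₀ → ℝ) × (Fin d' → ℝ) → 𝓘} (hN : Measurable N)
    {h : 𝓘 × (Fin d → ℝ) → ℝ≥0∞} (hh : Measurable h) :
    ∫⁻ ω, h (N (Z ω, α (Z ω) + W₀ ω, c (F (Z ω) (X ω) + W ω) + V ω), F (Z ω) (X ω) + W ω) ∂μ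
      = ∫⁻ p, (∫⁻ x, (ν (p.2.2 - c x) * ∫⁻ x', φ (x - F p.1 x') * φ₀ (p.2.1 - α p.1) * f p.1 x')
          * h (N p, x)) ∂((μ.map Z).prod ((volume : Measure (Fin d₀ → ℝ)).prod
            (volume : Measure (Fin d' → ℝ)))) := by
  have hfm := hf.1
  have hφ₀m := hφ₀.1
  have hφm := hφ.1
  have hνm := hν.1
  have hlaw : μ.map (fun ω => ((Z ω, X ω), (W₀ ω, W ω, V ω)))
      = (μ.map fun ω => (Z ω, X ω)).prod ((μ.map W₀).prod ((μ.map W).prod (μ.map V))) := by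
    rw [(indepFun_iff_map_prod_eq_prod_map_map (hZ.prodMk hX).aemeasurable
        (hW₀.prodMk (hW.prodMk hV)).aemeasurable).1 hind₁,
      (indepFun_iff_map_prod_eq_prod_map_map hW₀.aemeasurable (hW.prodMk hV).aemeasurable).1 hind₂,
      (indepFun_iff_map_prod_eq_prod_map_map hW.aemeasurable hV.aemeasurable).1 hind₃]
  have hprob : ∀ {δ : ℕ} {U : Ω → Fin δ → ℝ}, Measurable U → IsProbabilityMeasure (μ.map U) :=
    fun hU => Measure.isProbabilityMeasure_map hU.aemeasurable
  have := hprob hW₀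
  have := hprob hW
  have := hprob hV
  let H : (𝓨 × (Fin d → ℝ)) × (Fin d₀ → ℝ) × (Fin d → ℝ) × (Fin d' → ℝ) → ℝ≥0∞ := fun p =>
    h (N (p.1.1, α p.1.1 + p.2.1, c (F p.1.1 p.1.2 + p.2.2.1) + p.2.2.2), F p.1.1 p.1.2 + p.2.2.1)
  have hF₁ : Measurable fun p : 𝓨 × (Fin d → ℝ) => F p.1 p.2 := hF
  have hf₁ : Measurable fun p : 𝓨 × (Fin d → ℝ) => f p.1 p.2 := hfm
  have hH : Measurable H := by
    have h1 : Measurable fun p : (𝓨 × (Fin d → ℝ)) × (Fin d₀ → ℝ) × (Fin d → ℝ) × (Fin d' → ℝ) =>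
      F p.1.1 p.1.2 + p.2.2.1 := (hF₁.comp measurable_fst).add (by fun_prop)
    exact hh.comp ((hN.comp (Measurable.prodMk (by fun_prop)
      (Measurable.prodMk (by fun_prop) ((hc.comp h1).add (by fun_prop))))).prodMk h1)
  have hshift : ∀ {δ : ℕ} (G : (Fin δ → ℝ) → ℝ≥0∞) (r : Fin δ → ℝ),
      ∫⁻ x, G x = ∫⁻ x, G (x - r) := fun G r => (lintegral_sub_right_eq_self G r).symm
  let K : 𝓨 → (Fin d → ℝ) → (Fin d₀ → ℝ) → (Fin d → ℝ) → (Fin d' → ℝ) → ℝ≥0∞ :=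
    fun z x' s x y => ν (y - c x) * (φ (x - F z x') * φ₀ (s - α z) * f z x') * h (N (z, s, y), x)
  have hK : ∀ z, Measurable fun p : (Fin d → ℝ) × (Fin d₀ → ℝ) × (Fin d → ℝ) × (Fin d' → ℝ) =>
      K z p.1 p.2.1 p.2.2.1 p.2.2.2 := by
    intro z
    have h1 : Measurable (F z) := hF.comp measurable_prodMk_left
    have h2 : Measurable (f z) := hfm.comp measurable_prodMk_left
    have h3 : Measurable fun p : (Fin d → ℝ) × (Fin d₀ → ℝ) × (Fin d → ℝ) × (Fin d' → ℝ) =>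
      h (N (z, p.2.1, p.2.2.2), p.2.2.1) := by fun_prop
    exact Measurable.mul (by fun_prop) h3
  calc ∫⁻ ω, h (N (Z ω, α (Z ω) + W₀ ω, c (F (Z ω) (X ω) + W ω) + V ω), F (Z ω) (X ω) + W ω) ∂μ
      = ∫⁻ p, H p ∂(μ.map (fun ω => ((Z ω, X ω), (W₀ ω, W ω, V ω)))) := by
        rw [lintegral_map hH (by fun_prop)]
    _ = ∫⁻ z, (∫⁻ x', f z x' * ∫⁻ a, φ₀ a * ∫⁻ b, φ b * ∫⁻ v, ν v * H ((z, x'), a, b, v))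
          ∂(μ.map Z) := by
        rw [hlaw, lintegral_prod _ hH.aemeasurable,
          hf.lintegral hX hZ hH.lintegral_prod_right']
        refine lintegral_congr fun z => lintegral_congr fun x' => ?_
        have hH1 : Measurable fun p => H ((z, x'), p) := hH.comp measurable_prodMk_left
        rw [lintegral_prod _ hH1.aemeasurable, hφ₀.lintegral hH1.lintegral_prod_right']
        congr 1
        refine lintegral_congr fun a => ?_
        have hH2 : Measurable fun p => H ((z, x'), a, p) := hH1.comp measurable_prodMk_left
        rw [lintegral_prod _ hH2.aemeasurable, hφ.lintegral hH2.lintegral_prod_right']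
        congr 1
        refine lintegral_congr fun b => ?_
        have hH3 : Measurable fun v => H ((z, x'), a, b, v) := hH2.comp measurable_prodMk_left
        rw [hν.lintegral hH3]
    _ = ∫⁻ z, (∫⁻ x', ∫⁻ s, ∫⁻ x, ∫⁻ y, K z x' s x y) ∂(μ.map Z) := by
        refine lintegral_congr fun z => lintegral_congr fun x' => ?_
        have h2 : ∀ s x, Measurable fun y => ν (y - c x) * h (N (z, s, y), x) :=
          fun s x => by fun_prop
        have h3 : Measurable fun p : (Fin d₀ → ℝ) × (Fin d → ℝ) =>
            φ (p.2 - F z x') * ∫⁻ y, ν (y - c p.2) * h (N (z, p.1, y), p.2) := by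
          refine Measurable.mul (by fun_prop) (Measurable.lintegral_prod_right (f := fun
            (p : (Fin d₀ → ℝ) × (Fin d → ℝ)) y => ν (y - c p.2) * h (N (z, p.1, y), p.2)) ?_)
          have : Measurable fun q : ((Fin d₀ → ℝ) × (Fin d → ℝ)) × (Fin d' → ℝ) =>
            ν (q.2 - c q.1.2) * h (N (z, q.1.1, q.2), q.1.2) := by fun_prop
          exact this
        have h4 : Measurable fun s => φ₀ (s - α z) * ∫⁻ x, φ (x - F z x')
            * ∫⁻ y, ν (y - c x) * h (N (z, s, y), x) :=
          Measurable.mul (by fun_prop) h3.lintegral_prod_right'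
        calc f z x' * ∫⁻ a, φ₀ a * ∫⁻ b, φ b * ∫⁻ v, ν v * H ((z, x'), a, b, v)
            = f z x' * ∫⁻ s, φ₀ (s - α z) * ∫⁻ x, φ (x - F z x')
                * ∫⁻ y, ν (y - c x) * h (N (z, s, y), x) := by
              congr 1
              rw [hshift _ (α z)]
              refine lintegral_congr fun s => ?_
              congr 1
              rw [hshift _ (F z x')]
              refine lintegral_congr fun x => ?_
              congr 1
              rw [hshift _ (c x)]
              refine lintegral_congr fun y => ?_
              simp only [H, add_sub_cancel]
          _ = ∫⁻ s, ∫⁻ x, ∫⁻ y, K z x' s x y := by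
              rw [← lintegral_const_mul _ h4]
              refine lintegral_congr fun s => ?_
              have h5 : Measurable fun x => φ (x - F z x')
                * ∫⁻ y, ν (y - c x) * h (N (z, s, y), x) := h3.comp measurable_prodMk_left
              rw [← mul_assoc, ← lintegral_const_mul _ h5]
              refine lintegral_congr fun x => ?_
              rw [← mul_assoc, ← lintegral_const_mul _ (h2 s x)]
              refine lintegral_congr fun y => ?_
              simp only [K]
              ring
    _ = ∫⁻ z, (∫⁻ s, ∫⁻ y, ∫⁻ x, ∫⁻ x', K z x' s x y) ∂(μ.map Z) :=
        lintegral_congr fun z => lintegral_reorder (hK z)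
    _ = _ := by
        have h1 : Measurable fun q : (𝓨 × (Fin d₀ → ℝ) × (Fin d' → ℝ)) × (Fin d → ℝ) =>
            ∫⁻ x', φ (q.2 - F q.1.1 x') * φ₀ (q.1.2.1 - α q.1.1) * f q.1.1 x' := by
          refine Measurable.lintegral_prod_right (f := fun
            (q : (𝓨 × (Fin d₀ → ℝ) × (Fin d' → ℝ)) × (Fin d → ℝ)) x' =>
              φ (q.2 - F q.1.1 x') * φ₀ (q.1.2.1 - α q.1.1) * f q.1.1 x') ?_
          have h5 : Measurable fun p : ((𝓨 × (Fin d₀ → ℝ) × (Fin d' → ℝ)) × (Fin d → ℝ))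
              × (Fin d → ℝ) => (p.1.1.1, p.2) := by fun_prop
          have h6 := hF₁.comp h5
          have h7 := hf₁.comp h5
          simp only [Function.comp_def] at h6 h7
          exact Measurable.mul (Measurable.mul (hφm.comp (Measurable.sub (by fun_prop) h6))
            (by fun_prop)) h7
        have h2 : Measurable fun q : (𝓨 × (Fin d₀ → ℝ) × (Fin d' → ℝ)) × (Fin d → ℝ) =>
            (ν (q.1.2.2 - c q.2)
              * ∫⁻ x', φ (q.2 - F q.1.1 x') * φ₀ (q.1.2.1 - α q.1.1) * f q.1.1 x')
              * h (N q.1, q.2) := (Measurable.mul (by fun_prop) h1).mul (by fun_prop)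
        have h3 := h2.lintegral_prod_right' (ν := (volume : Measure (Fin d → ℝ)))
        rw [lintegral_prod _ h3.aemeasurable]
        refine lintegral_congr fun z => ?_
        have h4 := h3.comp (measurable_prodMk_left (x := z))
        simp only [Function.comp_def] at h4
        rw [lintegral_prod _ h4.aemeasurable]
        refine lintegral_congr fun s => lintegral_congr fun y => lintegral_congr fun x => ?_
        have h5 : Measurable (F z) := hF.comp measurable_prodMk_left
        have h6 : Measurable (f z) := hfm.comp measurable_prodMk_left
        rw [← lintegral_const_mul _ (by fun_prop), ← lintegral_mul_const _ (by fun_prop)]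

end Density

/-! ### The Bayesian filter -/

section Filter

variable {n : ℕ} {S : System n}

/-- The part `I_0(t)` of the information `I_i(t)`. -/
def System.InfoMinor.major {i : Fin n} {t : ℕ} (I : S.InfoMinor i t) : S.InfoMajor t :=
  (I.1, I.2.2.1)

lemma System.InfoMinor.measurable_major {i : Fin n} {t : ℕ} :
    Measurable (System.InfoMinor.major : S.InfoMinor i t → S.InfoMajor t) :=
  measurable_fst.prodMk measurable_snd.snd.fst

/-- The information `I_i(t+1)` that results from `I_i(t)` and the new data `x_0(t+1)`, `y_i(t+1)`
when the strategy `g` is used. -/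
def System.Strategy.nextInfo (g : S.Strategy) (i : Fin n) (t : ℕ)
    (p : S.InfoMinor i t × (Fin (S.dx 0) → ℝ) × (Fin (S.dy i) → ℝ)) : S.InfoMinor i (t + 1) :=
  (fun r => if h : (r : ℕ) ≤ t then p.1.1 ⟨r, Finset.mem_Icc.2 ⟨(Finset.mem_Icc.1 r.2).1, h⟩⟩
    else p.2.1,
   fun r => if h : (r : ℕ) ≤ t then p.1.2.1 ⟨r, Finset.mem_Icc.2 ⟨(Finset.mem_Icc.1 r.2).1, h⟩⟩
    else p.2.2,
   fun r => if h : (r : ℕ) < t then p.1.2.2.1 ⟨r, Finset.mem_Ico.2 ⟨(Finset.mem_Ico.1 r.2).1, h⟩⟩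
    else g.major t p.1.major,
   fun r => if h : (r : ℕ) < t then p.1.2.2.2 ⟨r, Finset.mem_Ico.2 ⟨(Finset.mem_Ico.1 r.2).1, h⟩⟩
    else g.minor i t p.1)

lemma System.Strategy.measurable_nextInfo (g : S.Strategy) (i : Fin n) (t : ℕ) :
    Measurable (g.nextInfo i t) := by
  have hg := (g.measurable_major t).comp (System.InfoMinor.measurable_major (i := i))
  have hg' := g.measurable_minor i t
  refine Measurable.prodMk (measurable_pi_lambda _ fun r => ?_)
    (Measurable.prodMk (measurable_pi_lambda _ fun r => ?_)
      (Measurable.prodMk (measurable_pi_lambda _ fun r => ?_)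
        (measurable_pi_lambda _ fun r => ?_)))
  · by_cases h : (r : ℕ) ≤ t
    · simp only [h, dite_true]
      exact (measurable_pi_apply _).comp measurable_fst.fst
    · simp only [h, dite_false]
      exact measurable_snd.fst
  · by_cases h : (r : ℕ) ≤ t
    · simp only [h, dite_true]
      exact (measurable_pi_apply _).comp measurable_fst.snd.fst
    · simp only [h, dite_false]
      exact measurable_snd.snd
  · by_cases h : (r : ℕ) < t
    · simp only [h, dite_true]
      exact (measurable_pi_apply _).comp measurable_fst.snd.snd.fst
    · simp only [h, dite_false]
      exact hg.comp measurable_fst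
  · by_cases h : (r : ℕ) < t
    · simp only [h, dite_true]
      exact (measurable_pi_apply _).comp measurable_fst.snd.snd.snd
    · simp only [h, dite_false]
      exact hg'.comp measurable_fst

lemma System.Strategy.prev_nextInfo (g : S.Strategy) (i : Fin n) (t : ℕ)
    (p : S.InfoMinor i t × (Fin (S.dx 0) → ℝ) × (Fin (S.dy i) → ℝ)) :
    System.InfoMinor.prev (g.nextInfo i t p) = p.1 := by
  refine Prod.ext (funext fun r => ?_) (Prod.ext (funext fun r => ?_)
    (Prod.ext (funext fun r => ?_) (funext fun r => ?_)))
  · simp [System.InfoMinor.prev, nextInfo, (Finset.mem_Icc.1 r.2).2]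
  · simp [System.InfoMinor.prev, nextInfo, (Finset.mem_Icc.1 r.2).2]
  · simp [System.InfoMinor.prev, nextInfo, (Finset.mem_Ico.1 r.2).2]
  · simp [System.InfoMinor.prev, nextInfo, (Finset.mem_Ico.1 r.2).2]

lemma Primitives.infoMinor_succ {Ω : Type*} (P : Primitives S Ω) (g : S.Strategy) (i : Fin n)
    {t : ℕ} (ht : 1 ≤ t) (ω : Ω) :
    P.infoMinor g i (t + 1) ω = g.nextInfo i t
      (P.infoMinor g i t ω, comp (P.state g (t + 1) ω) 0, P.output g i (t + 1) ω) := by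
  refine Prod.ext (funext fun r => ?_) (Prod.ext (funext fun r => ?_)
    (Prod.ext (funext fun r => ?_) (funext fun r => ?_)))
  · have hr := Finset.mem_Icc.1 r.2
    by_cases h : (r : ℕ) ≤ t
    · simp only [System.Strategy.nextInfo, h, dite_true]
      rfl
    · have : (r : ℕ) = t + 1 := by omega
      simp only [System.Strategy.nextInfo, h, dite_false, ← this]
      rfl
  · have hr := Finset.mem_Icc.1 r.2
    by_cases h : (r : ℕ) ≤ t
    · simp only [System.Strategy.nextInfo, h, dite_true]
      rfl
    · have : (r : ℕ) = t + 1 := by omega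
      simp only [System.Strategy.nextInfo, h, dite_false, ← this]
      rfl
  · have hr := Finset.mem_Ico.1 r.2
    by_cases h : (r : ℕ) < t
    · simp only [System.Strategy.nextInfo, h, dite_true]
      rfl
    · have : (r : ℕ) = t := by omega
      simp only [System.Strategy.nextInfo, h, dite_false]
      change comp (P.control g r ω) 0 = g.major t (P.infoMajor g t ω)
      rw [this, P.comp_control_zero g ht]
  · have hr := Finset.mem_Ico.1 r.2
    by_cases h : (r : ℕ) < t
    · simp only [System.Strategy.nextInfo, h, dite_true]
      rfl
    · have : (r : ℕ) = t := by omega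
      simp only [System.Strategy.nextInfo, h, dite_false]
      change comp (P.control g r ω) i.succ = g.minor i t (P.infoMinor g i t ω)
      rw [this, P.comp_control_succ g ht]

end Filter

namespace Primitives.Admissible

variable {n : ℕ} {S : System n} {Ω : Type*} {P : Primitives S Ω} {T : ℕ}
  [mΩ : MeasurableSpace Ω] {μ : Measure Ω} (hP : P.Admissible T μ)

include hP

lemma indepFun_of_sig {β γ : Type*} [MeasurableSpace β] [MeasurableSpace γ] {X : Ω → β}
    {Y : Ω → γ} {a b : Set (S.PrimIndex T)} (hab : Disjoint a b)
    (hX : Measurable[P.sig T a] X) (hY : Measurable[P.sig T b] Y) : IndepFun X Y μ :=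
  indep_of_indep_of_le (hP.indep_sig hab) hX.comap_le hY.comap_le

/-- The initial step of the Bayesian filter. -/
lemma isCondDensity_bayesInit [IsProbabilityMeasure μ] (hT : 1 ≤ T) (g : S.Strategy) (i : Fin n)
    {ξ : (Fin (S.dx i.succ) → ℝ) → ℝ≥0∞} {ν : (Fin (S.dy i) → ℝ) → ℝ≥0∞}
    (hξ : HasDensity μ (P.init i.succ) ξ) (hν : HasDensity μ (P.v i 1) ν) :
    IsCondDensity μ (fun ω => comp (P.state g 1 ω) i.succ) (P.infoMinor g i 1)
      (S.bayesInit i ξ ν) := by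
  have hξm := hξ.1
  have hνm := hν.1
  have hT1 : 1 ∈ Finset.Icc 1 T := Finset.mem_Icc.2 ⟨le_rfl, hT⟩
  have h0m : Measurable (P.init 0) := hP.measurable (.inl 0)
  have him : Measurable (P.init i.succ) := hP.measurable (.inl i.succ)
  have hvm : Measurable (P.v i 1) := hP.measurable (.inr (.inr (i, ⟨1, hT1⟩)))
  have hne : (0 : Fin (n + 1)) ≠ i.succ := (Fin.succ_ne_zero i).symm
  have hind₁ : IndepFun (P.init 0) (fun ω => (P.init i.succ ω, P.v i 1 ω)) μ := by
    refine hP.indepFun_of_sig (a := {.inl 0}) (b := {.inl i.succ, .inr (.inr (i, ⟨1, hT1⟩))})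
      (by simp [hne]) (measurable_sig_init 0 (by simp))
      (Measurable.prodMk (measurable_sig_init i.succ (by simp))
        (measurable_sig_v i hT1 (by simp)))
  have hind₂ : IndepFun (P.init i.succ) (P.v i 1) μ :=
    hP.indepFun_of_sig (a := {.inl i.succ}) (b := {.inr (.inr (i, ⟨1, hT1⟩))})
      (by simp) (measurable_sig_init i.succ (by simp)) (measurable_sig_v i hT1 (by simp))
  let N : (Fin (S.dx 0) → ℝ) × (Fin (S.dy i) → ℝ) → S.InfoMinor i 1 := fun p =>
    (fun _ => p.1, fun _ => p.2, fun _ => 0, fun _ => 0)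
  have hN : Measurable N := by
    refine Measurable.prodMk (measurable_pi_lambda _ fun _ => measurable_fst)
      (Measurable.prodMk (measurable_pi_lambda _ fun _ => measurable_snd)
        (Measurable.prodMk measurable_const measurable_const))
  have hI : ∀ ω, P.infoMinor g i 1 ω = N (P.init 0 ω, S.C i *ᵥ P.init i.succ ω + P.v i 1 ω) := by
    intro ω
    refine Prod.ext (funext fun r => ?_) (Prod.ext (funext fun r => ?_)
      (Prod.ext (funext fun r => ?_) (funext fun r => ?_)))
    · obtain ⟨r, hr⟩ := r
      obtain rfl : r = 1 := by simpa using hr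
      rfl
    · obtain ⟨r, hr⟩ := r
      obtain rfl : r = 1 := by simpa using hr
      rfl
    · exact absurd r.2 (by simp)
    · exact absurd r.2 (by simp)
  let q : S.InfoMinor i 1 → (Fin (S.dx i.succ) → ℝ) → ℝ≥0∞ := fun I x =>
    ν (I.2.1 ⟨1, by simp⟩ - S.C i *ᵥ x) * ξ x
  have hCm : Measurable fun x : Fin (S.dx i.succ) → ℝ => S.C i *ᵥ x := measurable_id.mulVec _
  have hq : Measurable (Function.uncurry q) := by
    have h1 : Measurable fun p : S.InfoMinor i 1 × (Fin (S.dx i.succ) → ℝ) =>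
        p.1.2.1 ⟨1, by simp⟩ - S.C i *ᵥ p.2 :=
      ((measurable_pi_apply _).comp measurable_fst.snd.fst).sub (hCm.comp measurable_snd)
    exact (hνm.comp h1).mul (hξm.comp measurable_snd)
  have hprob₁ := Measure.isProbabilityMeasure_map (μ := μ) him.aemeasurable
  have hprob₂ := Measure.isProbabilityMeasure_map (μ := μ) hvm.aemeasurable
  have hprob₃ := Measure.isProbabilityMeasure_map (μ := μ) h0m.aemeasurable
  refine isCondDensity_of_joint (q := q) him (hP.measurable_infoMinor g i le_rfl hT)
    (((μ.map (P.init 0)).prod volume).map N) hq fun h hh => ?_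
  have hqh : Measurable fun p : S.InfoMinor i 1 × (Fin (S.dx i.succ) → ℝ) =>
    q p.1 p.2 * h p := hq.mul hh
  rw [lintegral_map hqh.lintegral_prod_right' hN]
  have hm : Measurable fun a => ∫⁻ y, q (N a) y * h (N a, y) :=
    hqh.lintegral_prod_right'.comp hN
  change _ = ∫⁻ a, (∫⁻ y, q (N a) y * h (N a, y)) ∂((μ.map (P.init 0)).prod volume)
  rw [lintegral_prod _ hm.aemeasurable]
  have hH : Measurable fun p : (Fin (S.dx 0) → ℝ) × (Fin (S.dx i.succ) → ℝ) × (Fin (S.dy i) → ℝ)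
      => h (N (p.1, S.C i *ᵥ p.2.1 + p.2.2), p.2.1) := by fun_prop
  have hlaw : μ.map (fun ω => (P.init 0 ω, (P.init i.succ ω, P.v i 1 ω)))
      = (μ.map (P.init 0)).prod ((μ.map (P.init i.succ)).prod (μ.map (P.v i 1))) := by
    rw [(indepFun_iff_map_prod_eq_prod_map_map h0m.aemeasurable
        (him.prodMk hvm).aemeasurable).1 hind₁,
      (indepFun_iff_map_prod_eq_prod_map_map him.aemeasurable hvm.aemeasurable).1 hind₂]
  have hlhs := lintegral_map (μ := μ) hH (h0m.prodMk (him.prodMk hvm))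
  have e : ∫⁻ ω, h (P.infoMinor g i 1 ω, comp (P.state g 1 ω) i.succ) ∂μ
      = ∫⁻ ω, h (N (P.init 0 ω, S.C i *ᵥ P.init i.succ ω + P.v i 1 ω), P.init i.succ ω) ∂μ :=
    lintegral_congr fun ω => by rw [hI ω]; rfl
  refine Eq.trans e ?_
  rw [← hlhs, hlaw, lintegral_prod _ hH.aemeasurable]
  refine lintegral_congr fun z => ?_
  have hH1 : Measurable fun p : (Fin (S.dx i.succ) → ℝ) × (Fin (S.dy i) → ℝ) =>
    h (N (z, S.C i *ᵥ p.1 + p.2), p.1) := by fun_prop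
  rw [lintegral_prod _ hH1.aemeasurable, hξ.lintegral hH1.lintegral_prod_right']
  have hsw : Measurable fun p : (Fin (S.dy i) → ℝ) × (Fin (S.dx i.succ) → ℝ) =>
    q (N (z, p.1)) p.2 * h (N (z, p.1), p.2) :=
    hqh.comp (f := fun p : (Fin (S.dy i) → ℝ) × (Fin (S.dx i.succ) → ℝ) => (N (z, p.1), p.2))
      (by fun_prop)
  rw [lintegral_lintegral_swap hsw.aemeasurable]
  refine lintegral_congr fun x => ?_
  have hH2 : Measurable fun y : Fin (S.dy i) → ℝ => h (N (z, S.C i *ᵥ x + y), x) := by fun_prop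
  have hH3 : Measurable fun y => ν y * h (N (z, S.C i *ᵥ x + y), x) := hνm.mul hH2
  rw [hν.lintegral hH2, ← lintegral_const_mul _ hH3,
    ← lintegral_sub_right_eq_self _ (S.C i *ᵥ x)]
  refine lintegral_congr fun y => ?_
  simp only [add_sub_cancel, q, N]
  ring

/-- The update step of the Bayesian filter. -/
lemma isCondDensity_bayesUpdate [IsProbabilityMeasure μ] (g : S.Strategy) (i : Fin n) {t : ℕ}
    (ht : 1 ≤ t) (htT : t < T) {φ₀ : (Fin (S.dx 0) → ℝ) → ℝ≥0∞}
    {φ : (Fin (S.dx i.succ) → ℝ) → ℝ≥0∞} {ν : (Fin (S.dy i) → ℝ) → ℝ≥0∞}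
    (hφ₀ : HasDensity μ (P.w 0 t) φ₀) (hφ : HasDensity μ (P.w i.succ t) φ)
    (hν : HasDensity μ (P.v i (t + 1)) ν)
    {f : S.InfoMinor i t → (Fin (S.dx i.succ) → ℝ) → ℝ≥0∞}
    (hf : IsCondDensity μ (fun ω => comp (P.state g t ω) i.succ) (P.infoMinor g i t) f) :
    IsCondDensity μ (fun ω => comp (P.state g (t + 1) ω) i.succ) (P.infoMinor g i (t + 1))
      (S.bayesUpdate ht φ₀ φ ν f) := by
  have hφ₀m := hφ₀.1
  have hφm := hφ.1
  have hνm := hν.1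
  have htm : t ∈ Finset.Icc 1 T := Finset.mem_Icc.2 ⟨ht, htT.le⟩
  have htm' : t + 1 ∈ Finset.Icc 1 T := Finset.mem_Icc.2 ⟨by omega, htT⟩
  have hw0 : Measurable (P.w 0 t) := hP.measurable (.inr (.inl (0, ⟨t, htm⟩)))
  have hwi : Measurable (P.w i.succ t) := hP.measurable (.inr (.inl (i.succ, ⟨t, htm⟩)))
  have hv : Measurable (P.v i (t + 1)) := hP.measurable (.inr (.inr (i, ⟨t + 1, htm'⟩)))
  have hZ := hP.measurable_infoMinor g i ht htT.le
  have hX : Measurable fun ω => comp (P.state g t ω) i.succ :=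
    (measurable_comp _).comp (hP.measurable_state g ht htT.le)
  have hX' : Measurable fun ω => comp (P.state g (t + 1) ω) i.succ :=
    (measurable_comp _).comp (hP.measurable_state g (by omega) htT)
  have hne : (0 : Fin (n + 1)) ≠ i.succ := (Fin.succ_ne_zero i).symm
  have hind₁ : IndepFun (fun ω => (P.infoMinor g i t ω, comp (P.state g t ω) i.succ))
      (fun ω => (P.w 0 t ω, P.w i.succ t ω, P.v i (t + 1) ω)) μ := by
    refine hP.indepFun_of_sig (a := S.prims T {0, i.succ} t)
      (b := {.inr (.inl (0, ⟨t, htm⟩)), .inr (.inl (i.succ, ⟨t, htm⟩)),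
        .inr (.inr (i, ⟨t + 1, htm'⟩))}) ?_ ?_ ?_
    · simp [System.prims, System.IsRealized]
    · have h := measurable_sig_minor (P := P) (T := T) g (a := {0, i.succ}) (i := i) (by simp)
        (by simp) ht htT.le
      exact Measurable.prodMk h.2.2 h.1
    · exact Measurable.prodMk (measurable_sig_w 0 htm (by simp))
        (Measurable.prodMk (measurable_sig_w i.succ htm (by simp))
          (measurable_sig_v i htm' (by simp)))
  have hind₂ : IndepFun (P.w 0 t) (fun ω => (P.w i.succ t ω, P.v i (t + 1) ω)) μ :=
    hP.indepFun_of_sig (a := {.inr (.inl (0, ⟨t, htm⟩))})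
      (b := {.inr (.inl (i.succ, ⟨t, htm⟩)), .inr (.inr (i, ⟨t + 1, htm'⟩))})
      (by simp [hne]) (measurable_sig_w 0 htm (by simp))
      (Measurable.prodMk (measurable_sig_w i.succ htm (by simp))
          (measurable_sig_v i htm' (by simp)))
  have hind₃ : IndepFun (P.w i.succ t) (P.v i (t + 1)) μ :=
    hP.indepFun_of_sig (a := {.inr (.inl (i.succ, ⟨t, htm⟩))})
      (b := {.inr (.inr (i, ⟨t + 1, htm'⟩))})
      (by simp) (measurable_sig_w i.succ htm (by simp)) (measurable_sig_v i htm' (by simp))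
  let τ : Finset.Icc 1 t := ⟨t, by simp [ht]⟩
  let α : S.InfoMinor i t → Fin (S.dx 0) → ℝ := fun z =>
    block S.A 0 0 *ᵥ z.1 τ + block S.B 0 0 *ᵥ g.major t z.major
  let F : S.InfoMinor i t → (Fin (S.dx i.succ) → ℝ) → Fin (S.dx i.succ) → ℝ := fun z x' =>
    (block S.A i.succ 0 *ᵥ z.1 τ + block S.A i.succ i.succ *ᵥ x')
      + (block S.B i.succ 0 *ᵥ g.major t z.major + block S.B i.succ i.succ *ᵥ g.minor i t z)
  have hzτ : Measurable fun z : S.InfoMinor i t => z.1 τ :=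
    (measurable_pi_apply τ).comp measurable_fst
  have hgm : Measurable fun z : S.InfoMinor i t => g.major t z.major :=
    (g.measurable_major t).comp System.InfoMinor.measurable_major
  have hα : Measurable α := (hzτ.mulVec _).add (hgm.mulVec _)
  have hF : Measurable (Function.uncurry F) :=
    (((hzτ.comp measurable_fst).mulVec _).add (measurable_snd.mulVec _)).add
      (((hgm.comp measurable_fst).mulVec _).add
        (((g.measurable_minor i t).comp measurable_fst).mulVec _))
  have hc : Measurable fun x : Fin (S.dx i.succ) → ℝ => S.C i *ᵥ x := measurable_id.mulVec _
  have hN := g.measurable_nextInfo i t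
  let q : S.InfoMinor i (t + 1) → (Fin (S.dx i.succ) → ℝ) → ℝ≥0∞ := fun I x =>
    S.filterBeta ν I x * ∫⁻ x', S.filterGamma ht φ I x x' * S.filterGamma0 ht φ₀ I
      * f (System.InfoMinor.prev I) x'
  have hprev : Measurable (System.InfoMinor.prev : S.InfoMinor i (t + 1) → S.InfoMinor i t) :=
    Measurable.prodMk (measurable_pi_lambda _ fun _ => (measurable_pi_apply _).comp measurable_fst)
      (Measurable.prodMk
        (measurable_pi_lambda _ fun _ => (measurable_pi_apply _).comp measurable_snd.fst)
        (Measurable.prodMk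
          (measurable_pi_lambda _ fun _ => (measurable_pi_apply _).comp measurable_snd.snd.fst)
          (measurable_pi_lambda _ fun _ => (measurable_pi_apply _).comp measurable_snd.snd.snd)))
  have hx1 : ∀ s, Measurable fun I : S.InfoMinor i (t + 1) => I.1 s := fun s =>
    (measurable_pi_apply s).comp measurable_fst
  have hy1 : ∀ s, Measurable fun I : S.InfoMinor i (t + 1) => I.2.1 s := fun s =>
    (measurable_pi_apply s).comp measurable_snd.fst
  have hu1 : ∀ s, Measurable fun I : S.InfoMinor i (t + 1) => I.2.2.1 s := fun s =>
    (measurable_pi_apply s).comp measurable_snd.snd.fst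
  have hv1 : ∀ s, Measurable fun I : S.InfoMinor i (t + 1) => I.2.2.2 s := fun s =>
    (measurable_pi_apply s).comp measurable_snd.snd.snd
  have hq : Measurable (Function.uncurry q) := by
    refine Measurable.mul ?_ ?_
    · exact hνm.comp (((hy1 _).comp measurable_fst).sub (hc.comp measurable_snd))
    · refine Measurable.lintegral_prod_right (f := fun
        (p : S.InfoMinor i (t + 1) × (Fin (S.dx i.succ) → ℝ)) x' =>
          S.filterGamma ht φ p.1 p.2 x' * S.filterGamma0 ht φ₀ p.1
            * f (System.InfoMinor.prev p.1) x') ?_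
      have hI : Measurable fun r : (S.InfoMinor i (t + 1) × (Fin (S.dx i.succ) → ℝ))
        × (Fin (S.dx i.succ) → ℝ) => r.1.1 := measurable_fst.fst
      refine Measurable.mul (Measurable.mul ?_ ?_) ?_
      · exact hφm.comp ((((measurable_fst.snd.sub (measurable_snd.mulVec _)).sub
          (((hx1 _).comp hI).mulVec _)).sub (((hv1 _).comp hI).mulVec _)).sub
          (((hu1 _).comp hI).mulVec _))
      · exact hφ₀m.comp ((((hx1 _).comp hI).sub (((hx1 _).comp hI).mulVec _)).sub
          (((hu1 _).comp hI).mulVec _))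
      · exact hf.1.comp ((hprev.comp hI).prodMk measurable_snd)
  refine isCondDensity_of_joint (q := q) hX' (hP.measurable_infoMinor g i (by omega) htT)
    (((μ.map (P.infoMinor g i t)).prod (volume.prod volume)).map (g.nextInfo i t)) hq
    fun h hh => ?_
  have hqh : Measurable fun p : S.InfoMinor i (t + 1) × (Fin (S.dx i.succ) → ℝ) =>
    q p.1 p.2 * h p := hq.mul hh
  rw [lintegral_map hqh.lintegral_prod_right' hN]
  have hx0 : ∀ ω, comp (P.state g (t + 1) ω) 0 = α (P.infoMinor g i t ω) + P.w 0 t ω := by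
    intro ω
    rw [P.comp_state_succ_zero g ht, P.comp_control_zero g ht]
    rfl
  have hxi : ∀ ω, comp (P.state g (t + 1) ω) i.succ
      = F (P.infoMinor g i t ω) (comp (P.state g t ω) i.succ) + P.w i.succ t ω := by
    intro ω
    rw [P.comp_state_succ_succ g ht, P.comp_control_zero g ht, P.comp_control_succ g ht]
    rfl
  have key := lintegral_filter_step hZ hX hw0 hwi hv hind₁ hind₂ hind₃ hf hφ₀ hφ hν hα hF hc hN hh
  have e : ∀ ω, h (P.infoMinor g i (t + 1) ω, comp (P.state g (t + 1) ω) i.succ)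
      = h (g.nextInfo i t (P.infoMinor g i t ω, α (P.infoMinor g i t ω) + P.w 0 t ω,
          S.C i *ᵥ (F (P.infoMinor g i t ω) (comp (P.state g t ω) i.succ) + P.w i.succ t ω)
            + P.v i (t + 1) ω),
          F (P.infoMinor g i t ω) (comp (P.state g t ω) i.succ) + P.w i.succ t ω) := by
    intro ω
    rw [P.infoMinor_succ g i ht, output, hx0, hxi]
  rw [lintegral_congr e, key]
  refine lintegral_congr fun p => lintegral_congr fun x => ?_
  congr 1
  have hb : S.filterBeta ν (g.nextInfo i t p) x = ν (p.2.2 - S.C i *ᵥ x) := by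
    simp [System.filterBeta, System.Strategy.nextInfo]
  have hg0 : S.filterGamma0 ht φ₀ (g.nextInfo i t p) = φ₀ (p.2.1 - α p.1) := by
    simp [System.filterGamma0, System.Strategy.nextInfo, α, τ, sub_sub]
  have hgi : ∀ x', S.filterGamma ht φ (g.nextInfo i t p) x x' = φ (x - F p.1 x') := by
    intro x'
    simp only [System.filterGamma, System.Strategy.nextInfo, F, τ, le_refl, lt_irrefl, dite_true,
      dite_false]
    congr 1
    abel
  simp only [q, hb, hg0, hgi, System.Strategy.prev_nextInfo]

end Primitives.Admissible

/-! ### Completion of squares -/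

section Riccati

lemma transpose_eq_of_posSemidef {X : Type*} {M : Matrix X X ℝ} (hM : M.PosSemidef) : Mᵀ = M := by
  simpa using hM.isHermitian.eq

variable {X U : Type*} [Fintype X] [Fintype U]

lemma mulVec_dotProduct_mulVec {Y : Type*} [Fintype Y] (A : Matrix Y X ℝ) (x : X → ℝ)
    (y : Y → ℝ) : (A *ᵥ x) ⬝ᵥ y = x ⬝ᵥ Aᵀ *ᵥ y := by
  rw [Matrix.dotProduct_transpose_mulVec, dotProduct_comm]

lemma dotProduct_mulVec_nonneg {M : Matrix X X ℝ} (hM : M.PosSemidef) (x : X → ℝ) :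
    0 ≤ x ⬝ᵥ M *ᵥ x := hM.dotProduct_mulVec_nonneg x

lemma eq_zero_of_dotProduct_mulVec_eq_zero {M : Matrix X X ℝ} (hM : M.PosDef) {x : X → ℝ}
    (hx : x ⬝ᵥ M *ᵥ x = 0) : x = 0 := by
  by_contra h
  exact (hM.dotProduct_mulVec_pos h).ne' hx

lemma posSemidef_transpose_mul_mul_same {P : Matrix X X ℝ} (hP : P.PosSemidef)
    (B : Matrix X U ℝ) : (Bᵀ * P * B).PosSemidef := by
  simpa using hP.conjTranspose_mul_mul_same B

lemma posDef_weight {P : Matrix X X ℝ} (hP : P.PosSemidef) (B : Matrix X U ℝ)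
    {R : Matrix U U ℝ} (hR : R.PosDef) : (R + Bᵀ * P * B).PosDef :=
  hR.add_posSemidef (posSemidef_transpose_mul_mul_same hP B)

variable [DecidableEq U]

lemma complete_square {P : Matrix X X ℝ} (hP : P.PosSemidef) (A : Matrix X X ℝ)
    (B : Matrix X U ℝ) (Q : Matrix X X ℝ) {R : Matrix U U ℝ} (hR : R.PosDef) (x : X → ℝ)
    (u : U → ℝ) :
    x ⬝ᵥ Q *ᵥ x + u ⬝ᵥ R *ᵥ u + (A *ᵥ x + B *ᵥ u) ⬝ᵥ P *ᵥ (A *ᵥ x + B *ᵥ u)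
      = x ⬝ᵥ riccatiOp P A B Q R *ᵥ x + (u + gainOp P A B R *ᵥ x) ⬝ᵥ
          (R + Bᵀ * P * B) *ᵥ (u + gainOp P A B R *ᵥ x) := by
  have hMpd := posDef_weight hP B hR
  have hMt := transpose_eq_of_posSemidef hMpd.posSemidef
  have hPt := transpose_eq_of_posSemidef hP
  have hdet : IsUnit (R + Bᵀ * P * B).det := (Matrix.isUnit_iff_isUnit_det _).1 hMpd.isUnit
  set M := R + Bᵀ * P * B with hM
  set L := gainOp P A B R with hL
  have hML : M * L = Bᵀ * P * A := by
    rw [hL, gainOp, ← hM]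
    simp only [Matrix.mul_assoc]
    rw [Matrix.mul_nonsing_inv_cancel_left _ _ hdet]
  have hLt : Lᵀ * M = Aᵀ * P * B := by
    have := congrArg Matrix.transpose hML
    rw [Matrix.transpose_mul, hMt] at this
    rw [this]
    simp only [Matrix.transpose_mul, Matrix.transpose_transpose, hPt, Matrix.mul_assoc]
  have hric : riccatiOp P A B Q R = Q + Aᵀ * P * A - Lᵀ * M * L := by
    rw [hLt, riccatiOp, hL, gainOp]
    simp only [Matrix.mul_assoc]
  have hR' : R = M - Bᵀ * P * B := by rw [hM]; abel
  have e1 : (u + L *ᵥ x) ⬝ᵥ M *ᵥ (u + L *ᵥ x)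
      = u ⬝ᵥ M *ᵥ u + u ⬝ᵥ (M * L) *ᵥ x + x ⬝ᵥ (Lᵀ * M) *ᵥ u + x ⬝ᵥ (Lᵀ * M * L) *ᵥ x := by
    simp only [Matrix.mulVec_add, dotProduct_add, add_dotProduct, mulVec_dotProduct_mulVec,
      Matrix.mulVec_mulVec, Matrix.mul_assoc]
    ring
  have e2 : (A *ᵥ x + B *ᵥ u) ⬝ᵥ P *ᵥ (A *ᵥ x + B *ᵥ u)
      = u ⬝ᵥ (Bᵀ * P * B) *ᵥ u + u ⬝ᵥ (Bᵀ * P * A) *ᵥ x + x ⬝ᵥ (Aᵀ * P * B) *ᵥ u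
        + x ⬝ᵥ (Aᵀ * P * A) *ᵥ x := by
    simp only [Matrix.mulVec_add, dotProduct_add, add_dotProduct, mulVec_dotProduct_mulVec,
      Matrix.mulVec_mulVec, Matrix.mul_assoc]
    ring
  rw [e1, e2, hric, hR', hML, hLt]
  simp only [Matrix.sub_mulVec, Matrix.add_mulVec, dotProduct_sub, dotProduct_add]
  ring

lemma posSemidef_riccatiOp {P : Matrix X X ℝ} (hP : P.PosSemidef) (A : Matrix X X ℝ)
    (B : Matrix X U ℝ) {Q : Matrix X X ℝ} (hQ : Q.PosSemidef) {R : Matrix U U ℝ}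
    (hR : R.PosDef) : (riccatiOp P A B Q R).PosSemidef := by
  refine Matrix.PosSemidef.of_dotProduct_mulVec_nonneg ?_ fun x => ?_
  · have hMt := transpose_eq_of_posSemidef (posDef_weight hP B hR).posSemidef
    have hPt := transpose_eq_of_posSemidef hP
    have hQt := transpose_eq_of_posSemidef hQ
    change (riccatiOp P A B Q R)ᴴ = _
    rw [Matrix.conjTranspose_eq_transpose_of_trivial, riccatiOp]
    simp only [Matrix.transpose_sub, Matrix.transpose_add, Matrix.transpose_mul,
      Matrix.transpose_transpose, Matrix.transpose_nonsing_inv, hPt, hQt,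
      transpose_eq_of_posSemidef hR.posSemidef, Matrix.mul_assoc]
  · have h := complete_square hP A B Q hR x (-(gainOp P A B R *ᵥ x))
    rw [neg_add_cancel, Matrix.mulVec_zero, dotProduct_zero, add_zero] at h
    change 0 ≤ x ⬝ᵥ _
    rw [← h]
    exact add_nonneg (add_nonneg (dotProduct_mulVec_nonneg hQ _)
      (dotProduct_mulVec_nonneg hR.posSemidef _)) (dotProduct_mulVec_nonneg hP _)

lemma posSemidef_riccatiSeq (A : Matrix X X ℝ) (B : Matrix X U ℝ) {Q : Matrix X X ℝ}
    (hQ : Q.PosSemidef) {R : Matrix U U ℝ} (hR : R.PosDef) {QT : Matrix X X ℝ}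
    (hQT : QT.PosSemidef) (k : ℕ) : (riccatiSeq A B Q R QT k).PosSemidef := by
  induction k with
  | zero => exact hQT
  | succ k ih => exact posSemidef_riccatiOp ih A B hQ hR

end Riccati

namespace System

variable {n : ℕ} (S : System n) (T : ℕ)

lemma posSemidef_riccatiC (t : ℕ) : (S.riccatiC T t).PosSemidef :=
  posSemidef_riccatiSeq _ _ S.Q_posSemidef S.R_posDef S.QT_posSemidef _

lemma posDef_block_R (i : Fin (n + 1)) : (block S.R i i).PosDef :=
  S.R_posDef.submatrix fun _ _ h => by simpa using h

lemma posSemidef_riccatiL (i : Fin n) (t : ℕ) : (S.riccatiL T i t).PosSemidef :=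
  posSemidef_riccatiSeq _ _ (S.Q_posSemidef.submatrix _) (S.posDef_block_R _)
    (S.QT_posSemidef.submatrix _) _

variable {T}

lemma riccatiC_eq {t : ℕ} (h : t < T) :
    S.riccatiC T t = riccatiOp (S.riccatiC T (t + 1)) S.A S.B S.Q S.R := by
  rw [riccatiC, riccatiC, show T - t = (T - (t + 1)) + 1 by omega]
  rfl

lemma riccatiL_eq (i : Fin n) {t : ℕ} (h : t < T) :
    S.riccatiL T i t = riccatiOp (S.riccatiL T i (t + 1)) (block S.A i.succ i.succ)
      (block S.B i.succ i.succ) (block S.Q i.succ i.succ) (block S.R i.succ i.succ) := by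
  rw [riccatiL, riccatiL, show T - t = (T - (t + 1)) + 1 by omega]
  rfl

lemma riccatiC_self : S.riccatiC T T = S.QT := by
  rw [riccatiC, Nat.sub_self]
  rfl

lemma riccatiL_self (i : Fin n) : S.riccatiL T i T = block S.QT i.succ i.succ := by
  rw [riccatiL, Nat.sub_self]
  rfl

end System

/-! ### Expectations of quadratic forms -/

section Quadratic

variable {Ω X Y : Type*} [Fintype X] [Fintype Y] {mΩ : MeasurableSpace Ω} {μ : Measure Ω}

lemma integrable_coord_mul {f : Ω → X → ℝ} {g : Ω → Y → ℝ} (hf : MemLp f 2 μ) (hg : MemLp g 2 μ)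
    (k : X) (l : Y) : Integrable (fun ω => f ω k * g ω l) μ :=
  MemLp.integrable_mul (p := 2) (q := 2) (memLp_pi_iff.1 hf k) (memLp_pi_iff.1 hg l)

lemma dotProduct_mulVec_eq_sum (M : Matrix X Y ℝ) (x : X → ℝ) (y : Y → ℝ) :
    x ⬝ᵥ M *ᵥ y = ∑ k, ∑ l, M k l * (x k * y l) := by
  simp only [dotProduct, Matrix.mulVec, Finset.mul_sum]
  exact Finset.sum_congr rfl fun k _ => Finset.sum_congr rfl fun l _ => by ring

lemma integrable_dotProduct_mulVec {f : Ω → X → ℝ} {g : Ω → Y → ℝ} (hf : MemLp f 2 μ)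
    (hg : MemLp g 2 μ) (M : Matrix X Y ℝ) : Integrable (fun ω => f ω ⬝ᵥ M *ᵥ g ω) μ := by
  simp only [dotProduct_mulVec_eq_sum]
  exact integrable_finsetSum _ fun k _ => integrable_finsetSum _ fun l _ =>
    (integrable_coord_mul hf hg k l).const_mul _

lemma integral_dotProduct_mulVec {f : Ω → X → ℝ} {g : Ω → Y → ℝ} (hf : MemLp f 2 μ)
    (hg : MemLp g 2 μ) (M : Matrix X Y ℝ) :
    ∫ ω, f ω ⬝ᵥ M *ᵥ g ω ∂μ = ∑ k, ∑ l, M k l * ∫ ω, f ω k * g ω l ∂μ := by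
  have h1 : ∀ k l, Integrable (fun ω => M k l * (f ω k * g ω l)) μ := fun k l =>
    (integrable_coord_mul hf hg k l).const_mul _
  have h2 : ∀ k, Integrable (fun ω => ∑ l, M k l * (f ω k * g ω l)) μ := fun k =>
    integrable_finsetSum _ fun l _ => h1 k l
  simp only [dotProduct_mulVec_eq_sum]
  rw [integral_finsetSum _ fun k _ => h2 k]
  refine Finset.sum_congr rfl fun k _ => ?_
  rw [integral_finsetSum _ fun l _ => h1 k l]
  exact Finset.sum_congr rfl fun l _ => integral_const_mul _ _

/-- The random vectors `f` and `g` are orthogonal: all products of their coordinates have zero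
expectation. -/
def Orth {Ω X Y : Type*} {mΩ : MeasurableSpace Ω} (μ : Measure Ω) (f : Ω → X → ℝ)
    (g : Ω → Y → ℝ) : Prop :=
  ∀ k l, ∫ ω, f ω k * g ω l ∂μ = 0

lemma Orth.symm {Ω X Y : Type*} {mΩ : MeasurableSpace Ω} {μ : Measure Ω} {f : Ω → X → ℝ}
    {g : Ω → Y → ℝ} (h : Orth μ f g) : Orth μ g f := fun k l => by
  simpa only [mul_comm] using h l k

lemma Orth.integral_add {f g : Ω → X → ℝ} (h : Orth μ f g) (hf : MemLp f 2 μ) (hg : MemLp g 2 μ)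
    (M : Matrix X X ℝ) :
    ∫ ω, (f ω + g ω) ⬝ᵥ M *ᵥ (f ω + g ω) ∂μ
      = ∫ ω, f ω ⬝ᵥ M *ᵥ f ω ∂μ + ∫ ω, g ω ⬝ᵥ M *ᵥ g ω ∂μ := by
  have h1 : ∫ ω, f ω ⬝ᵥ M *ᵥ g ω ∂μ = 0 := by
    rw [integral_dotProduct_mulVec hf hg]
    exact Finset.sum_eq_zero fun k _ => Finset.sum_eq_zero fun l _ => by rw [h k l, mul_zero]
  have h2 : ∫ ω, g ω ⬝ᵥ M *ᵥ f ω ∂μ = 0 := by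
    rw [integral_dotProduct_mulVec hg hf]
    exact Finset.sum_eq_zero fun k _ => Finset.sum_eq_zero fun l _ => by
      rw [h.symm k l, mul_zero]
  have e : ∀ ω, (f ω + g ω) ⬝ᵥ M *ᵥ (f ω + g ω) = (f ω ⬝ᵥ M *ᵥ f ω + g ω ⬝ᵥ M *ᵥ g ω)
      + (f ω ⬝ᵥ M *ᵥ g ω + g ω ⬝ᵥ M *ᵥ f ω) := fun ω => by
    simp only [Matrix.mulVec_add, dotProduct_add, add_dotProduct]
    ring
  have i1 := integrable_dotProduct_mulVec hf hf M
  have i2 := integrable_dotProduct_mulVec hg hg M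
  have i3 := integrable_dotProduct_mulVec hf hg M
  have i4 := integrable_dotProduct_mulVec hg hf M
  have i5 : Integrable (fun ω => f ω ⬝ᵥ M *ᵥ f ω + g ω ⬝ᵥ M *ᵥ g ω) μ := i1.add i2
  have i6 : Integrable (fun ω => f ω ⬝ᵥ M *ᵥ g ω + g ω ⬝ᵥ M *ᵥ f ω) μ := i3.add i4
  simp only [e]
  rw [MeasureTheory.integral_add i5 i6, MeasureTheory.integral_add i1 i2,
    MeasureTheory.integral_add i3 i4, h1, h2, add_zero, add_zero]

/-- A random vector whose conditional expectation vanishes is orthogonal to every random vector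
that is measurable with respect to the conditioning σ-algebra. -/
lemma orth_of_condExp_eq_zero [IsFiniteMeasure μ] {m : MeasurableSpace Ω} (hm : m ≤ mΩ)
    {f : Ω → X → ℝ} {g : Ω → Y → ℝ} (hf : MemLp f 2 μ) (hg : MemLp g 2 μ)
    (hf0 : μ[f | m] =ᵐ[μ] 0) (hgm : AEStronglyMeasurable[m] g μ) : Orth μ f g := by
  intro k l
  have hgl : AEStronglyMeasurable[m] (fun ω => g ω l) μ :=
    (continuous_apply l).comp_aestronglyMeasurable hgm
  have hfi : Integrable f μ := hf.integrable (by norm_num)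
  have h1 := condExp_mul_of_aestronglyMeasurable_right (m := m) (f := fun ω => f ω k) hgl
    (integrable_coord_mul hf hg k l) (hfi.eval k)
  rw [← integral_condExp hm]
  refine integral_eq_zero_of_ae ?_
  filter_upwards [h1, condExp_apply (m := m) hfi k, hf0] with ω h1 h2 h3
  refine h1.trans ?_
  rw [Pi.mul_apply, h2, h3]
  simp

/-- The expectation of a quadratic form is the sum of the contributions of the minor components,
if these are mutually orthogonal and the major component vanishes. -/
lemma integral_dotProduct_mulVec_of_orth {n : ℕ} {d : Fin (n + 1) → ℕ}
    {f : Ω → (Σ i, Fin (d i)) → ℝ} (hf : MemLp f 2 μ) (h0 : ∀ᵐ ω ∂μ, comp (f ω) 0 = 0)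
    (h : ∀ i j : Fin n, i ≠ j →
      Orth μ (fun ω => comp (f ω) i.succ) (fun ω => comp (f ω) j.succ))
    (M : Matrix (Σ i, Fin (d i)) (Σ i, Fin (d i)) ℝ) :
    ∫ ω, f ω ⬝ᵥ M *ᵥ f ω ∂μ = ∑ i : Fin n, ∫ ω, comp (f ω) i.succ ⬝ᵥ
      block M i.succ i.succ *ᵥ comp (f ω) i.succ ∂μ := by
  have hz : ∀ i j k l, (i = 0 ∨ j = 0 ∨ i ≠ j) → ∫ ω, f ω ⟨i, k⟩ * f ω ⟨j, l⟩ ∂μ = 0 := by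
    intro i j k l hij
    rcases eq_or_ne i 0 with rfl | hi
    · refine integral_eq_zero_of_ae ?_
      filter_upwards [h0] with ω hω
      have : f ω ⟨0, k⟩ = 0 := congrFun hω k
      simp [this]
    rcases eq_or_ne j 0 with rfl | hj
    · refine integral_eq_zero_of_ae ?_
      filter_upwards [h0] with ω hω
      have : f ω ⟨0, l⟩ = 0 := congrFun hω l
      simp [this]
    obtain ⟨i, rfl⟩ := Fin.exists_succ_eq.2 hi
    obtain ⟨j, rfl⟩ := Fin.exists_succ_eq.2 hj
    have hne : i ≠ j := by
      rintro rfl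
      tauto
    exact h i j hne k l
  rw [integral_dotProduct_mulVec hf hf, Fintype.sum_sigma, Fin.sum_univ_succ]
  simp only [Fintype.sum_sigma]
  have e0 : ∀ k : Fin (d 0), ∑ j, ∑ l, M ⟨0, k⟩ ⟨j, l⟩ * ∫ ω, f ω ⟨0, k⟩ * f ω ⟨j, l⟩ ∂μ = 0 :=
    fun k => Finset.sum_eq_zero fun j _ => Finset.sum_eq_zero fun l _ => by
      rw [hz 0 j k l (Or.inl rfl), mul_zero]
  rw [Finset.sum_eq_zero fun k _ => e0 k, zero_add]
  refine Finset.sum_congr rfl fun i _ => ?_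
  rw [integral_dotProduct_mulVec (memLp_comp hf _) (memLp_comp hf _)]
  refine Finset.sum_congr rfl fun k _ => ?_
  refine Fintype.sum_eq_single i.succ fun j hj => Finset.sum_eq_zero fun l _ => ?_
  rw [hz i.succ j k l (Or.inr (Or.inr hj.symm)), mul_zero]

lemma ae_eq_zero_of_integral_dotProduct_mulVec {M : Matrix X X ℝ} (hM : M.PosDef)
    {f : Ω → X → ℝ} (hf : MemLp f 2 μ) (h : ∫ ω, f ω ⬝ᵥ M *ᵥ f ω ∂μ = 0) : f =ᵐ[μ] 0 := by
  have h1 := (integral_eq_zero_iff_of_nonneg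
    (fun ω => dotProduct_mulVec_nonneg hM.posSemidef (f ω))
    (integrable_dotProduct_mulVec hf hf M)).1 h
  filter_upwards [h1] with ω hω
  exact eq_zero_of_dotProduct_mulVec_eq_zero hM hω

open scoped MatrixOrder in
lemma memLp_of_integrable_dotProduct_mulVec [DecidableEq X] {M : Matrix X X ℝ} (hM : M.PosDef)
    {f : Ω → X → ℝ} (hf : Measurable f) (h : Integrable (fun ω => f ω ⬝ᵥ M *ᵥ f ω) μ) :
    MemLp f 2 μ := by
  obtain ⟨B, hB⟩ := CStarAlgebra.nonneg_iff_eq_star_mul_self.mp hM.posSemidef.nonneg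
  have hBt : M = Bᵀ * B := by simpa [Matrix.star_eq_conjTranspose] using hB
  have hdet : IsUnit B.det := by
    have := (Matrix.isUnit_iff_isUnit_det _).1 hM.isUnit
    rw [hBt, Matrix.det_mul, Matrix.det_transpose] at this
    exact isUnit_of_mul_isUnit_left this
  have hBf : MemLp (fun ω => B *ᵥ f ω) 2 μ := by
    refine memLp_pi_iff.2 fun k => ?_
    have hm : Measurable fun ω => (B *ᵥ f ω) k := (measurable_pi_apply k).comp (hf.mulVec B)
    refine (memLp_two_iff_integrable_sq hm.aestronglyMeasurable).2
      (h.mono (hm.pow_const 2).aestronglyMeasurable (Filter.Eventually.of_forall fun ω => ?_))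
    have e : f ω ⬝ᵥ M *ᵥ f ω = ∑ l, (B *ᵥ f ω) l ^ 2 := by
      rw [hBt, ← Matrix.mulVec_mulVec, ← mulVec_dotProduct_mulVec]
      simp only [dotProduct, sq]
    rw [Real.norm_of_nonneg (sq_nonneg _), e,
      Real.norm_of_nonneg (Finset.sum_nonneg fun l _ => sq_nonneg _)]
    exact Finset.single_le_sum (f := fun l => (B *ᵥ f ω) l ^ 2) (fun l _ => sq_nonneg _)
      (Finset.mem_univ k)
  have := hBf.mulVec B⁻¹
  simpa only [Matrix.mulVec_mulVec, Matrix.nonsing_inv_mul _ hdet, Matrix.one_mulVec] using this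

end Quadratic

/-! ### Decomposition of the cost -/

section Generic

variable {Ω X U : Type*} [Fintype X] [Fintype U] {mΩ : MeasurableSpace Ω} {μ : Measure Ω}

lemma condExp_sub_condExp [IsFiniteMeasure μ] {E : Type*} [NormedAddCommGroup E]
    [NormedSpace ℝ E] [CompleteSpace E] {m : MeasurableSpace Ω} (hm : m ≤ mΩ) {f : Ω → E}
    (hf : Integrable f μ) : μ[fun ω => f ω - μ[f | m] ω | m] =ᵐ[μ] 0 := by
  have h := condExp_sub hf (integrable_condExp (μ := μ) (m := m) (f := f)) m
  rw [condExp_of_stronglyMeasurable hm stronglyMeasurable_condExp integrable_condExp, sub_self] at h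
  exact h

lemma integral_dotProduct_mulVec_condExp [IsFiniteMeasure μ] {m : MeasurableSpace Ω}
    (hm : m ≤ mΩ) {f : Ω → X → ℝ} (hf : MemLp f 2 μ) (M : Matrix X X ℝ) :
    ∫ ω, f ω ⬝ᵥ M *ᵥ f ω ∂μ = ∫ ω, μ[f | m] ω ⬝ᵥ M *ᵥ μ[f | m] ω ∂μ
      + ∫ ω, (f ω - μ[f | m] ω) ⬝ᵥ M *ᵥ (f ω - μ[f | m] ω) ∂μ := by
  have hE : MemLp (μ[f | m]) 2 μ := hf.condExp (by norm_num)
  have h : Orth μ (fun ω => f ω - μ[f | m] ω) (μ[f | m]) :=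
    orth_of_condExp_eq_zero hm (hf.sub hE) hE
      (condExp_sub_condExp hm (hf.integrable (by norm_num)))
      stronglyMeasurable_condExp.aestronglyMeasurable
  have := h.symm.integral_add hE (hf.sub hE) M
  simpa only [add_sub_cancel] using this

lemma integral_complete_square [DecidableEq U] {P : Matrix X X ℝ} (hP : P.PosSemidef)
    (A : Matrix X X ℝ) (B : Matrix X U ℝ) (Q : Matrix X X ℝ) {R : Matrix U U ℝ} (hR : R.PosDef)
    {x : Ω → X → ℝ} {u : Ω → U → ℝ} (hx : MemLp x 2 μ) (hu : MemLp u 2 μ) :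
    ∫ ω, x ω ⬝ᵥ Q *ᵥ x ω ∂μ + ∫ ω, u ω ⬝ᵥ R *ᵥ u ω ∂μ
        + ∫ ω, (A *ᵥ x ω + B *ᵥ u ω) ⬝ᵥ P *ᵥ (A *ᵥ x ω + B *ᵥ u ω) ∂μ
      = ∫ ω, x ω ⬝ᵥ riccatiOp P A B Q R *ᵥ x ω ∂μ
        + ∫ ω, (u ω + gainOp P A B R *ᵥ x ω) ⬝ᵥ (R + Bᵀ * P * B) *ᵥ
            (u ω + gainOp P A B R *ᵥ x ω) ∂μ := by
  have h1 : MemLp (fun ω => A *ᵥ x ω + B *ᵥ u ω) 2 μ := (hx.mulVec A).add (hu.mulVec B)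
  have h2 : MemLp (fun ω => u ω + gainOp P A B R *ᵥ x ω) 2 μ := hu.add (hx.mulVec _)
  have i1 := integrable_dotProduct_mulVec hx hx Q
  have i2 := integrable_dotProduct_mulVec hu hu R
  have i3 := integrable_dotProduct_mulVec h1 h1 P
  have i4 := integrable_dotProduct_mulVec hx hx (riccatiOp P A B Q R)
  have i5 := integrable_dotProduct_mulVec h2 h2 (R + Bᵀ * P * B)
  have i6 : Integrable (fun ω => x ω ⬝ᵥ Q *ᵥ x ω + u ω ⬝ᵥ R *ᵥ u ω) μ := i1.add i2
  rw [← integral_add i1 i2, ← integral_add i6 i3, ← integral_add i4 i5]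
  exact integral_congr_ae (Filter.Eventually.of_forall fun ω =>
    complete_square hP A B Q hR (x ω) (u ω))

lemma _root_.MeasureTheory.StronglyMeasurable.mulVec {m : MeasurableSpace Ω} {f : Ω → X → ℝ}
    (hf : StronglyMeasurable f) (M : Matrix U X ℝ) : StronglyMeasurable fun ω => M *ᵥ f ω :=
  (mulVecCLM M).continuous.comp_stronglyMeasurable hf

lemma stronglyMeasurable_comp {m : MeasurableSpace Ω} {n : ℕ} {d : Fin (n + 1) → ℕ}
    {f : Ω → (Σ i, Fin (d i)) → ℝ} (hf : StronglyMeasurable f) (i : Fin (n + 1)) :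
    StronglyMeasurable fun ω => comp (f ω) i :=
  (compCLM d i).continuous.comp_stronglyMeasurable hf

end Generic

namespace Primitives

variable {n : ℕ} {S : System n} {Ω : Type*} (P : Primitives S Ω)

section Defs

variable [MeasurableSpace Ω] (μ : Measure Ω)

/-- The deviation `x(t) - x̂(t|c)` of the state. -/
def devState (g : S.Strategy) (t : ℕ) (ω : Ω) : S.State := P.state g t ω - P.estMajor μ g t ω

/-- The deviation `u(t) - u^c(t)` of the actions. -/
def devControl (g : S.Strategy) (t : ℕ) (ω : Ω) : S.Control :=
  P.control g t ω - P.commonControl μ g t ω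

/-- The minor agent's estimate of the deviation of its state, `x̂_i(t|i) - x̂_i(t|c)`. -/
def devEst (g : S.Strategy) (i : Fin n) (t : ℕ) (ω : Ω) : Fin (S.dx i.succ) → ℝ :=
  comp (P.estMinor μ g i t ω) i.succ - comp (P.estMajor μ g t ω) i.succ

/-- The minor agent's estimation error `x_i(t) - x̂_i(t|i)`. -/
def errMinor (g : S.Strategy) (i : Fin n) (t : ℕ) (ω : Ω) : Fin (S.dx i.succ) → ℝ :=
  comp (P.state g t ω) i.succ - comp (P.estMinor μ g i t ω) i.succ

/-- The value function at time `t`. -/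
def value (T : ℕ) (g : S.Strategy) (t : ℕ) : ℝ :=
  ∫ ω, P.estMajor μ g t ω ⬝ᵥ S.riccatiC T t *ᵥ P.estMajor μ g t ω ∂μ
    + ∑ i : Fin n, ∫ ω, comp (P.devState μ g t ω) i.succ ⬝ᵥ
        S.riccatiL T i t *ᵥ comp (P.devState μ g t ω) i.succ ∂μ

/-- The part of the cost at time `t` that the control actions can avoid. -/
def gap (T : ℕ) (g : S.Strategy) (t : ℕ) : ℝ :=
  ∫ ω, (P.commonControl μ g t ω + S.gainC T t *ᵥ P.estMajor μ g t ω) ⬝ᵥ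
      (S.R + S.Bᵀ * S.riccatiC T (t + 1) * S.B) *ᵥ
        (P.commonControl μ g t ω + S.gainC T t *ᵥ P.estMajor μ g t ω) ∂μ
    + ∑ i : Fin n, ∫ ω,
        (comp (P.devControl μ g t ω) i.succ + S.gainL T i t *ᵥ P.devEst μ g i t ω) ⬝ᵥ
        (block S.R i.succ i.succ + (block S.B i.succ i.succ)ᵀ * S.riccatiL T i (t + 1)
          * block S.B i.succ i.succ) *ᵥ
        (comp (P.devControl μ g t ω) i.succ + S.gainL T i t *ᵥ P.devEst μ g i t ω) ∂μ

/-- The part of the cost at time `t` that is caused by the noise and the estimation errors. -/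
def noiseCost (T : ℕ) (g : S.Strategy) (t : ℕ) : ℝ :=
  ∫ ω, stackMM (d := S.dx) (P.w 0 t ω) (fun _ => 0) ⬝ᵥ
      S.riccatiC T (t + 1) *ᵥ stackMM (d := S.dx) (P.w 0 t ω) (fun _ => 0) ∂μ
    + ∑ i : Fin n, (∫ ω, P.w i.succ t ω ⬝ᵥ S.riccatiL T i (t + 1) *ᵥ P.w i.succ t ω ∂μ
      + ∫ ω, (S.gainL T i t *ᵥ P.errMinor μ g i t ω) ⬝ᵥ
          (block S.R i.succ i.succ + (block S.B i.succ i.succ)ᵀ * S.riccatiL T i (t + 1)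
            * block S.B i.succ i.succ) *ᵥ (S.gainL T i t *ᵥ P.errMinor μ g i t ω) ∂μ)

end Defs

variable {P} {T : ℕ}

lemma sigmaMajor_le_past (g : S.Strategy) {t : ℕ} (h1 : 1 ≤ t) (h2 : t ≤ T) :
    P.sigmaMajor g t ≤ P.sig T (S.prims T Set.univ t) := by
  rw [sigmaMajor_eq g h1 h2]
  exact sig_mono (System.prims_mono (Set.subset_univ _) t)

namespace Admissible

variable [mΩ : MeasurableSpace Ω] {μ : Measure Ω} (hP : P.Admissible T μ)
  [IsProbabilityMeasure μ]

include hP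

/-- The deviations of different minor agents from their conditional means given the common
information are orthogonal. -/
lemma orth_dev {X Y : Type} [Fintype X] [Fintype Y] {i j : Fin n} (hij : i ≠ j) {t : ℕ}
    {f : Ω → X → ℝ} {g : Ω → Y → ℝ}
    (hf : MemLp f 2 μ) (hg : MemLp g 2 μ)
    (hfm : Measurable[P.sig T (S.prims T {0, i.succ} t)] f)
    (hgm : Measurable[P.sig T (S.prims T {0, j.succ} t)] g) :
    Orth μ (fun ω => f ω - μ[f | P.sig T (S.prims T {0} t)] ω)
      (fun ω => g ω - μ[g | P.sig T (S.prims T {0} t)] ω) := by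
  have hfE := hf.condExp (m := P.sig T (S.prims T {0} t)) (by norm_num)
  have hgE := hg.condExp (m := P.sig T (S.prims T {0} t)) (by norm_num)
  have hfi : Integrable f μ := hf.integrable (by norm_num)
  have hle : P.sig T (S.prims T {0} t) ≤ P.sig T (S.prims T {0, j.succ} t) :=
    sig_mono (System.prims_mono (by simp) t)
  have hdrop : μ[f | P.sig T (S.prims T {0, j.succ} t)]
      =ᵐ[μ] μ[f | P.sig T (S.prims T {0} t)] := by
    rw [Set.insert_eq, System.prims_union]
    refine hP.condExp_sig_union (a := S.prims T {0, i.succ} t)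
      (System.prims_mono (by simp) t) (System.prims_disjoint ?_ t t) hfm.stronglyMeasurable hfi
    simp [hij.symm, Fin.succ_ne_zero]
  refine orth_of_condExp_eq_zero (m := P.sig T (S.prims T {0, j.succ} t)) (hP.sig_le _)
    (hf.sub hfE) (hg.sub hgE) ?_
    (hgm.stronglyMeasurable.sub (stronglyMeasurable_condExp.mono hle)).aestronglyMeasurable
  have h := condExp_sub hfi (integrable_condExp (μ := μ) (m := P.sig T (S.prims T {0} t)) (f := f))
    (P.sig T (S.prims T {0, j.succ} t))
  rw [condExp_of_stronglyMeasurable (hP.sig_le (S.prims T {0, j.succ} t))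
    (stronglyMeasurable_condExp.mono hle) integrable_condExp] at h
  filter_upwards [h, hdrop] with ω h1 h2
  refine h1.trans ?_
  rw [Pi.sub_apply, h2, sub_self, Pi.zero_apply]

lemma integral_split {d : Fin (n + 1) → ℕ} {t : ℕ} {f : Ω → (Σ i, Fin (d i)) → ℝ}
    (hf : MemLp f 2 μ)
    (h0 : Measurable[P.sig T (S.prims T {0} t)] fun ω => comp (f ω) 0)
    (hi : ∀ i : Fin n, Measurable[P.sig T (S.prims T {0, i.succ} t)]
      fun ω => comp (f ω) i.succ) (M : Matrix (Σ i, Fin (d i)) (Σ i, Fin (d i)) ℝ) :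
    ∫ ω, f ω ⬝ᵥ M *ᵥ f ω ∂μ
      = ∫ ω, μ[f | P.sig T (S.prims T {0} t)] ω ⬝ᵥ M *ᵥ μ[f | P.sig T (S.prims T {0} t)] ω ∂μ
        + ∑ i : Fin n, ∫ ω, comp (f ω - μ[f | P.sig T (S.prims T {0} t)] ω) i.succ ⬝ᵥ
          block M i.succ i.succ *ᵥ comp (f ω - μ[f | P.sig T (S.prims T {0} t)] ω) i.succ ∂μ := by
  have hfi : Integrable f μ := hf.integrable (by norm_num)
  have hfE := hf.condExp (m := P.sig T (S.prims T {0} t)) (by norm_num)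
  rw [integral_dotProduct_mulVec_condExp (hP.sig_le (S.prims T {0} t)) hf]
  congr 1
  refine integral_dotProduct_mulVec_of_orth (hf.sub hfE) ?_ (fun i j hij => ?_) M
  · have h := condExp_of_stronglyMeasurable (hP.sig_le (S.prims T {0} t))
      h0.stronglyMeasurable (integrable_comp hfi 0)
    filter_upwards [condExp_comp (m := P.sig T (S.prims T {0} t)) hfi 0] with ω hω
    rw [Pi.sub_apply, comp_sub, ← hω, h, sub_self]
  · intro k l
    rw [← hP.orth_dev hij (memLp_comp hf i.succ) (memLp_comp hf j.succ) (hi i) (hi j) k l]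
    refine integral_congr_ae ?_
    filter_upwards [condExp_comp (m := P.sig T (S.prims T {0} t)) hfi i.succ,
      condExp_comp (m := P.sig T (S.prims T {0} t)) hfi j.succ] with ω h1 h2
    simp only [h1, h2, comp_sub, Pi.sub_apply]

lemma integral_state (g : S.Strategy) {t : ℕ} (h1 : 1 ≤ t) (h2 : t ≤ T)
    (hx : MemLp (P.state g t) 2 μ) (M : Matrix (Σ i, Fin (S.dx i)) (Σ i, Fin (S.dx i)) ℝ) :
    ∫ ω, P.state g t ω ⬝ᵥ M *ᵥ P.state g t ω ∂μ
      = ∫ ω, P.estMajor μ g t ω ⬝ᵥ M *ᵥ P.estMajor μ g t ω ∂μ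
        + ∑ i : Fin n, ∫ ω, comp (P.devState μ g t ω) i.succ ⬝ᵥ
          block M i.succ i.succ *ᵥ comp (P.devState μ g t ω) i.succ ∂μ := by
  have h := hP.integral_split hx (measurable_sig_major g (Set.mem_singleton 0) h1 h2).1
    (fun i => (measurable_sig_minor g (by simp) (by simp) h1 h2).1) M
  rw [← sigmaMajor_eq g h1 h2] at h
  exact h

lemma integral_control (g : S.Strategy) {t : ℕ} (h1 : 1 ≤ t) (h2 : t ≤ T)
    (hu : MemLp (P.control g t) 2 μ) (M : Matrix (Σ i, Fin (S.du i)) (Σ i, Fin (S.du i)) ℝ) :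
    ∫ ω, P.control g t ω ⬝ᵥ M *ᵥ P.control g t ω ∂μ
      = ∫ ω, P.commonControl μ g t ω ⬝ᵥ M *ᵥ P.commonControl μ g t ω ∂μ
        + ∑ i : Fin n, ∫ ω, comp (P.devControl μ g t ω) i.succ ⬝ᵥ
          block M i.succ i.succ *ᵥ comp (P.devControl μ g t ω) i.succ ∂μ := by
  have h := hP.integral_split hu (measurable_sig_major g (Set.mem_singleton 0) h1 h2).2.1
    (fun i => (measurable_sig_minor g (by simp) (by simp) h1 h2).2.1) M
  rw [← sigmaMajor_eq g h1 h2] at h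
  exact h

lemma memLp_stackMM_w {t : ℕ} (h1 : 1 ≤ t) (h2 : t ≤ T) :
    MemLp (fun ω => stackMM (d := S.dx) (P.w 0 t ω) fun _ => 0) 2 μ := by
  refine memLp_of_comp fun i => ?_
  cases i using Fin.cases with
  | zero => exact hP.memLp_w 0 h1 h2
  | succ i =>
    simp only [comp_stackMM_succ]
    exact memLp_const 0

lemma condExp_w_eq_zero (i : Fin (n + 1)) {t : ℕ} (h1 : 1 ≤ t) (h2 : t ≤ T) :
    μ[P.w i t | P.sig T (S.prims T Set.univ t)] =ᵐ[μ] 0 := by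
  refine hP.condExp_family_eq_zero
    (k := .inr (.inl (i, ⟨t, Finset.mem_Icc.2 ⟨h1, h2⟩⟩))) ?_
  exact fun h => lt_irrefl t h.2

lemma condExp_stackMM_w {t : ℕ} (h1 : 1 ≤ t) (h2 : t ≤ T) :
    μ[fun ω => stackMM (d := S.dx) (P.w 0 t ω) fun _ => 0 | P.sig T (S.prims T Set.univ t)]
      =ᵐ[μ] 0 := by
  have hw := (hP.memLp_stackMM_w h1 h2).integrable (by norm_num)
  have hz : ∀ i : Fin n, μ[fun _ : Ω => (0 : Fin (S.dx i.succ) → ℝ) |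
      P.sig T (S.prims T Set.univ t)] = 0 := fun i => condExp_zero
  filter_upwards [ae_all_iff.2 fun i =>
    condExp_comp (m := P.sig T (S.prims T Set.univ t)) hw i, hP.condExp_w_eq_zero 0 h1 h2]
    with ω h3 h4
  refine ext_comp fun i => ?_
  rw [← h3 i]
  cases i using Fin.cases with
  | zero => exact h4
  | succ i => exact congrFun (hz i) ω

/-- The common part of the one-step identity. -/
lemma integral_estMajor_succ (g : S.Strategy) {t : ℕ} (h1 : 1 ≤ t) (h2 : t < T)
    (hx : MemLp (P.state g t) 2 μ) (hu : MemLp (P.control g t) 2 μ)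
    (M : Matrix (Σ i, Fin (S.dx i)) (Σ i, Fin (S.dx i)) ℝ) :
    ∫ ω, P.estMajor μ g (t + 1) ω ⬝ᵥ M *ᵥ P.estMajor μ g (t + 1) ω ∂μ
      = ∫ ω, (S.A *ᵥ P.estMajor μ g t ω + S.B *ᵥ P.commonControl μ g t ω) ⬝ᵥ
          M *ᵥ (S.A *ᵥ P.estMajor μ g t ω + S.B *ᵥ P.commonControl μ g t ω) ∂μ
        + ∫ ω, stackMM (d := S.dx) (P.w 0 t ω) (fun _ => 0) ⬝ᵥ
          M *ᵥ stackMM (d := S.dx) (P.w 0 t ω) (fun _ => 0) ∂μ := by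
  have hxE : MemLp (P.estMajor μ g t) 2 μ := hx.condExp (by norm_num)
  have huE : MemLp (P.commonControl μ g t) 2 μ := hu.condExp (by norm_num)
  have hy : MemLp (fun ω => S.A *ᵥ P.estMajor μ g t ω + S.B *ᵥ P.commonControl μ g t ω) 2 μ :=
    (hxE.mulVec S.A).add (huE.mulVec S.B)
  have hw := hP.memLp_stackMM_w h1 h2.le
  have hm : StronglyMeasurable[P.sigmaMajor g t]
      fun ω => S.A *ᵥ P.estMajor μ g t ω + S.B *ᵥ P.commonControl μ g t ω := by
    have e1 : StronglyMeasurable[P.sigmaMajor g t] (P.estMajor μ g t) :=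
      stronglyMeasurable_condExp
    have e2 : StronglyMeasurable[P.sigmaMajor g t] (P.commonControl μ g t) :=
      stronglyMeasurable_condExp
    exact (e1.mulVec S.A).add (e2.mulVec S.B)
  have horth := orth_of_condExp_eq_zero (hP.sig_le (S.prims T Set.univ t)) hw hy
    (hP.condExp_stackMM_w h1 h2.le)
    (hm.mono (sigmaMajor_le_past g h1 h2.le)).aestronglyMeasurable
  rw [← horth.symm.integral_add hy hw M]
  refine integral_congr_ae ?_
  filter_upwards [hP.estMajor_succ g h1 h2 (hx.integrable (by norm_num))
    (hu.integrable (by norm_num))] with ω hω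
  rw [hω]

/-- The local part of the one-step identity. -/
lemma integral_devState_succ (g : S.Strategy) (i : Fin n) {t : ℕ} (h1 : 1 ≤ t) (h2 : t < T)
    (hx : MemLp (P.state g t) 2 μ) (hu : MemLp (P.control g t) 2 μ)
    (M : Matrix (Fin (S.dx i.succ)) (Fin (S.dx i.succ)) ℝ) :
    ∫ ω, comp (P.devState μ g (t + 1) ω) i.succ ⬝ᵥ M *ᵥ comp (P.devState μ g (t + 1) ω) i.succ ∂μ
      = ∫ ω, (block S.A i.succ i.succ *ᵥ comp (P.devState μ g t ω) i.succ
            + block S.B i.succ i.succ *ᵥ comp (P.devControl μ g t ω) i.succ) ⬝ᵥ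
          M *ᵥ (block S.A i.succ i.succ *ᵥ comp (P.devState μ g t ω) i.succ
            + block S.B i.succ i.succ *ᵥ comp (P.devControl μ g t ω) i.succ) ∂μ
        + ∫ ω, P.w i.succ t ω ⬝ᵥ M *ᵥ P.w i.succ t ω ∂μ := by
  have hxi := hx.integrable (by norm_num)
  have hui := hu.integrable (by norm_num)
  have hxE : MemLp (P.devState μ g t) 2 μ := hx.sub (hx.condExp (by norm_num))
  have huE : MemLp (P.devControl μ g t) 2 μ := hu.sub (hu.condExp (by norm_num))
  have hy : MemLp (fun ω => block S.A i.succ i.succ *ᵥ comp (P.devState μ g t ω) i.succ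
      + block S.B i.succ i.succ *ᵥ comp (P.devControl μ g t ω) i.succ) 2 μ :=
    ((memLp_comp hxE i.succ).mulVec (block S.A i.succ i.succ)).add
      ((memLp_comp huE i.succ).mulVec (block S.B i.succ i.succ))
  have hw := hP.memLp_w i.succ h1 h2.le
  have hle := sigmaMajor_le_past (P := P) g h1 h2.le
  have hm : StronglyMeasurable[P.sig T (S.prims T Set.univ t)]
      fun ω => block S.A i.succ i.succ *ᵥ comp (P.devState μ g t ω) i.succ
        + block S.B i.succ i.succ *ᵥ comp (P.devControl μ g t ω) i.succ := by
    have e1 : StronglyMeasurable[P.sig T (S.prims T Set.univ t)] (P.devState μ g t) :=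
      (measurable_sig_state g h1 h2.le).stronglyMeasurable.sub
        (stronglyMeasurable_condExp.mono hle)
    have e2 : StronglyMeasurable[P.sig T (S.prims T Set.univ t)] (P.devControl μ g t) :=
      (measurable_sig_control g h1 h2.le).stronglyMeasurable.sub
        (stronglyMeasurable_condExp.mono hle)
    exact ((stronglyMeasurable_comp e1 i.succ).mulVec (block S.A i.succ i.succ)).add
      ((stronglyMeasurable_comp e2 i.succ).mulVec (block S.B i.succ i.succ))
  have horth := orth_of_condExp_eq_zero (hP.sig_le (S.prims T Set.univ t)) hw hy
    (hP.condExp_w_eq_zero i.succ h1 h2.le) hm.aestronglyMeasurable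
  rw [← horth.symm.integral_add hy hw M]
  refine integral_congr_ae ?_
  filter_upwards [hP.estMajor_succ g h1 h2 hxi hui, hP.comp_estMajor_zero g h1 h2.le hxi,
    hP.comp_commonControl_zero g h1 h2.le hui] with ω h3 h4 h5
  have e : comp (P.devState μ g (t + 1) ω) i.succ
      = block S.A i.succ i.succ *ᵥ comp (P.devState μ g t ω) i.succ
        + block S.B i.succ i.succ *ᵥ comp (P.devControl μ g t ω) i.succ + P.w i.succ t ω := by
    rw [devState, devState, devControl, comp_sub, comp_sub, comp_sub, h3,
      P.comp_state_succ_succ g h1, comp_add, comp_add, comp_mulVec_succ_of_sparse S.A_sparse,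
      comp_mulVec_succ_of_sparse S.B_sparse, comp_stackMM_succ, h4, h5]
    simp only [Matrix.mulVec_sub]
    abel
  rw [e]

/-- The minor agent's estimation error is orthogonal to what the agent knows. -/
lemma integral_devControl_add (g : S.Strategy) (i : Fin n) {t : ℕ} (h1 : 1 ≤ t) (h2 : t < T)
    (hx : MemLp (P.state g t) 2 μ) (hu : MemLp (P.control g t) 2 μ)
    (L : Matrix (Fin (S.du i.succ)) (Fin (S.dx i.succ)) ℝ)
    (M : Matrix (Fin (S.du i.succ)) (Fin (S.du i.succ)) ℝ) :
    ∫ ω, (comp (P.devControl μ g t ω) i.succ + L *ᵥ comp (P.devState μ g t ω) i.succ) ⬝ᵥ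
        M *ᵥ (comp (P.devControl μ g t ω) i.succ + L *ᵥ comp (P.devState μ g t ω) i.succ) ∂μ
      = ∫ ω, (comp (P.devControl μ g t ω) i.succ + L *ᵥ P.devEst μ g i t ω) ⬝ᵥ
          M *ᵥ (comp (P.devControl μ g t ω) i.succ + L *ᵥ P.devEst μ g i t ω) ∂μ
        + ∫ ω, (L *ᵥ P.errMinor μ g i t ω) ⬝ᵥ M *ᵥ (L *ᵥ P.errMinor μ g i t ω) ∂μ := by
  have hxi : Integrable (P.state g t) μ := hx.integrable (by norm_num)
  have hm := hP.sigmaMinor_le g i h1 h2.le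
  have hxM : MemLp (P.estMinor μ g i t) 2 μ := hx.condExp (by norm_num)
  have hxC : MemLp (P.estMajor μ g t) 2 μ := hx.condExp (by norm_num)
  have huE : MemLp (P.devControl μ g t) 2 μ := hu.sub (hu.condExp (by norm_num))
  have herr : MemLp (P.errMinor μ g i t) 2 μ := (memLp_comp hx i.succ).sub (memLp_comp hxM i.succ)
  have hest : MemLp (P.devEst μ g i t) 2 μ := (memLp_comp hxM i.succ).sub (memLp_comp hxC i.succ)
  have hy : MemLp (fun ω => comp (P.devControl μ g t ω) i.succ + L *ᵥ P.devEst μ g i t ω) 2 μ :=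
    (memLp_comp huE i.succ).add (hest.mulVec L)
  have hle := sigmaMajor_le_sigmaMinor (P := P) g i t
  have hmeas : StronglyMeasurable[P.sigmaMinor g i t]
      fun ω => comp (P.devControl μ g t ω) i.succ + L *ᵥ P.devEst μ g i t ω := by
    have e1 : StronglyMeasurable[P.sigmaMinor g i t] (P.commonControl μ g t) :=
      stronglyMeasurable_condExp.mono hle
    have e2 : StronglyMeasurable[P.sigmaMinor g i t] (P.estMajor μ g t) :=
      stronglyMeasurable_condExp.mono hle
    have e3 : StronglyMeasurable[P.sigmaMinor g i t] (P.estMinor μ g i t) :=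
      stronglyMeasurable_condExp
    exact ((measurable_sigmaMinor_control g i h1).stronglyMeasurable.sub
      (stronglyMeasurable_comp e1 i.succ)).add
      (((stronglyMeasurable_comp e3 i.succ).sub (stronglyMeasurable_comp e2 i.succ)).mulVec L)
  have herr0 : μ[P.errMinor μ g i t | P.sigmaMinor g i t] =ᵐ[μ] 0 := by
    refine Filter.EventuallyEq.trans (condExp_congr_ae ?_)
      (condExp_sub_condExp hm (integrable_comp hxi i.succ))
    filter_upwards [condExp_comp (m := P.sigmaMinor g i t) hxi i.succ] with ω hω
    rw [hω, errMinor, estMinor]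
  have hL0 : μ[fun ω => L *ᵥ P.errMinor μ g i t ω | P.sigmaMinor g i t] =ᵐ[μ] 0 := by
    filter_upwards [condExp_mulVec (m := P.sigmaMinor g i t) L (herr.integrable (by norm_num)),
      herr0] with ω h3 h4
    rw [h3, h4]
    exact Matrix.mulVec_zero L
  have horth := orth_of_condExp_eq_zero hm (herr.mulVec L) hy hL0
    hmeas.aestronglyMeasurable
  rw [← horth.symm.integral_add hy (herr.mulVec L) M]
  refine integral_congr_ae (Filter.Eventually.of_forall fun ω => ?_)
  have e : comp (P.devControl μ g t ω) i.succ + L *ᵥ comp (P.devState μ g t ω) i.succ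
      = comp (P.devControl μ g t ω) i.succ + L *ᵥ P.devEst μ g i t ω
        + L *ᵥ P.errMinor μ g i t ω := by
    rw [devState, devEst, errMinor, comp_sub, add_assoc, ← Matrix.mulVec_add]
    congr 2
    abel
  simp only [e]

/-- The one-step identity of dynamic programming. -/
lemma stage_add_value (g : S.Strategy) {t : ℕ} (h1 : 1 ≤ t) (h2 : t < T)
    (hx : MemLp (P.state g t) 2 μ) (hu : MemLp (P.control g t) 2 μ) :
    (∫ ω, P.state g t ω ⬝ᵥ S.Q *ᵥ P.state g t ω ∂μ
        + ∫ ω, P.control g t ω ⬝ᵥ S.R *ᵥ P.control g t ω ∂μ) + P.value μ T g (t + 1)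
      = P.value μ T g t + P.gap μ T g t + P.noiseCost μ T g t := by
  have hxE : MemLp (P.estMajor μ g t) 2 μ := hx.condExp (by norm_num)
  have huE : MemLp (P.commonControl μ g t) 2 μ := hu.condExp (by norm_num)
  have hxD : MemLp (P.devState μ g t) 2 μ := hx.sub hxE
  have huD : MemLp (P.devControl μ g t) 2 μ := hu.sub huE
  have ec := integral_complete_square (S.posSemidef_riccatiC T (t + 1)) S.A S.B S.Q S.R_posDef
    hxE huE
  have el := fun i : Fin n => integral_complete_square (S.posSemidef_riccatiL T i (t + 1))
    (block S.A i.succ i.succ) (block S.B i.succ i.succ) (block S.Q i.succ i.succ)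
    (S.posDef_block_R i.succ) (memLp_comp hxD i.succ) (memLp_comp huD i.succ)
  have ed := fun i : Fin n => hP.integral_devControl_add g i h1 h2 hx hu (S.gainL T i t)
    (block S.R i.succ i.succ + (block S.B i.succ i.succ)ᵀ * S.riccatiL T i (t + 1)
      * block S.B i.succ i.succ)
  have en := fun i : Fin n => hP.integral_devState_succ g i h1 h2 hx hu (S.riccatiL T i (t + 1))
  rw [← S.riccatiC_eq h2] at ec
  have es : ∀ i : Fin n, _ := fun i => (el i).trans (congrArg₂ (· + ·)
    (by rw [← S.riccatiL_eq i h2]) (ed i))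
  have es := Finset.sum_congr rfl fun (i : Fin n) (_ : i ∈ Finset.univ) => es i
  have en := Finset.sum_congr rfl fun (i : Fin n) (_ : i ∈ Finset.univ) => en i
  simp only [Finset.sum_add_distrib] at es en
  rw [value, hP.integral_state g h1 h2.le hx, hP.integral_control g h1 h2.le hu,
    hP.integral_estMajor_succ g h1 h2 hx hu, value, gap, noiseCost, en]
  simp only [Finset.sum_add_distrib]
  rw [show S.gainC T t = gainOp (S.riccatiC T (t + 1)) S.A S.B S.R from rfl]
  linarith

end Admissible

end Primitives

/-! ### The total cost -/

namespace Primitives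

variable {n : ℕ} {S : System n} {Ω : Type*} {P : Primitives S Ω} {T : ℕ}

lemma pathCost_nonneg (g : S.Strategy) (ω : Ω) : 0 ≤ P.pathCost T g ω :=
  add_nonneg (Finset.sum_nonneg fun _ _ => add_nonneg (dotProduct_mulVec_nonneg S.Q_posSemidef _)
    (dotProduct_mulVec_nonneg S.R_posDef.posSemidef _)) (dotProduct_mulVec_nonneg S.QT_posSemidef _)

lemma control_cost_le_pathCost (g : S.Strategy) {t : ℕ} (h1 : 1 ≤ t) (h2 : t < T) (ω : Ω) :
    P.control g t ω ⬝ᵥ S.R *ᵥ P.control g t ω ≤ P.pathCost T g ω := by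
  have hs : ∀ s ∈ Finset.Ico 1 T, 0 ≤ P.state g s ω ⬝ᵥ S.Q *ᵥ P.state g s ω
      + P.control g s ω ⬝ᵥ S.R *ᵥ P.control g s ω := fun _ _ =>
    add_nonneg (dotProduct_mulVec_nonneg S.Q_posSemidef _)
      (dotProduct_mulVec_nonneg S.R_posDef.posSemidef _)
  have h := Finset.single_le_sum hs (Finset.mem_Ico.2 ⟨h1, h2⟩)
  have hQ := dotProduct_mulVec_nonneg S.Q_posSemidef (P.state g t ω)
  have hQT := dotProduct_mulVec_nonneg S.QT_posSemidef (P.state g T ω)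
  rw [pathCost]
  linarith

variable [mΩ : MeasurableSpace Ω] {μ : Measure Ω}

lemma gap_nonneg (g : S.Strategy) (t : ℕ) : 0 ≤ P.gap μ T g t :=
  add_nonneg (integral_nonneg fun _ => dotProduct_mulVec_nonneg
      (posDef_weight (S.posSemidef_riccatiC T (t + 1)) S.B S.R_posDef).posSemidef _)
    (Finset.sum_nonneg fun i _ => integral_nonneg fun _ => dotProduct_mulVec_nonneg
      (posDef_weight (S.posSemidef_riccatiL T i (t + 1)) _ (S.posDef_block_R _)).posSemidef _)

lemma value_one_congr (hT : 1 ≤ T) (g g' : S.Strategy) : P.value μ T g 1 = P.value μ T g' 1 := by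
  have hx : P.state g 1 = P.state g' 1 := rfl
  have hs : P.sigmaMajor g 1 = P.sigmaMajor g' 1 := by
    rw [sigmaMajor_eq g le_rfl hT, sigmaMajor_eq g' le_rfl hT]
  simp only [value, devState, estMajor, hs, hx]

/-- The actions at time `t` are given by the gains and the estimates. -/
def FollowsGains (P : Primitives S Ω) (μ : Measure Ω) (T : ℕ) (g : S.Strategy) (t : ℕ) : Prop :=
  ∀ᵐ ω ∂μ,
    comp (P.control g t ω) 0 = -(blockRow (S.gainC T t) 0 *ᵥ P.estMajor μ g t ω) ∧
    ∀ i : Fin n, comp (P.control g t ω) i.succ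
        = -(blockRow (S.gainC T t) i.succ *ᵥ P.estMajor μ g t ω)
          - S.gainL T i t *ᵥ (comp (P.estMinor μ g i t ω) i.succ
              - comp (P.estMajor μ g t ω) i.succ)

lemma memLp_devEst (g : S.Strategy) (i : Fin n) {t : ℕ} (hx : MemLp (P.state g t) 2 μ) :
    MemLp (P.devEst μ g i t) 2 μ := by
  have h1 : MemLp (P.estMinor μ g i t) 2 μ := hx.condExp (by norm_num)
  have h2 : MemLp (P.estMajor μ g t) 2 μ := hx.condExp (by norm_num)
  exact (memLp_comp h1 i.succ).sub (memLp_comp h2 i.succ)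

lemma memLp_control_of_followsGains (g : S.Strategy) {t : ℕ} (hx : MemLp (P.state g t) 2 μ)
    (hf : P.FollowsGains μ T g t) : MemLp (P.control g t) 2 μ := by
  have hE : MemLp (P.estMajor μ g t) 2 μ := hx.condExp (by norm_num)
  refine memLp_of_comp fun i => ?_
  cases i using Fin.cases with
  | zero =>
    refine (hE.mulVec (blockRow (S.gainC T t) 0)).neg.ae_eq ?_
    filter_upwards [hf] with ω hω
    exact hω.1.symm
  | succ i =>
    refine ((hE.mulVec (blockRow (S.gainC T t) i.succ)).neg.sub
      ((memLp_devEst g i hx).mulVec (S.gainL T i t))).ae_eq ?_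
    filter_upwards [hf] with ω hω
    exact (hω.2 i).symm

namespace Admissible

variable (hP : P.Admissible T μ)

include hP

/-- A strategy of finite cost has square integrable actions. -/
lemma memLp_control_of_cost_lt_top (g : S.Strategy) (h : P.cost μ T g < ⊤) {t : ℕ} (h1 : 1 ≤ t)
    (h2 : t < T) : MemLp (P.control g t) 2 μ := by
  have hm := hP.measurable_control g h1 h2.le
  refine memLp_of_integrable_dotProduct_mulVec S.R_posDef hm ?_
  have hc : Continuous fun u : S.Control => u ⬝ᵥ S.R *ᵥ u :=
    continuous_id.dotProduct (mulVecCLM S.R).continuous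
  refine (lintegral_ofReal_ne_top_iff_integrable
    (hc.measurable.comp hm).aestronglyMeasurable (Filter.Eventually.of_forall fun ω =>
      dotProduct_mulVec_nonneg S.R_posDef.posSemidef _)).1 (ne_top_of_le_ne_top h.ne ?_)
  exact lintegral_mono fun ω => ENNReal.ofReal_le_ofReal (control_cost_le_pathCost g h1 h2 ω)

variable [IsProbabilityMeasure μ]

/-- The estimation error does not depend on the strategy. -/
lemma errMinor_congr (g g' : S.Strategy) (i : Fin n) {t : ℕ} (h1 : 1 ≤ t) (h2 : t ≤ T)
    (hx : Integrable (P.state g t) μ) (hx' : Integrable (P.state g' t) μ) :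
    P.errMinor μ g i t =ᵐ[μ] P.errMinor μ g' i t := by
  have hd : StronglyMeasurable[P.sigmaMinor g' i t]
      ((fun ω => comp (P.state g t ω) i.succ) - fun ω => comp (P.state g' t ω) i.succ) :=
    (measurable_sub_state (P := P) g g' i h1).stronglyMeasurable
  have hdi := (integrable_comp hx i.succ).sub (integrable_comp hx' i.succ)
  have h3 := condExp_sub (integrable_comp hx i.succ) (integrable_comp hx' i.succ)
    (P.sigmaMinor g' i t)
  rw [condExp_of_stronglyMeasurable (hP.sigmaMinor_le g' i h1 h2) hd hdi] at h3
  filter_upwards [h3, condExp_comp (m := P.sigmaMinor g' i t) hx i.succ,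
    condExp_comp (m := P.sigmaMinor g' i t) hx' i.succ] with ω h3 h4 h5
  rw [Pi.sub_apply, Pi.sub_apply, h4, h5] at h3
  rw [errMinor, errMinor, estMinor, estMinor, P.sigmaMinor_eq g g' i t]
  rw [sub_eq_sub_iff_add_eq_add] at h3 ⊢
  rw [h3, add_comm]

lemma noiseCost_congr (g g' : S.Strategy) {t : ℕ} (h1 : 1 ≤ t) (h2 : t ≤ T)
    (hx : Integrable (P.state g t) μ) (hx' : Integrable (P.state g' t) μ) :
    P.noiseCost μ T g t = P.noiseCost μ T g' t := by
  rw [noiseCost, noiseCost]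
  congr 1
  refine Finset.sum_congr rfl fun i _ => ?_
  congr 1
  refine integral_congr_ae ?_
  filter_upwards [hP.errMinor_congr g g' i h1 h2 hx hx'] with ω hω
  rw [hω]

/-- The cost of a strategy with square integrable actions. -/
lemma cost_eq (hT : 1 ≤ T) (g : S.Strategy)
    (hu : ∀ t, 1 ≤ t → t < T → MemLp (P.control g t) 2 μ) :
    0 ≤ P.value μ T g 1 + ∑ t ∈ Finset.Ico 1 T, (P.gap μ T g t + P.noiseCost μ T g t) ∧
    P.cost μ T g = ENNReal.ofReal (P.value μ T g 1
      + ∑ t ∈ Finset.Ico 1 T, (P.gap μ T g t + P.noiseCost μ T g t)) := by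
  have hx : ∀ t, 1 ≤ t → t ≤ T → MemLp (P.state g t) 2 μ := fun t h1 h2 =>
    hP.memLp_state g le_rfl hu h1 h2
  have hstage : ∀ t ∈ Finset.Ico 1 T, Integrable (fun ω =>
      P.state g t ω ⬝ᵥ S.Q *ᵥ P.state g t ω + P.control g t ω ⬝ᵥ S.R *ᵥ P.control g t ω) μ := by
    intro t ht
    obtain ⟨h1, h2⟩ := Finset.mem_Ico.1 ht
    exact (integrable_dotProduct_mulVec (hx t h1 h2.le) (hx t h1 h2.le) _).add
      (integrable_dotProduct_mulVec (hu t h1 h2) (hu t h1 h2) _)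
  have hsum := integrable_finsetSum (Finset.Ico 1 T) hstage
  have hlast := integrable_dotProduct_mulVec (hx T hT le_rfl) (hx T hT le_rfl) S.QT
  have hpath : Integrable (P.pathCost T g) μ := hsum.add hlast
  have hvT : ∫ ω, P.state g T ω ⬝ᵥ S.QT *ᵥ P.state g T ω ∂μ = P.value μ T g T := by
    rw [hP.integral_state g hT le_rfl (hx T hT le_rfl), value, S.riccatiC_self]
    simp only [S.riccatiL_self]
  have htel : ∑ t ∈ Finset.Ico 1 T, (P.value μ T g (t + 1) - P.value μ T g t)
      = P.value μ T g T - P.value μ T g 1 := Finset.sum_Ico_sub _ hT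
  have hint : ∫ ω, P.pathCost T g ω ∂μ = P.value μ T g 1
      + ∑ t ∈ Finset.Ico 1 T, (P.gap μ T g t + P.noiseCost μ T g t) := by
    simp only [pathCost]
    rw [integral_add hsum hlast, integral_finsetSum _ hstage, hvT]
    have hstep : ∀ t ∈ Finset.Ico 1 T, ∫ ω, (P.state g t ω ⬝ᵥ S.Q *ᵥ P.state g t ω
        + P.control g t ω ⬝ᵥ S.R *ᵥ P.control g t ω) ∂μ
        = (P.gap μ T g t + P.noiseCost μ T g t)
          - (P.value μ T g (t + 1) - P.value μ T g t) := by
      intro t ht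
      obtain ⟨h1, h2⟩ := Finset.mem_Ico.1 ht
      rw [integral_add (integrable_dotProduct_mulVec (hx t h1 h2.le) (hx t h1 h2.le) _)
        (integrable_dotProduct_mulVec (hu t h1 h2) (hu t h1 h2) _)]
      linarith [hP.stage_add_value g h1 h2 (hx t h1 h2.le) (hu t h1 h2)]
    rw [Finset.sum_congr rfl hstep, Finset.sum_sub_distrib, htel]
    ring
  rw [← hint, cost, ofReal_integral_eq_lintegral_ofReal hpath
    (Filter.Eventually.of_forall (pathCost_nonneg g))]
  exact ⟨integral_nonneg (pathCost_nonneg g), rfl⟩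

/-! ### Strategies that follow the gains -/

lemma condExp_devEst (g : S.Strategy) (i : Fin n) {t : ℕ} (h1 : 1 ≤ t) (h2 : t ≤ T) :
    μ[P.devEst μ g i t | P.sigmaMajor g t] =ᵐ[μ] 0 := by
  have e1 : Integrable (P.estMinor μ g i t) μ := integrable_condExp
  have e2 : Integrable (P.estMajor μ g t) μ := integrable_condExp
  have h3 : μ[P.estMinor μ g i t | P.sigmaMajor g t] =ᵐ[μ] P.estMajor μ g t :=
    condExp_condExp_of_le (sigmaMajor_le_sigmaMinor g i t) (hP.sigmaMinor_le g i h1 h2)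
  have h4 : μ[P.estMajor μ g t | P.sigmaMajor g t] = P.estMajor μ g t :=
    condExp_of_stronglyMeasurable (hP.sigmaMajor_le g h1 h2) stronglyMeasurable_condExp e2
  filter_upwards [condExp_sub (integrable_comp e1 i.succ) (integrable_comp e2 i.succ)
    (P.sigmaMajor g t), condExp_comp (m := P.sigmaMajor g t) e1 i.succ,
    condExp_comp (m := P.sigmaMajor g t) e2 i.succ, h3] with ω h5 h6 h7 h8
  refine h5.trans ?_
  rw [Pi.sub_apply, h6, h7, h8, h4, sub_self, Pi.zero_apply]

lemma memLp_of_followsGains (g : S.Strategy)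
    (hf : ∀ t, 1 ≤ t → t < T → P.FollowsGains μ T g t) {t : ℕ} (h1 : 1 ≤ t) (h2 : t < T) :
    MemLp (P.control g t) 2 μ := by
  suffices h : ∀ t, 1 ≤ t → t ≤ T → MemLp (P.state g t) 2 μ from
    memLp_control_of_followsGains g (h t h1 h2.le) (hf t h1 h2)
  intro t h1 h2
  induction t, h1 using Nat.le_induction with
  | base => exact hP.memLp_state_one g
  | succ t h1 ih =>
    have hx := ih (by omega)
    exact hP.memLp_state_succ g h1 (by omega) le_rfl hx
      (memLp_control_of_followsGains g hx (hf t h1 h2))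

lemma commonControl_of_followsGains (g : S.Strategy) {t : ℕ} (h1 : 1 ≤ t) (h2 : t < T)
    (hx : MemLp (P.state g t) 2 μ) (hf : P.FollowsGains μ T g t) :
    ∀ᵐ ω ∂μ, P.commonControl μ g t ω = -(S.gainC T t *ᵥ P.estMajor μ g t ω) := by
  have hui : Integrable (P.control g t) μ :=
    (memLp_control_of_followsGains g hx hf).integrable (by norm_num)
  have hE : Integrable (P.estMajor μ g t) μ := integrable_condExp
  have hEm : StronglyMeasurable[P.sigmaMajor g t] (P.estMajor μ g t) := stronglyMeasurable_condExp
  have hi : ∀ i : Fin n, ∀ᵐ ω ∂μ, comp (P.commonControl μ g t ω) i.succ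
      = -(blockRow (S.gainC T t) i.succ *ᵥ P.estMajor μ g t ω) := by
    intro i
    have hd : Integrable (P.devEst μ g i t) μ :=
      (memLp_devEst g i hx).integrable (by norm_num)
    have e1 : μ[fun ω => comp (P.control g t ω) i.succ | P.sigmaMajor g t] =ᵐ[μ]
        μ[(fun ω => -(blockRow (S.gainC T t) i.succ *ᵥ P.estMajor μ g t ω))
          - (fun ω => S.gainL T i t *ᵥ P.devEst μ g i t ω) | P.sigmaMajor g t] :=
      condExp_congr_ae (by filter_upwards [hf] with ω hω using hω.2 i)
    have e2 := condExp_sub (hE.mulVec (blockRow (S.gainC T t) i.succ)).neg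
      (hd.mulVec (S.gainL T i t)) (P.sigmaMajor g t)
    have e3 := condExp_of_stronglyMeasurable (hP.sigmaMajor_le g h1 h2.le)
      (hEm.mulVec (blockRow (S.gainC T t) i.succ)).neg
      (hE.mulVec (blockRow (S.gainC T t) i.succ)).neg
    filter_upwards [e1, e2, condExp_comp (m := P.sigmaMajor g t) hui i.succ,
      condExp_mulVec (m := P.sigmaMajor g t) (S.gainL T i t) hd,
      hP.condExp_devEst g i h1 h2.le] with ω f1 f2 f3 f4 f5
    rw [commonControl, ← f3, f1]
    refine f2.trans ?_
    rw [Pi.sub_apply, e3, f4, f5]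
    simp
  filter_upwards [hf, hP.comp_commonControl_zero g h1 h2.le hui, ae_all_iff.2 hi] with ω h3 h4 h5
  refine ext_comp fun i => ?_
  cases i using Fin.cases with
  | zero => rw [h4, h3.1]; rfl
  | succ i => rw [h5 i]; rfl

lemma gap_eq_zero_of_followsGains (g : S.Strategy) {t : ℕ} (h1 : 1 ≤ t) (h2 : t < T)
    (hx : MemLp (P.state g t) 2 μ) (hf : P.FollowsGains μ T g t) : P.gap μ T g t = 0 := by
  have hc := hP.commonControl_of_followsGains g h1 h2 hx hf
  rw [gap, integral_eq_zero_of_ae, zero_add]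
  · refine Finset.sum_eq_zero fun i _ => integral_eq_zero_of_ae ?_
    filter_upwards [hc, hf] with ω h3 h4
    have e : comp (P.devControl μ g t ω) i.succ + S.gainL T i t *ᵥ P.devEst μ g i t ω = 0 := by
      rw [devControl, comp_sub, h4.2 i, h3, comp_neg, comp_mulVec, devEst]
      abel
    rw [e, zero_dotProduct, Pi.zero_apply]
  · filter_upwards [hc] with ω h3
    rw [h3, neg_add_cancel, zero_dotProduct, Pi.zero_apply]

lemma followsGains_of_gap_eq_zero (g : S.Strategy) {t : ℕ} (h1 : 1 ≤ t) (h2 : t < T)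
    (hx : MemLp (P.state g t) 2 μ) (hu : MemLp (P.control g t) 2 μ) (h : P.gap μ T g t = 0) :
    P.FollowsGains μ T g t := by
  have hxE : MemLp (P.estMajor μ g t) 2 μ := hx.condExp (by norm_num)
  have huE : MemLp (P.commonControl μ g t) 2 μ := hu.condExp (by norm_num)
  have huD : MemLp (P.devControl μ g t) 2 μ := hu.sub huE
  have hMc := posDef_weight (S.posSemidef_riccatiC T (t + 1)) S.B S.R_posDef
  have hMl := fun i : Fin n => posDef_weight (S.posSemidef_riccatiL T i (t + 1))
    (block S.B i.succ i.succ) (S.posDef_block_R i.succ)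
  rw [gap, add_eq_zero_iff_of_nonneg
    (integral_nonneg fun _ => dotProduct_mulVec_nonneg hMc.posSemidef _)
    (Finset.sum_nonneg fun i _ => integral_nonneg fun _ =>
      dotProduct_mulVec_nonneg (hMl i).posSemidef _),
    Finset.sum_eq_zero_iff_of_nonneg fun i _ => integral_nonneg fun _ =>
      dotProduct_mulVec_nonneg (hMl i).posSemidef _] at h
  have hc := ae_eq_zero_of_integral_dotProduct_mulVec hMc (huE.add (hxE.mulVec (S.gainC T t))) h.1
  have hl := fun i : Fin n => ae_eq_zero_of_integral_dotProduct_mulVec (hMl i)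
    ((memLp_comp huD i.succ).add ((memLp_devEst g i hx).mulVec (S.gainL T i t)))
    (h.2 i (Finset.mem_univ i))
  filter_upwards [hc, ae_all_iff.2 hl,
    hP.comp_commonControl_zero g h1 h2.le (hu.integrable (by norm_num))] with ω h3 h4 h5
  have h3' : P.commonControl μ g t ω = -(S.gainC T t *ᵥ P.estMajor μ g t ω) :=
    eq_neg_of_add_eq_zero_left h3
  refine ⟨?_, fun i => ?_⟩
  · rw [← h5, h3']
    rfl
  · have h6 : comp (P.control g t ω) i.succ - comp (P.commonControl μ g t ω) i.succ
        = -(S.gainL T i t *ᵥ P.devEst μ g i t ω) := eq_neg_of_add_eq_zero_left (h4 i)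
    rw [sub_eq_iff_eq_add.1 h6, h3', comp_neg, comp_mulVec, devEst]
    abel

end Admissible

end Primitives

/-! ### Existence, optimality and uniqueness -/

/-- The strategy `g`, with the laws at time `t` replaced. -/
def System.Strategy.update {n : ℕ} {S : System n} (g : S.Strategy) (t : ℕ)
    {a : S.InfoMajor t → Fin (S.du 0) → ℝ} (ha : Measurable a)
    {b : (i : Fin n) → S.InfoMinor i t → Fin (S.du i.succ) → ℝ} (hb : ∀ i, Measurable (b i)) :
    S.Strategy where
  major := Function.update g.major t a
  minor i := Function.update (g.minor i) t (b i)
  measurable_major s := by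
    rcases eq_or_ne s t with rfl | h
    · rwa [Function.update_self]
    · rw [Function.update_of_ne h]
      exact g.measurable_major s
  measurable_minor i s := by
    rcases eq_or_ne s t with rfl | h
    · rw [Function.update_self]
      exact hb i
    · rw [Function.update_of_ne h]
      exact g.measurable_minor i s

namespace Primitives

variable {n : ℕ} {S : System n} {Ω : Type*} {P : Primitives S Ω} {T : ℕ}

lemma info_congr {g g' : S.Strategy} {t : ℕ} {ω : Ω}
    (h : ∀ s, 1 ≤ s → s < t → P.control g s ω = P.control g' s ω) :
    P.state g t ω = P.state g' t ω ∧ P.infoMajor g t ω = P.infoMajor g' t ω ∧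
      ∀ i, P.infoMinor g i t ω = P.infoMinor g' i t ω :=
  ⟨P.stateOf_congr h, P.infoMajorOf_congr h, fun _ => P.infoMinorOf_congr h⟩

variable [mΩ : MeasurableSpace Ω] {μ : Measure Ω}

lemma est_congr {g g' : S.Strategy} {t : ℕ}
    (h : ∀ ω s, 1 ≤ s → s < t → P.control g s ω = P.control g' s ω) :
    P.estMajor μ g t = P.estMajor μ g' t ∧ ∀ i, P.estMinor μ g i t = P.estMinor μ g' i t := by
  have h1 : P.state g t = P.state g' t := funext fun ω => (info_congr (h ω)).1
  have h2 : P.infoMajor g t = P.infoMajor g' t := funext fun ω => (info_congr (h ω)).2.1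
  have h3 : ∀ i, P.infoMinor g i t = P.infoMinor g' i t := fun i =>
    funext fun ω => (info_congr (h ω)).2.2 i
  refine ⟨?_, fun i => ?_⟩
  · rw [estMajor, estMajor, sigmaMajor, sigmaMajor, h1, h2]
  · rw [estMinor, estMinor, sigmaMinor, sigmaMinor, h1, h3 i]

variable (P μ T)

lemma exists_followsGains_le (k : ℕ) :
    ∃ g : S.Strategy, ∀ t, 1 ≤ t → t ≤ k → P.FollowsGains μ T g t := by
  induction k with
  | zero =>
    exact ⟨⟨fun _ _ => 0, fun _ _ _ => 0, fun _ => measurable_const, fun _ _ => measurable_const⟩,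
      fun t h1 h2 => by omega⟩
  | succ k ih =>
    obtain ⟨g, hg⟩ := ih
    have hE : StronglyMeasurable[P.sigmaMajor g (k + 1)] (P.estMajor μ g (k + 1)) :=
      stronglyMeasurable_condExp
    obtain ⟨a, ha, hae⟩ :=
      (hE.mulVec (blockRow (S.gainC T (k + 1)) 0)).neg.measurable.exists_eq_measurable_comp
    have hb : ∀ i : Fin n, ∃ b : S.InfoMinor i (k + 1) → Fin (S.du i.succ) → ℝ, Measurable b ∧
        (fun ω => -(blockRow (S.gainC T (k + 1)) i.succ *ᵥ P.estMajor μ g (k + 1) ω)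
          - S.gainL T i (k + 1) *ᵥ (comp (P.estMinor μ g i (k + 1) ω) i.succ
              - comp (P.estMajor μ g (k + 1) ω) i.succ)) = b ∘ P.infoMinor g i (k + 1) := by
      intro i
      have hM : StronglyMeasurable[P.sigmaMinor g i (k + 1)] (P.estMinor μ g i (k + 1)) :=
        stronglyMeasurable_condExp
      have hE' := hE.mono (sigmaMajor_le_sigmaMinor g i (k + 1))
      have h := (hE'.mulVec (blockRow (S.gainC T (k + 1)) i.succ)).neg.sub
        (((stronglyMeasurable_comp hM i.succ).sub
          (stronglyMeasurable_comp hE' i.succ)).mulVec (S.gainL T i (k + 1)))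
      exact h.measurable.exists_eq_measurable_comp
    choose b hb hbe using hb
    have hcong : ∀ ω s, 1 ≤ s → s < k + 1 →
        P.control (g.update (k + 1) ha hb) s ω = P.control g s ω := fun ω =>
      P.control_congr (fun s _ hs => Function.update_of_ne hs.ne _ _)
        (fun i s _ hs => Function.update_of_ne hs.ne _ _) ω
    refine ⟨g.update (k + 1) ha hb, fun t h1 h2 => ?_⟩
    have hest := est_congr (P := P) (μ := μ) (t := t) fun ω s h3 h4 =>
      hcong ω s h3 (h4.trans_le h2)
    rcases h2.lt_or_eq with h2 | rfl
    · have hgt := hg t h1 (by omega)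
      simp only [FollowsGains, hest.1, hest.2, hcong _ t h1 h2]
      exact hgt
    · refine Filter.Eventually.of_forall fun ω => ?_
      obtain ⟨-, hI, hJ⟩ := info_congr (P := P) (hcong ω)
      rw [hest.1]
      refine ⟨?_, fun i => ?_⟩
      · rw [P.comp_control_zero _ h1, hI]
        exact (congrFun (Function.update_self (k + 1) a g.major) _).trans (congrFun hae ω).symm
      · rw [P.comp_control_succ _ h1, hJ i, hest.2 i]
        exact (congrFun (Function.update_self (k + 1) (b i) (g.minor i)) _).trans
          (congrFun (hbe i) ω).symm

variable {P μ T}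

lemma control_unique {g g' : S.Strategy} (hg : ∀ t, 1 ≤ t → t < T → P.FollowsGains μ T g t)
    (hg' : ∀ t, 1 ≤ t → t < T → P.FollowsGains μ T g' t) {t : ℕ} (h1 : 1 ≤ t) (h2 : t < T) :
    P.control g t =ᵐ[μ] P.control g' t := by
  induction t using Nat.strong_induction_on with
  | _ t ih =>
    have hpast : ∀ᵐ ω ∂μ, ∀ s, 1 ≤ s → s < t → P.control g s ω = P.control g' s ω := by
      refine ae_all_iff.2 fun s => ?_
      by_cases hs : 1 ≤ s ∧ s < t
      · filter_upwards [ih s hs.2 hs.1 (hs.2.trans h2)] with ω hω _ _ using hω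
      · exact Filter.Eventually.of_forall fun ω h3 h4 => absurd ⟨h3, h4⟩ hs
    have hx : P.state g t =ᵐ[μ] P.state g' t := by
      filter_upwards [hpast] with ω hω using (info_congr hω).1
    have hE : P.estMajor μ g t =ᵐ[μ] P.estMajor μ g' t := by
      rw [estMajor, estMajor, sigmaMajor_eq g h1 h2.le, sigmaMajor_eq g' h1 h2.le]
      exact condExp_congr_ae hx
    have hM : ∀ i, P.estMinor μ g i t =ᵐ[μ] P.estMinor μ g' i t := fun i => by
      rw [estMinor, estMinor, P.sigmaMinor_eq g g' i t]
      exact condExp_congr_ae hx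
    filter_upwards [hg t h1 h2, hg' t h1 h2, hE, ae_all_iff.2 hM] with ω h3 h4 h5 h6
    refine ext_comp fun i => ?_
    cases i using Fin.cases with
    | zero => rw [h3.1, h4.1, h5]
    | succ i => rw [h3.2 i, h4.2 i, h5, h6 i]

namespace Admissible

variable (hP : P.Admissible T μ)

include hP

lemma law_unique {g g' : S.Strategy} {t : ℕ} (h1 : 1 ≤ t) (h2 : t < T)
    (h : ∀ s, 1 ≤ s → s < T → P.control g s =ᵐ[μ] P.control g' s) :
    g.major t =ᵐ[μ.map (P.infoMajor g t)] g'.major t ∧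
      ∀ i, g.minor i t =ᵐ[μ.map (P.infoMinor g i t)] g'.minor i t := by
  have hpast : ∀ᵐ ω ∂μ, ∀ s, 1 ≤ s → s < T → P.control g s ω = P.control g' s ω := by
    refine ae_all_iff.2 fun s => ?_
    by_cases hs : 1 ≤ s ∧ s < T
    · filter_upwards [h s hs.1 hs.2] with ω hω _ _ using hω
    · exact Filter.Eventually.of_forall fun ω h3 h4 => absurd ⟨h3, h4⟩ hs
  refine ⟨?_, fun i => ?_⟩
  · refine (ae_map_iff (hP.measurable_infoMajor g h1 h2.le).aemeasurable
      (measurableSet_eq_fun (g.measurable_major t) (g'.measurable_major t))).2 ?_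
    filter_upwards [hpast] with ω hω
    have hI := (info_congr (P := P) fun s h3 h4 => hω s h3 (h4.trans h2)).2.1
    rw [← P.comp_control_zero g h1, hω t h1 h2, P.comp_control_zero g' h1, hI]
  · refine (ae_map_iff (hP.measurable_infoMinor g i h1 h2.le).aemeasurable
      (measurableSet_eq_fun (g.measurable_minor i t) (g'.measurable_minor i t))).2 ?_
    filter_upwards [hpast] with ω hω
    have hI := (info_congr (P := P) fun s h3 h4 => hω s h3 (h4.trans h2)).2.2 i
    rw [← P.comp_control_succ g h1, hω t h1 h2, P.comp_control_succ g' h1, hI]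

variable [IsProbabilityMeasure μ]

/-- The cost of a strategy with square integrable actions exceeds the cost of a strategy that
follows the gains by the sum of the gaps. -/
lemma cost_eq_add_gap (hT : 1 ≤ T) {g g' : S.Strategy}
    (hg : ∀ t, 1 ≤ t → t < T → P.FollowsGains μ T g t)
    (hu : ∀ t, 1 ≤ t → t < T → MemLp (P.control g' t) 2 μ) :
    P.cost μ T g < ⊤ ∧
      P.cost μ T g' = P.cost μ T g + ENNReal.ofReal (∑ t ∈ Finset.Ico 1 T, P.gap μ T g' t) := by
  have hug : ∀ t, 1 ≤ t → t < T → MemLp (P.control g t) 2 μ := fun t h1 h2 =>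
    hP.memLp_of_followsGains g hg h1 h2
  obtain ⟨h0, h1⟩ := hP.cost_eq hT g hug
  obtain ⟨-, h3⟩ := hP.cost_eq hT g' hu
  have hgap : ∑ t ∈ Finset.Ico 1 T, P.gap μ T g t = 0 := Finset.sum_eq_zero fun t ht => by
    obtain ⟨h4, h5⟩ := Finset.mem_Ico.1 ht
    exact hP.gap_eq_zero_of_followsGains g h4 h5 (hP.memLp_state g le_rfl hug h4 h5.le)
      (hg t h4 h5)
  have hnoise : ∑ t ∈ Finset.Ico 1 T, P.noiseCost μ T g' t
      = ∑ t ∈ Finset.Ico 1 T, P.noiseCost μ T g t := Finset.sum_congr rfl fun t ht => by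
    obtain ⟨h4, h5⟩ := Finset.mem_Ico.1 ht
    exact hP.noiseCost_congr g' g h4 h5.le
      ((hP.memLp_state g' le_rfl hu h4 h5.le).integrable (by norm_num))
      ((hP.memLp_state g le_rfl hug h4 h5.le).integrable (by norm_num))
  refine ⟨by rw [h1]; exact ENNReal.ofReal_lt_top, ?_⟩
  rw [h1, h3, ← ENNReal.ofReal_add h0 (Finset.sum_nonneg fun t _ => gap_nonneg g' t),
    value_one_congr hT g' g, Finset.sum_add_distrib, Finset.sum_add_distrib, hnoise, hgap]
  congr 1
  ring

lemma isOptimal_iff (hT : 1 ≤ T) (g : S.Strategy) :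
    P.IsOptimal μ T g ↔ ∀ t, 1 ≤ t → t < T → P.FollowsGains μ T g t := by
  constructor
  · intro hopt
    obtain ⟨g₀, hg₀⟩ := exists_followsGains_le P T μ T
    have hg₀ := fun t (h1 : 1 ≤ t) (h2 : t < T) => hg₀ t h1 h2.le
    have hfin := (hP.cost_eq_add_gap hT hg₀ fun t => hP.memLp_of_followsGains g₀ hg₀).1
    have hu : ∀ t, 1 ≤ t → t < T → MemLp (P.control g t) 2 μ := fun t =>
      hP.memLp_control_of_cost_lt_top g ((hopt g₀).trans_lt hfin)
    have h := hopt g₀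
    rw [(hP.cost_eq_add_gap hT hg₀ hu).2] at h
    have h0 : ENNReal.ofReal (∑ t ∈ Finset.Ico 1 T, P.gap μ T g t) = 0 := by
      refine le_antisymm ?_ bot_le
      refine (ENNReal.add_le_add_iff_left hfin.ne).1 ?_
      rwa [add_zero]
    have h0 := le_antisymm (ENNReal.ofReal_eq_zero.1 h0)
      (Finset.sum_nonneg fun t _ => gap_nonneg g t)
    intro t h1 h2
    exact hP.followsGains_of_gap_eq_zero g h1 h2 (hP.memLp_state g le_rfl hu h1 h2.le)
      (hu t h1 h2) ((Finset.sum_eq_zero_iff_of_nonneg fun t _ => gap_nonneg g t).1 h0 t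
        (Finset.mem_Ico.2 ⟨h1, h2⟩))
  · intro hg g'
    rcases eq_or_ne (P.cost μ T g') ⊤ with h | h
    · rw [h]
      exact le_top
    · rw [(hP.cost_eq_add_gap hT hg fun t =>
        hP.memLp_control_of_cost_lt_top g' h.lt_top).2]
      exact le_self_add

lemma exists_isOptimal (hT : 1 ≤ T) : ∃ g : S.Strategy, P.IsOptimal μ T g := by
  obtain ⟨g, hg⟩ := exists_followsGains_le P T μ T
  exact ⟨g, (hP.isOptimal_iff hT g).2 fun t h1 h2 => hg t h1 h2.le⟩

/-- The recursion of the major agent's estimate, in terms of the observed quantities. -/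
lemma estMajor_succ_observed (g : S.Strategy) {t : ℕ} (h1 : 1 ≤ t) (h2 : t < T)
    (hx : Integrable (P.state g t) μ) (hu : Integrable (P.control g t) μ) :
    ∀ᵐ ω ∂μ, P.estMajor μ g (t + 1) ω
      = S.A *ᵥ stackMM (comp (P.state g t ω) 0) (fun i => comp (P.estMajor μ g t ω) i.succ)
        + S.B *ᵥ stackMM (comp (P.control g t ω) 0)
            (fun i => comp (P.commonControl μ g t ω) i.succ)
        + stackMM (comp (P.state g (t + 1) ω) 0 - block S.A 0 0 *ᵥ comp (P.state g t ω) 0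
            - block S.B 0 0 *ᵥ comp (P.control g t ω) 0) fun _ => 0 := by
  filter_upwards [hP.estMajor_succ g h1 h2 hx hu, hP.comp_estMajor_zero g h1 h2.le hx,
    hP.comp_commonControl_zero g h1 h2.le hu] with ω h3 h4 h5
  have e1 : stackMM (comp (P.state g t ω) 0) (fun i => comp (P.estMajor μ g t ω) i.succ)
      = P.estMajor μ g t ω := ext_comp fun i => by
    cases i using Fin.cases with
    | zero => rw [comp_stackMM_zero, h4]
    | succ i => rw [comp_stackMM_succ]
  have e2 : stackMM (comp (P.control g t ω) 0) (fun i => comp (P.commonControl μ g t ω) i.succ)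
      = P.commonControl μ g t ω := ext_comp fun i => by
    cases i using Fin.cases with
    | zero => rw [comp_stackMM_zero, h5]
    | succ i => rw [comp_stackMM_succ]
  have e3 : comp (P.state g (t + 1) ω) 0 - block S.A 0 0 *ᵥ comp (P.state g t ω) 0
      - block S.B 0 0 *ᵥ comp (P.control g t ω) 0 = P.w 0 t ω := by
    rw [P.comp_state_succ_zero g h1]
    abel
  rw [e1, e2, e3, h3]

lemma estMinor_eq_integral (g : S.Strategy) (i : Fin n) {t : ℕ} (h1 : 1 ≤ t) (h2 : t ≤ T)
    (hx : Integrable (P.state g t) μ)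
    {f : S.InfoMinor i t → (Fin (S.dx i.succ) → ℝ) → ℝ≥0∞}
    (hf : IsCondDensity μ (fun ω => comp (P.state g t ω) i.succ) (P.infoMinor g i t) f) :
    ∀ᵐ ω ∂μ, Integrable (fun x => (f (P.infoMinor g i t ω) x).toReal • x) volume ∧
      comp (P.estMinor μ g i t ω) i.succ = ∫ x, (f (P.infoMinor g i t ω) x).toReal • x := by
  filter_upwards [hf.condExp_eq_integral (integrable_comp hx i.succ)
    (hP.measurable_infoMinor g i h1 h2), condExp_comp (m := P.sigmaMinor g i t) hx i.succ]
    with ω h3 h4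
  exact ⟨h3.1, h4.symm.trans h3.2⟩

end Admissible

end Primitives

end MajorMinor
end

theorem mainTheorem1 {n T : ℕ} (hT : 1 ≤ T) (S : MajorMinor.System n)
    {Ω : Type*} [MeasurableSpace Ω] (μ : Measure Ω) [IsProbabilityMeasure μ]
    (P : MajorMinor.Primitives S Ω) (hP : P.Admissible T μ) :
    -- an optimal general strategy exists
    (∃ g : S.Strategy, P.IsOptimal μ T g) ∧
    -- a strategy is optimal if and only if its actions are given by the stated formulas
    (∀ g : S.Strategy, P.IsOptimal μ T g ↔ ∀ t, 1 ≤ t → t < T → ∀ᵐ ω ∂μ,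
      MajorMinor.comp (P.control g t ω) 0
          = -(MajorMinor.blockRow (S.gainC T t) 0 *ᵥ P.estMajor μ g t ω) ∧
      ∀ i : Fin n, MajorMinor.comp (P.control g t ω) i.succ
          = -(MajorMinor.blockRow (S.gainC T t) i.succ *ᵥ P.estMajor μ g t ω)
            - S.gainL T i t *ᵥ (MajorMinor.comp (P.estMinor μ g i t ω) i.succ
                - MajorMinor.comp (P.estMajor μ g t ω) i.succ)) ∧
    -- an optimal strategy has finite cost and square integrable actions, and its common
    -- control is `-L^c(t) x̂(t|c)`
    (∀ g : S.Strategy, P.IsOptimal μ T g → P.cost μ T g < ⊤ ∧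
      ∀ t, 1 ≤ t → t < T → MemLp (P.control g t) 2 μ ∧
        ∀ᵐ ω ∂μ, P.commonControl μ g t ω = -(S.gainC T t *ᵥ P.estMajor μ g t ω)) ∧
    -- the optimal strategy is unique: the control laws agree almost everywhere with respect to
    -- the law of the information, and the actions agree almost surely
    (∀ g g' : S.Strategy, P.IsOptimal μ T g → P.IsOptimal μ T g' →
      ∀ t, 1 ≤ t → t < T →
        P.control g t =ᵐ[μ] P.control g' t ∧
        g.major t =ᵐ[μ.map (P.infoMajor g t)] g'.major t ∧
        ∀ i : Fin n, g.minor i t =ᵐ[μ.map (P.infoMinor g i t)] g'.minor i t) ∧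
    -- the linear recursion of the major agent's estimate, for every strategy with integrable
    -- actions
    (∀ g : S.Strategy, (∀ t, 1 ≤ t → t < T → Integrable (P.control g t) μ) →
      (∀ᵐ ω ∂μ, P.estMajor μ g 1 ω
        = MajorMinor.stackMM (MajorMinor.comp (P.state g 1 ω) 0) fun _ => 0) ∧
      ∀ t, 1 ≤ t → t < T → ∀ᵐ ω ∂μ, P.estMajor μ g (t + 1) ω
        = S.A *ᵥ MajorMinor.stackMM (MajorMinor.comp (P.state g t ω) 0)
              (fun i => MajorMinor.comp (P.estMajor μ g t ω) i.succ)
          + S.B *ᵥ MajorMinor.stackMM (MajorMinor.comp (P.control g t ω) 0)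
              (fun i => MajorMinor.comp (P.commonControl μ g t ω) i.succ)
          + MajorMinor.stackMM (MajorMinor.comp (P.state g (t + 1) ω) 0
                - MajorMinor.block S.A 0 0 *ᵥ MajorMinor.comp (P.state g t ω) 0
                - MajorMinor.block S.B 0 0 *ᵥ MajorMinor.comp (P.control g t ω) 0)
              fun _ => 0) ∧
    -- the minor agent's estimate is the mean of the conditional density
    (∀ g : S.Strategy, (∀ t, 1 ≤ t → t < T → Integrable (P.control g t) μ) →
      ∀ (i : Fin n) (t : ℕ), 1 ≤ t → t ≤ T →
      ∀ f : S.InfoMinor i t → (Fin (S.dx i.succ) → ℝ) → ℝ≥0∞,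
        MajorMinor.IsCondDensity μ (fun ω => MajorMinor.comp (P.state g t ω) i.succ)
          (P.infoMinor g i t) f →
        ∀ᵐ ω ∂μ, Integrable (fun x => (f (P.infoMinor g i t ω) x).toReal • x) volume ∧
          MajorMinor.comp (P.estMinor μ g i t ω) i.succ
            = ∫ x, (f (P.infoMinor g i t ω) x).toReal • x) ∧
    -- the initial conditional density, for every strategy
    (∀ (g : S.Strategy) (i : Fin n) (ξ : (Fin (S.dx i.succ) → ℝ) → ℝ≥0∞)
      (ν : (Fin (S.dy i) → ℝ) → ℝ≥0∞),
      MajorMinor.HasDensity μ (P.init i.succ) ξ → MajorMinor.HasDensity μ (P.v i 1) ν →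
      MajorMinor.IsCondDensity μ (fun ω => MajorMinor.comp (P.state g 1 ω) i.succ)
        (P.infoMinor g i 1) (S.bayesInit i ξ ν)) ∧
    -- the Bayesian filter, for every strategy
    (∀ (g : S.Strategy) (i : Fin n) (t : ℕ) (ht : 1 ≤ t), t < T →
      ∀ (φ₀ : (Fin (S.dx 0) → ℝ) → ℝ≥0∞) (φ : (Fin (S.dx i.succ) → ℝ) → ℝ≥0∞)
        (ν : (Fin (S.dy i) → ℝ) → ℝ≥0∞),
      MajorMinor.HasDensity μ (P.w 0 t) φ₀ → MajorMinor.HasDensity μ (P.w i.succ t) φ →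
      MajorMinor.HasDensity μ (P.v i (t + 1)) ν →
      ∀ f : S.InfoMinor i t → (Fin (S.dx i.succ) → ℝ) → ℝ≥0∞,
        MajorMinor.IsCondDensity μ (fun ω => MajorMinor.comp (P.state g t ω) i.succ)
          (P.infoMinor g i t) f →
        MajorMinor.IsCondDensity μ (fun ω => MajorMinor.comp (P.state g (t + 1) ω) i.succ)
          (P.infoMinor g i (t + 1)) (S.bayesUpdate ht φ₀ φ ν f)) := by
  refine ⟨hP.exists_isOptimal hT, hP.isOptimal_iff hT, fun g hg => ?_, fun g g' hg hg' => ?_,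
    fun g hu => ⟨hP.estMajor_one hT g, fun t h1 h2 => hP.estMajor_succ_observed g h1 h2
      (hP.integrable_state g hu h1 h2.le) (hu t h1 h2)⟩,
    fun g hu i t h1 h2 f hf => hP.estMinor_eq_integral g i h1 h2
      (hP.integrable_state g hu h1 h2) hf,
    fun g i ξ ν hξ hν => hP.isCondDensity_bayesInit hT g i hξ hν,
    fun g i t ht h2 φ₀ φ ν hφ₀ hφ hν f hf =>
      hP.isCondDensity_bayesUpdate g i ht h2 hφ₀ hφ hν hf⟩
  · have hf := (hP.isOptimal_iff hT g).1 hg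
    have hu := fun t (h1 : 1 ≤ t) (h2 : t < T) => hP.memLp_of_followsGains g hf h1 h2
    exact ⟨(hP.cost_eq_add_gap hT hf hu).1, fun t h1 h2 => ⟨hu t h1 h2,
      hP.commonControl_of_followsGains g h1 h2 (hP.memLp_state g le_rfl hu h1 h2.le)
        (hf t h1 h2)⟩⟩
  · intro t h1 h2
    have hc := fun s (h3 : 1 ≤ s) (h4 : s < T) => MajorMinor.Primitives.control_unique
      ((hP.isOptimal_iff hT g).1 hg) ((hP.isOptimal_iff hT g').1 hg') h3 h4
    exact ⟨hc t h1 h2, hP.law_unique h1 h2 hc⟩
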